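/- Let $G$ be a finite group. A generalised (virtual) character of $G$ is a $\mathbb{Z}$-linear combination of characters of irreducible complex representations of $G$; its degree is its value at $1\in G$. A permutation character of $G$ is a $\mathbb{Z}$-linear combination of characters of permutation representations $\mathbb{C}[X]$, with $X$ a finite $G$-set. The determinant $\det\tau$ of the character $\tau$ of a representation $V$ is the linear character $g\mapsto\det(g\mid V)$, and for generalised characters one sets $\det(\tau_1-\tau_2)=\det\tau_1\cdot\overline{\det\tau_2}$, where $\tau_1,\tau_2$ are characters of representations. Let $D_{2n}$ denote the dihedral group of order $2n$. Let $\mathcal{P}$ be a set of real-valued generalised characters of $G$ such that 1. $\tau+\bar\tau\in\mathcal{P}$ for every generalised character $\tau$ of $G$ of degree $0$; 2. $\mathrm{Ind}_H^G(\tau-\mathbb{1}_H-\det\tau)\in\mathcal{P}$ for every subgroup $H\le G$ and every character $\tau$ of a $2$-dimensional complex representation of $H$ that factors through a quotient of $H$ isomorphic to $C_2\times C_2$, to $D_8$, or to $D_{2p}$ for some odd prime $p$; 3. if $\tau_1,\dots,\tau_k\in\mathcal{P}$ and $n_1,\dots,n_k\in\mathbb{Z}$, then $\sum_i n_i\tau_i\in\mathcal{P}$.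 Then $\mathcal{P}$ contains every permutation character of $G$ of degree $0$ with trivial determinant. -/

import Mathlib

universe u

namespace CharInduction

/-- The generalised (virtual) characters of `G`: the `ℤ`-linear combinations of the characters of
irreducible complex representations of `G`, as functions `G → ℂ`. -/
def generalisedCharacters (G : Type u) [Group G] : AddSubgroup (G → ℂ) :=
  AddSubgroup.closure
    {χ | ∃ V : FDRep.{0, u} ℂ G, Representation.IsIrreducible V.ρ ∧ χ = V.character}

/-- The permutation characters of `G`: the `ℤ`-linear combinations of the characters of the
permutation representations `ℂ[X]`, where `X` is a finite `G`-set. -/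
def permutationCharacters (G : Type u) [Group G] : AddSubgroup (G → ℂ) :=
  AddSubgroup.closure
    {χ | ∃ (X : Type u) (_ : Finite X) (_ : MulAction G X),
      χ = (Representation.ofMulAction ℂ G X).character}

/-- The determinant `g ↦ det (g | V)` of a representation `V`, as a function `G → ℂ`. -/
noncomputable def repDet {G : Type u} [Group G] (V : FDRep.{0, u} ℂ G) : G → ℂ :=
  fun g => LinearMap.det (V.ρ g)

/-- `δ` is the determinant of the generalised character `χ`: writing `χ = τ₁ - τ₂` with `τ₁, τ₂`
characters of representations `V, W`, one has `δ = det V * conj (det W)`. (Complex representations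
of a finite group are determined by their characters, so `δ` depends on `χ` only.) -/
def HasDet {G : Type u} [Group G] (χ δ : G → ℂ) : Prop :=
  ∃ V W : FDRep.{0, u} ℂ G, χ = V.character - W.character ∧
    ∀ g, δ g = repDet V g * starRingEnd ℂ (repDet W g)

open scoped Classical in
/-- Induction of class functions from a subgroup `H` to `G`:
`(Ind ψ)(g) = |H|⁻¹ ∑ ψ(x⁻¹ g x)`, the sum being over the `x ∈ G` with `x⁻¹ g x ∈ H`. -/
noncomputable def ind {G : Type u} [Group G] [Fintype G] (H : Subgroup G) (ψ : H → ℂ) : G → ℂ :=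
  fun g => (Nat.card H : ℂ)⁻¹ *
    ∑ x : G, if hx : x⁻¹ * g * x ∈ H then ψ ⟨x⁻¹ * g * x, hx⟩ else 0

/-- `Q` is isomorphic to `C₂ × C₂`, to the dihedral group of order `8`, or to the dihedral group
of order `2p` for an odd prime `p`. (`DihedralGroup n` has order `2n`.) -/
def IsBasicDihedral (Q : Type u) [Group Q] : Prop :=
  Nonempty (Q ≃* Multiplicative (ZMod 2) × Multiplicative (ZMod 2)) ∨
  Nonempty (Q ≃* DihedralGroup 4) ∨
  ∃ p : ℕ, p.Prime ∧ Odd p ∧ Nonempty (Q ≃* DihedralGroup p)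

/-- The representation `V` (equivalently, its character) factors through a quotient `G ⧸ N`
isomorphic to `C₂ × C₂`, `D₈` or `D₂ₚ` with `p` an odd prime. -/
def FactorsThroughBasicDihedral {G : Type u} [Group G] (V : FDRep.{0, u} ℂ G) : Prop :=
  ∃ (N : Subgroup G) (_ : N.Normal), (∀ n ∈ N, V.ρ n = 1) ∧ IsBasicDihedral (G ⧸ N)

end CharInduction

/-! The determinant of `ℂ[X]` is the sign character `sgn G X`, so a permutation character of degree
`0` with trivial determinant is `ℂ[X] - ℂ[Y]` with `|X| = |Y|` and equal signs
(`balancedCharacters`). By condition 1, twice such a difference lies in `P`. It therefore suffices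
to put one odd multiple of it in `P`.

For a group `E` with a normal cyclic subgroup `C` of odd order and `2`-power index, a stronger
statement holds (`SignCongr`): modulo `P`, `ℂ[X]` is its sign character plus `|X| - 1` copies of the
trivial one. The quotient `C₂ × C₂` gives `ε₁ + ε₂ ≡ 1 + ε₁ε₂` for quadratic characters, which
reduces `SignCongr` to coset spaces `E/H`, treated by induction on `|E|`. If `HC ≠ E`, then `HC`
lies in a subgroup of index two. A quadratic character `δ` induced from there is congruent to `1 +
det` of the induced representation: either `δ` extends up to a fourth root of unity, or `D₈` appears
(`Admissible.indHom_sign_index_two_mem`). If `HC = E ≠ H`, then `E` acts on an affine line `𝔽_q`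
with `q` an odd prime. Fourier analysis on `𝔽_q` together with the `D_{2q}` relation handles the
stabiliser `M` of `0` (`AffineHom.signCongr_quotient`), and `Admissible.signCongr_of_le` descends
from `M` to `H`.

The passage to general `G` is a Solomon-type induction argument. For each `x` there is such an `E`
for which `x` has an odd number of fixed points on `G/E`
(`exists_isTwoHyperelementary_odd_card_fixedBy`). By the projection formula, `ℂ[G/E]` multiplies
balanced characters into `P`. A polynomial identity in these permutation characters then produces an
odd integer constant with the same property (`exists_odd_mem_multiplierGroup`). -/

namespace CharInduction

/-! ### Induction of functions along homomorphisms -/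

open Classical in
/-- Induction of functions along a group homomorphism. -/
noncomputable def indHom {G H : Type*} [Group G] [Group H] [Finite G] [Finite H] (f : H →* G) :
    (H → ℂ) →ₗ[ℂ] (G → ℂ) :=
  letI := Fintype.ofFinite G
  letI := Fintype.ofFinite H
  { toFun := fun ψ g => (Nat.card H : ℂ)⁻¹ * ∑ x : G, ∑ h : H, if f h = x⁻¹ * g * x then ψ h else 0
    map_add' := by
      intro a b
      ext g
      simp only [Pi.add_apply, ← mul_add, ← Finset.sum_add_distrib]
      congr 1
      refine Finset.sum_congr rfl fun x _ => Finset.sum_congr rfl fun h _ => ?_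
      split_ifs <;> simp
    map_smul' := by
      intro c a
      ext g
      simp only [Pi.smul_apply, smul_eq_mul, RingHom.id_apply, Finset.mul_sum]
      refine Finset.sum_congr rfl fun x _ => Finset.sum_congr rfl fun h _ => ?_
      split_ifs
      · ring
      · simp }

section

variable {G H K : Type*} [Group G] [Group H] [Group K] [Finite G] [Finite H] [Finite K]

open Classical in
theorem indHom_apply [hG : Fintype G] [hH : Fintype H] (f : H →* G) (ψ : H → ℂ) (g : G) :
    indHom f ψ g =
      (Nat.card H : ℂ)⁻¹ * ∑ x : G, ∑ h : H, if f h = x⁻¹ * g * x then ψ h else 0 := by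
  obtain rfl := Subsingleton.elim hG (Fintype.ofFinite G)
  obtain rfl := Subsingleton.elim hH (Fintype.ofFinite H)
  rfl

theorem natCard_ne_zero_complex (H : Type*) [Group H] [Finite H] : (Nat.card H : ℂ) ≠ 0 :=
  Nat.cast_ne_zero.2 Nat.card_pos.ne'

/-- Transitivity of induction. Working with homomorphisms instead of subgroups avoids subgroups of
subgroups throughout. -/
theorem indHom_comp (j : K →* G) (f : H →* K) (ψ : H → ℂ) :
    indHom j (indHom f ψ) = indHom (j.comp f) ψ := by
  classical
  let _ := Fintype.ofFinite G
  let _ := Fintype.ofFinite H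
  let _ := Fintype.ofFinite K
  ext g
  -- The substitution `x ↦ x * j y` absorbs conjugation by `y`, so the sum over `y : K` contributes
  -- only the factor `|K|` that cancels the normalisation.
  have key : ∀ (h : H) (y : K), (∑ x : G, if j (y * f h * y⁻¹) = x⁻¹ * g * x then ψ h else 0) =
      ∑ x : G, if j (f h) = x⁻¹ * g * x then ψ h else 0 := by
    intro h y
    refine Fintype.sum_equiv (Equiv.mulRight (j y)) _ _ fun x => ?_
    have : (j (y * f h * y⁻¹) = x⁻¹ * g * x) ↔
        (j (f h) = (x * j y)⁻¹ * g * (x * j y)) := by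
      simp only [map_mul, map_inv]
      constructor
      · intro e
        have e2 : j (f h) = (j y)⁻¹ * (j y * j (f h) * (j y)⁻¹) * j y := by group
        rw [e2, e]; group
      · intro e
        rw [e]; group
    simp only [Equiv.coe_mulRight]
    exact if_congr this rfl rfl
  have inner : ∀ (x : G) (k : K), (if j k = x⁻¹ * g * x then indHom f ψ k else 0) =
      (Nat.card H : ℂ)⁻¹ * ∑ y : K, ∑ h : H,
        if k = y * f h * y⁻¹ then (if j k = x⁻¹ * g * x then ψ h else 0) else 0 := by
    intro x k
    rw [indHom_apply]
    split_ifs with hx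
    · congr 1
      refine Finset.sum_congr rfl fun y _ => Finset.sum_congr rfl fun h _ => ?_
      have : (f h = y⁻¹ * k * y) ↔ (k = y * f h * y⁻¹) := by
        constructor
        · intro e; rw [e]; group
        · intro e; rw [e]; group
      simp only [this]
    · simp
  rw [indHom_apply, indHom_apply]
  simp only [inner, ← Finset.mul_sum]
  have swap : (∑ x : G, ∑ k : K, ∑ y : K, ∑ h : H,
      if k = y * f h * y⁻¹ then (if j k = x⁻¹ * g * x then ψ h else 0) else 0) =
      (Nat.card K : ℂ) * ∑ x : G, ∑ h : H, if j (f h) = x⁻¹ * g * x then ψ h else 0 := by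
    calc _ = ∑ x : G, ∑ y : K, ∑ h : H,
          if j (y * f h * y⁻¹) = x⁻¹ * g * x then ψ h else 0 := by
          refine Finset.sum_congr rfl fun x _ => ?_
          rw [Finset.sum_comm]
          refine Finset.sum_congr rfl fun y _ => ?_
          rw [Finset.sum_comm]
          refine Finset.sum_congr rfl fun h _ => ?_
          simp
      _ = ∑ y : K, ∑ h : H, ∑ x : G,
          if j (y * f h * y⁻¹) = x⁻¹ * g * x then ψ h else 0 := by
          rw [Finset.sum_comm]
          refine Finset.sum_congr rfl fun y _ => Finset.sum_comm
      _ = ∑ y : K, ∑ h : H, ∑ x : G, if j (f h) = x⁻¹ * g * x then ψ h else 0 := by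
          simp only [key]
      _ = _ := by
          rw [Finset.sum_const, Finset.card_univ, nsmul_eq_mul, Finset.sum_comm,
            Nat.card_eq_fintype_card]
  rw [swap]
  have := natCard_ne_zero_complex K
  simp only [MonoidHom.comp_apply]
  field_simp

/-- The projection formula: on the support of the inner sum, `f h` is conjugate to `g`, so the class
function `φ` factors out. -/
theorem indHom_mul_comp (f : H →* G) (ψ : H → ℂ) (φ : G → ℂ)
    (hφ : ∀ x g : G, φ (x⁻¹ * g * x) = φ g) :
    indHom f (fun h => ψ h * φ (f h)) = fun g => indHom f ψ g * φ g := by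
  classical
  let _ := Fintype.ofFinite G
  let _ := Fintype.ofFinite H
  ext g
  rw [indHom_apply, indHom_apply, mul_assoc, Finset.sum_mul]
  congr 1
  refine Finset.sum_congr rfl fun x _ => ?_
  rw [Finset.sum_mul]
  refine Finset.sum_congr rfl fun h _ => ?_
  split_ifs with e
  · rw [e, hφ]
  · simp

theorem indHom_conj (f : H →* G) (ψ : H → ℂ) (g : G) :
    indHom f (fun h => starRingEnd ℂ (ψ h)) g = starRingEnd ℂ (indHom f ψ g) := by
  classical
  let _ := Fintype.ofFinite G
  let _ := Fintype.ofFinite H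
  rw [indHom_apply, indHom_apply]
  simp only [map_mul, map_inv₀, Complex.conj_natCast, map_sum]
  congr 1
  refine Finset.sum_congr rfl fun x _ => Finset.sum_congr rfl fun h _ => ?_
  split_ifs <;> simp

theorem indHom_one_apply (f : H →* G) (hf : Function.Injective f) (ψ : H → ℂ) :
    indHom f ψ 1 = (Nat.card H : ℂ)⁻¹ * (Nat.card G * ψ 1) := by
  classical
  let _ := Fintype.ofFinite G
  let _ := Fintype.ofFinite H
  rw [indHom_apply]
  have : ∀ (x : G) (h : H), f h = x⁻¹ * 1 * x ↔ h = 1 := by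
    intro x h
    rw [mul_one, inv_mul_cancel, ← map_one f, hf.eq_iff]
  simp only [this, Finset.sum_ite_eq', Finset.mem_univ, if_true]
  simp

theorem indHom_id (ψ : G → ℂ) (hψ : ∀ x g : G, ψ (x⁻¹ * g * x) = ψ g) :
    indHom (MonoidHom.id G) ψ = ψ := by
  classical
  let _ := Fintype.ofFinite G
  ext g
  rw [indHom_apply]
  simp only [MonoidHom.id_apply, Finset.sum_ite_eq', Finset.mem_univ, if_true, hψ]
  have := natCard_ne_zero_complex G
  simp only [Finset.sum_const, Finset.card_univ, nsmul_eq_mul, ← Nat.card_eq_fintype_card]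
  field_simp

theorem indHom_conj_invariant (f : H →* G) (ψ : H → ℂ) (y g : G) :
    indHom f ψ (y⁻¹ * g * y) = indHom f ψ g := by
  classical
  let _ := Fintype.ofFinite G
  let _ := Fintype.ofFinite H
  rw [indHom_apply, indHom_apply]
  congr 1
  refine Fintype.sum_equiv (Equiv.mulLeft y) _ _ fun x => ?_
  simp only [Equiv.coe_mulLeft, mul_inv_rev, mul_assoc]

open Classical in
/-- The extension by zero of a function on a subgroup. -/
noncomputable def extZero (K : Subgroup G) (ψ : K → ℂ) (g : G) : ℂ :=
  if h : g ∈ K then ψ ⟨g, h⟩ else 0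

omit [Finite G] in
theorem extZero_of_mem {K : Subgroup G} (ψ : K → ℂ) {g : G} (h : g ∈ K) :
    extZero K ψ g = ψ ⟨g, h⟩ := dif_pos h

omit [Finite G] in
theorem extZero_of_notMem {K : Subgroup G} (ψ : K → ℂ) {g : G} (h : g ∉ K) :
    extZero K ψ g = 0 := dif_neg h

theorem indHom_subtype_apply [Fintype G] (K : Subgroup G) (ψ : K → ℂ) (g : G) :
    indHom K.subtype ψ g = (Nat.card K : ℂ)⁻¹ * ∑ x : G, extZero K ψ (x⁻¹ * g * x) := by
  classical
  let _ := Fintype.ofFinite K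
  rw [indHom_apply]
  congr 1
  refine Finset.sum_congr rfl fun x _ => ?_
  by_cases hx : x⁻¹ * g * x ∈ K
  · rw [extZero_of_mem ψ hx, Finset.sum_eq_single ⟨x⁻¹ * g * x, hx⟩]
    · simp
    · intro b _ hb
      rw [if_neg]
      intro e
      exact hb (Subtype.ext e)
    · simp
  · rw [extZero_of_notMem ψ hx]
    refine Finset.sum_eq_zero fun h _ => if_neg ?_
    intro e
    exact hx (e ▸ h.2)

/-- The bijection `(q, k) ↦ r q * k`, where `r q` is the chosen representative of the coset `q`. -/
noncomputable def quotientProdEquiv {G : Type*} [Group G] (K : Subgroup G) : (G ⧸ K) × K ≃ G :=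
  Equiv.ofBijective (fun p => Quotient.out p.1 * p.2) <| by
    have hmk : ∀ (q : G ⧸ K) (k : K), ((Quotient.out q * k : G) : G ⧸ K) = q := by
      intro q k
      rw [QuotientGroup.mk_mul_of_mem _ k.2]
      exact Quotient.out_eq' q
    constructor
    · rintro ⟨q, k⟩ ⟨q', k'⟩ h
      have h1 : q = q' := by
        rw [← hmk q k, ← hmk q' k']
        exact congrArg _ h
      subst h1
      exact Prod.ext rfl (Subtype.ext (mul_left_cancel h))
    · intro g
      have : (Quotient.out (g : G ⧸ K))⁻¹ * g ∈ K :=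
        QuotientGroup.eq.1 (Quotient.out_eq' (g : G ⧸ K))
      exact ⟨(g, ⟨_, this⟩), mul_inv_cancel_left _ _⟩

theorem quotientProdEquiv_apply {G : Type*} [Group G] (K : Subgroup G) (q : G ⧸ K) (k : K) :
    quotientProdEquiv K (q, k) = Quotient.out q * k := rfl

/-- The summand depends only on the coset `xK` because `ψ` is a class function; each coset absorbs
one factor `|K|`. In this form induction is visibly the trace of a monomial matrix. -/
theorem indHom_subtype_eq_sum_quotient (K : Subgroup G) [Fintype (G ⧸ K)] (ψ : K → ℂ)
    (hψ : ∀ x k : K, ψ (x⁻¹ * k * x) = ψ k) (g : G) :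
    indHom K.subtype ψ g =
      ∑ q : G ⧸ K, extZero K ψ ((Quotient.out q)⁻¹ * g * (Quotient.out q)) := by
  classical
  let _ := Fintype.ofFinite G
  let _ := Fintype.ofFinite K
  have inv : ∀ (k : K) (y : G), extZero K ψ ((k : G)⁻¹ * y * k) = extZero K ψ y := by
    intro k y
    by_cases hy : y ∈ K
    · have h2 : (k : G)⁻¹ * y * k ∈ K := K.mul_mem (K.mul_mem (K.inv_mem k.2) hy) k.2
      rw [extZero_of_mem ψ hy, extZero_of_mem ψ h2, ← hψ k ⟨y, hy⟩]
      rfl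
    · rw [extZero_of_notMem ψ hy, extZero_of_notMem]
      intro h
      apply hy
      have := K.mul_mem (K.mul_mem k.2 h) (K.inv_mem k.2)
      convert this using 1
      group
  rw [indHom_subtype_apply,
    ← Fintype.sum_equiv (quotientProdEquiv K)
      (fun p => extZero K ψ ((Quotient.out p.1)⁻¹ * g * (Quotient.out p.1))) _ ?_]
  · rw [Fintype.sum_prod_type]
    simp only [Finset.sum_const, Finset.card_univ, nsmul_eq_mul, ← Finset.mul_sum,
      ← Nat.card_eq_fintype_card]
    rw [inv_mul_cancel_left₀ (natCard_ne_zero_complex K)]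
  · rintro ⟨q, k⟩
    rw [quotientProdEquiv_apply, ← inv k]
    congr 1
    group

end

theorem ind_eq_indHom {G : Type u} [Group G] [Fintype G] (H : Subgroup G) (ψ : H → ℂ) :
    ind H ψ = indHom H.subtype ψ := by
  ext g
  rw [indHom_subtype_apply]
  rfl

theorem indHom_eq_ind_range {G H : Type u} [Group G] [Fintype G] [Group H] [Finite H] (f : H →* G)
    (hf : Function.Injective f) (ψ : H → ℂ) :
    indHom f ψ = ind f.range (fun k => ψ ((MonoidHom.ofInjective hf).symm k)) := by
  classical
  let _ := Fintype.ofFinite H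
  let _ := Fintype.ofFinite f.range
  rw [ind_eq_indHom]
  ext g
  rw [indHom_apply, indHom_apply, Nat.card_congr (MonoidHom.ofInjective hf).toEquiv]
  congr 1
  refine Finset.sum_congr rfl fun x _ => ?_
  refine Fintype.sum_equiv (MonoidHom.ofInjective hf).toEquiv _ _ fun h => ?_
  simp [MonoidHom.ofInjective_apply]

/-! ### Sign characters and monomial matrices -/

section

variable {G : Type*} [Group G]

/-- The sign of the permutation by which a group element acts on a finite `G`-set. -/
noncomputable def sgn (G X : Type*) [Group G] [MulAction G X] [Finite X] : G →* ℤˣ :=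
  letI := Fintype.ofFinite X
  letI := Classical.decEq X
  Equiv.Perm.sign.comp (MulAction.toPermHom G X)

theorem sgn_apply {X : Type*} [MulAction G X] [hX : Fintype X] [hd : DecidableEq X] (g : G) :
    sgn G X g = Equiv.Perm.sign (MulAction.toPerm g : Equiv.Perm X) := by
  have h : ∀ (h1 : Fintype X) (h2 : DecidableEq X), @Equiv.Perm.sign X hd hX (MulAction.toPerm g)
      = @Equiv.Perm.sign X h2 h1 (MulAction.toPerm g) := by
    intro h1 h2
    congr!
  exact (h (Fintype.ofFinite X) (Classical.decEq X)).symm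

/-- A quadratic character as a complex-valued function. -/
def signFun (ε : G →* ℤˣ) : G → ℂ := fun g => ((ε g : ℤ) : ℂ)

/-- A quadratic character as a complex-valued homomorphism. -/
def signHom (ε : G →* ℤˣ) : G →* ℂ :=
  ((Int.castRingHom ℂ : ℤ →* ℂ).comp (Units.coeHom ℤ)).comp ε

theorem coe_signHom (ε : G →* ℤˣ) : ⇑(signHom ε) = signFun ε := rfl

theorem monoidHom_conj_invariant {K : Type*} [Group K] (δ : K →* ℂ) (x k : K) :
    δ (x⁻¹ * k * x) = δ k := by
  rw [map_mul, map_mul, mul_right_comm, ← map_mul, inv_mul_cancel, map_one, one_mul]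

variable [Finite G]

omit [Finite G] in
theorem extZero_mul_of_right_mem {K : Subgroup G} (δ : K →* ℂ) (a : G) {b : G} (hb : b ∈ K) :
    extZero K δ (a * b) = extZero K δ a * extZero K δ b := by
  by_cases ha : a ∈ K
  · rw [extZero_of_mem _ ha, extZero_of_mem _ hb, extZero_of_mem _ (K.mul_mem ha hb), ← map_mul]
    rfl
  · rw [extZero_of_notMem _ ha, extZero_of_notMem, zero_mul]
    intro h
    exact ha ((K.mul_mem_cancel_right hb).1 h)

omit [Finite G] in
theorem mem_iff_smul_eq (K : Subgroup G) (g : G) (i j : G ⧸ K) :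
    (Quotient.out i)⁻¹ * g * Quotient.out j ∈ K ↔ i = g • j := by
  have h1 : ((Quotient.out i : G) : G ⧸ K) = i := Quotient.out_eq' i
  have h2 : ((g * Quotient.out j : G) : G ⧸ K) = g • j := by
    conv_rhs => rw [← Quotient.out_eq' j]
    rfl
  rw [mul_assoc, ← QuotientGroup.eq, h1, h2]

/-- The matrices of the representation of `G` induced from a linear character `δ` of `K`, in the
basis given by the chosen coset representatives. -/
noncomputable def monomialHom (K : Subgroup G) [Fintype (G ⧸ K)] [DecidableEq (G ⧸ K)]
    (δ : K →* ℂ) : G →* Matrix (G ⧸ K) (G ⧸ K) ℂ where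
  toFun g := Matrix.of fun i j => extZero K δ ((Quotient.out i)⁻¹ * g * Quotient.out j)
  map_one' := by
    ext i j
    rw [Matrix.of_apply, Matrix.one_apply]
    split_ifs with h
    · subst h
      rw [mul_one, inv_mul_cancel, extZero_of_mem _ K.one_mem]
      exact map_one δ
    · refine extZero_of_notMem _ ?_
      rwa [mem_iff_smul_eq, one_smul]
  map_mul' g g' := by
    ext i k
    rw [Matrix.mul_apply, Finset.sum_eq_single (g' • k)]
    · simp only [Matrix.of_apply]
      rw [← extZero_mul_of_right_mem]
      · congr 1
        group
      · rw [mem_iff_smul_eq]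
    · intro j _ hj
      simp only [Matrix.of_apply]
      rw [extZero_of_notMem _ (mt (mem_iff_smul_eq K g' j k).1 hj), mul_zero]
    · simp

omit [Finite G] in
theorem monomialHom_apply (K : Subgroup G) [Fintype (G ⧸ K)] [DecidableEq (G ⧸ K)]
    (δ : K →* ℂ) (g : G) (i j : G ⧸ K) :
    monomialHom K δ g i j = extZero K δ ((Quotient.out i)⁻¹ * g * Quotient.out j) := rfl

theorem trace_monomialHom (K : Subgroup G) [Fintype (G ⧸ K)] [DecidableEq (G ⧸ K)]
    (δ : K →* ℂ) (g : G) : (monomialHom K δ g).trace = indHom K.subtype δ g := by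
  rw [indHom_subtype_eq_sum_quotient K δ (monoidHom_conj_invariant δ)]
  rfl

/-- Column `j` has its only nonzero entry in row `g • j`, so the matrix is a diagonal one with its
rows permuted by the action of `g` on `G ⧸ K`. -/
theorem det_monomialHom (K : Subgroup G) [Fintype (G ⧸ K)] [DecidableEq (G ⧸ K)]
    (δ : K →* ℂ) (g : G) : (monomialHom K δ g).det = ((sgn G (G ⧸ K) g : ℤ) : ℂ) *
      ∏ j : G ⧸ K, extZero K δ ((Quotient.out (g • j))⁻¹ * g * Quotient.out j) := by
  have : monomialHom K δ g = (Matrix.diagonal fun j : G ⧸ K =>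
      extZero K δ ((Quotient.out (g • j))⁻¹ * g * Quotient.out j)).submatrix
        ((MulAction.toPerm g)⁻¹ : Equiv.Perm (G ⧸ K)) id := by
    ext i j
    rw [monomialHom_apply, Matrix.submatrix_apply, Matrix.diagonal_apply, id]
    have hi : ((MulAction.toPerm g)⁻¹ : Equiv.Perm (G ⧸ K)) i = g⁻¹ • i := rfl
    rw [hi]
    split_ifs with h
    · subst h
      rw [smul_inv_smul]
    · refine extZero_of_notMem _ (mt (mem_iff_smul_eq K g i j).1 ?_)
      rintro rfl
      exact h (inv_smul_smul _ _)
  rw [this, Matrix.det_permute, Matrix.det_diagonal, Equiv.Perm.sign_inv, sgn_apply]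

end

/-! ### Representations, monomial characters and admissible subgroups -/

section

variable {G : Type u} [Group G]

/-- The bundled representation afforded by a homomorphism to matrices. -/
noncomputable def matrixRep {n : ℕ} (A : G →* Matrix (Fin n) (Fin n) ℂ) : FDRep.{0, u} ℂ G :=
  FDRep.of (V := Fin n → ℂ) ((Matrix.toLinAlgEquiv' : Matrix (Fin n) (Fin n) ℂ ≃ₐ[ℂ] _).toMonoidHom.comp A)

theorem matrixRep_ρ {n : ℕ} (A : G →* Matrix (Fin n) (Fin n) ℂ) (g : G) :
    (matrixRep A).ρ g = Matrix.toLin' (A g) := rfl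

theorem character_matrixRep {n : ℕ} (A : G →* Matrix (Fin n) (Fin n) ℂ) (g : G) :
    (matrixRep A).character g = (A g).trace :=
  Matrix.trace_toLin'_eq (A g)

theorem repDet_matrixRep {n : ℕ} (A : G →* Matrix (Fin n) (Fin n) ℂ) (g : G) :
    repDet (matrixRep A) g = (A g).det :=
  LinearMap.det_toLin' (A g)

theorem finrank_matrixRep {n : ℕ} (A : G →* Matrix (Fin n) (Fin n) ℂ) :
    Module.finrank ℂ (matrixRep A) = n :=
  Module.finrank_fin_fun ℂ

/-- Maschke's theorem and induction on the dimension; `generalisedCharacters` is generated by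
irreducible characters only. -/
theorem representation_character_mem [Finite G] (n : ℕ) :
    ∀ (V : Type) [AddCommGroup V] [Module ℂ V] [FiniteDimensional ℂ V] (ρ : Representation ℂ G V),
      Module.finrank ℂ V = n → ρ.character ∈ generalisedCharacters G := by
  induction n using Nat.strong_induction_on with
  | _ n ih =>
    intro V _ _ _ ρ hn
    by_cases hirr : Representation.IsIrreducible ρ
    · exact AddSubgroup.subset_closure ⟨FDRep.of ρ, hirr, rfl⟩
    by_cases hV : Nontrivial V
    · have : ∃ W : Subrepresentation ρ, W ≠ ⊥ ∧ W ≠ ⊤ := by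
        by_contra! hcon
        refine hirr { exists_pair_ne := ⟨⊥, ⊤, ?_⟩, eq_bot_or_eq_top := fun W => ?_ }
        · intro h
          have := congrArg Subrepresentation.toSubmodule h
          exact bot_ne_top (α := Submodule ℂ V) this
        · exact or_iff_not_imp_left.2 (hcon W)
      obtain ⟨W, hbot, htop⟩ := this
      have hcard : NeZero (Nat.card G : ℂ) := ⟨natCard_ne_zero_complex G⟩
      obtain ⟨W', hW'⟩ := exists_isCompl W
      have hc : IsCompl W.toSubmodule W'.toSubmodule := by
        rw [isCompl_iff, disjoint_iff, codisjoint_iff]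
        exact ⟨congrArg Subrepresentation.toSubmodule hW'.inf_eq_bot,
          congrArg Subrepresentation.toSubmodule hW'.sup_eq_top⟩
      have hint : DirectSum.IsInternal
          (fun b : Bool => bif b then W.toSubmodule else W'.toSubmodule) := by
        rw [DirectSum.isInternal_submodule_iff_isCompl _ (i := true) (j := false) (by simp)
          (by ext b; cases b <;> simp)]
        exact hc
      have hsum : ρ.character = W.toRepresentation.character + W'.toRepresentation.character := by
        ext g
        have hmaps : ∀ b : Bool, Set.MapsTo (ρ g)
            ((bif b then W.toSubmodule else W'.toSubmodule : Submodule ℂ V) : Set V)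
            ((bif b then W.toSubmodule else W'.toSubmodule : Submodule ℂ V) : Set V) := by
          rintro (_ | _)
          · exact fun v hv => W'.apply_mem_toSubmodule g hv
          · exact fun v hv => W.apply_mem_toSubmodule g hv
        have := LinearMap.trace_eq_sum_trace_restrict hint hmaps
        rw [Fintype.sum_bool] at this
        exact this
      have hadd := Submodule.finrank_add_eq_of_isCompl hc
      have h1 : 0 < Module.finrank ℂ W.toSubmodule := by
        rw [Module.finrank_pos_iff, Submodule.nontrivial_iff_ne_bot]
        exact fun h => hbot (Subrepresentation.toSubmodule_injective h)
      have h2 : 0 < Module.finrank ℂ W'.toSubmodule := by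
        rw [Module.finrank_pos_iff, Submodule.nontrivial_iff_ne_bot]
        intro h
        apply htop
        apply Subrepresentation.toSubmodule_injective
        rw [h] at hc
        exact eq_top_of_isCompl_bot hc
      rw [hsum]
      exact add_mem (ih _ (by omega) _ _ rfl) (ih _ (by omega) _ _ rfl)
    · have : ρ.character = 0 := by
        have := not_nontrivial_iff_subsingleton.1 hV
        ext g
        have h0 : ρ g = 0 := Subsingleton.elim _ _
        simp [Representation.character, h0]
      rw [this]
      exact zero_mem _

theorem character_mem_generalisedCharacters [Finite G] (V : FDRep.{0, u} ℂ G) :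
    V.character ∈ generalisedCharacters G :=
  representation_character_mem _ V V.ρ rfl

/-- The `ℤ`-linear combinations of the functions induced from linear characters. -/
def monomialCharacters (G : Type u) [Group G] [Finite G] : AddSubgroup (G → ℂ) :=
  AddSubgroup.closure {χ | ∃ (H : Type u) (_ : Group H) (_ : Finite H) (f : H →* G)
    (_ : Function.Injective f) (δ : H →* ℂ), χ = indHom f δ}

theorem indHom_mem_monomialCharacters [Finite G] {H : Type u} [Group H] [Finite H] (f : H →* G)
    (hf : Function.Injective f) (δ : H →* ℂ) : indHom f δ ∈ monomialCharacters G :=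
  AddSubgroup.subset_closure ⟨H, _, ‹_›, f, hf, δ, rfl⟩

theorem monomialCharacters_le [Finite G] :
    monomialCharacters G ≤ generalisedCharacters G := by
  classical
  refine (AddSubgroup.closure_le _).2 ?_
  rintro _ ⟨H, _, _, f, hf, δ, rfl⟩
  let _ := Fintype.ofFinite G
  let _ := Fintype.ofFinite (G ⧸ f.range)
  let δ' : f.range →* ℂ := δ.comp (MonoidHom.ofInjective hf).symm.toMonoidHom
  have h1 : indHom f δ = indHom f.range.subtype δ' := by
    rw [indHom_eq_ind_range f hf, ind_eq_indHom]
    rfl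
  let A := (Matrix.reindexAlgEquiv ℂ ℂ (Fintype.equivFin (G ⧸ f.range))).toMonoidHom.comp
    (monomialHom f.range δ')
  have h2 : indHom f δ = (matrixRep A).character := by
    ext g
    rw [character_matrixRep, h1, ← trace_monomialHom]
    exact (Equiv.sum_comp (Fintype.equivFin (G ⧸ f.range)).symm
      (fun i => monomialHom f.range δ' g i i)).symm
  rw [h2]
  exact character_mem_generalisedCharacters _

/-- The closure properties of the given set of characters that are used below. -/
structure Admissible {G : Type u} [Group G] [Finite G] (P : AddSubgroup (G → ℂ)) : Prop where
  add_conj_mem : ∀ τ ∈ monomialCharacters G, τ 1 = 0 → (fun g => τ g + starRingEnd ℂ (τ g)) ∈ P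
  indHom_mem : ∀ (H : Type u) [Group H] [Finite H] (f : H →* G), Function.Injective f →
    ∀ (A : H →* Matrix (Fin 2) (Fin 2) ℂ) (N : Subgroup H) [N.Normal], (∀ n ∈ N, A n = 1) →
      IsBasicDihedral (H ⧸ N) → indHom f (fun h => (A h).trace - 1 - (A h).det) ∈ P

/-- Monomial characters suffice for every use of condition 1, and their stability under induction is
immediate from transitivity. -/
theorem indHom_monomialCharacters_mem {K : Type u} [Group K] [Finite G] [Finite K] (j : K →* G)
    (hj : Function.Injective j) {τ : K → ℂ} (hτ : τ ∈ monomialCharacters K) :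
    indHom j τ ∈ monomialCharacters G := by
  induction hτ using AddSubgroup.closure_induction with
  | mem x hx =>
    obtain ⟨H, _, _, f, hf, δ, rfl⟩ := hx
    rw [indHom_comp]
    exact indHom_mem_monomialCharacters (j.comp f) (hj.comp hf) δ
  | zero => rw [map_zero]; exact zero_mem _
  | add x y _ _ hx hy => rw [map_add]; exact add_mem hx hy
  | neg x _ hx => rw [map_neg]; exact neg_mem hx

/-- Induction commutes with conjugation, preserves degree `0` and is transitive. This lets a
congruence be proved over a subgroup `K` for the pulled-back `P` and then induced to `G`, which
makes arguments by induction on the group possible. -/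
theorem Admissible.comap {K : Type u} [Group K] [Finite G] [Finite K] {P : AddSubgroup (G → ℂ)}
    (hP : Admissible P) (j : K →* G) (hj : Function.Injective j) :
    Admissible (P.comap (indHom j).toAddMonoidHom) where
  add_conj_mem τ hτ h1 := by
    have h := hP.add_conj_mem (indHom j τ) (indHom_monomialCharacters_mem j hj hτ) (by
      rw [indHom_one_apply j hj, h1]; simp)
    have e : indHom j (fun k => τ k + starRingEnd ℂ (τ k)) =
        fun g => indHom j τ g + starRingEnd ℂ (indHom j τ g) := by
      have : (fun k => τ k + starRingEnd ℂ (τ k)) = τ + fun k => starRingEnd ℂ (τ k) := rfl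
      rw [this, map_add]
      ext g
      rw [Pi.add_apply, indHom_conj]
    change indHom j _ ∈ P
    rw [e]
    exact h
  indHom_mem H _ _ f hf A N _ hN hD := by
    change indHom j _ ∈ P
    rw [indHom_comp]
    exact hP.indHom_mem H (j.comp f) (hj.comp hf) A N hN hD

theorem IsBasicDihedral.of_mulEquiv {Q R : Type u} [Group Q] [Group R] (e : R ≃* Q)
    (h : IsBasicDihedral Q) : IsBasicDihedral R := by
  rcases h with ⟨⟨i⟩⟩ | ⟨⟨i⟩⟩ | ⟨p, hp, hodd, ⟨i⟩⟩
  · exact Or.inl ⟨e.trans i⟩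
  · exact Or.inr (Or.inl ⟨e.trans i⟩)
  · exact Or.inr (Or.inr ⟨p, hp, hodd, ⟨e.trans i⟩⟩)

/-- A set of characters with the closure properties of the induction theorem is an admissible
subgroup. -/
theorem exists_admissible [Fintype G] (P : Set (G → ℂ))
    (h1 : ∀ τ ∈ generalisedCharacters G, τ 1 = 0 →
      (fun g => τ g + starRingEnd ℂ (τ g)) ∈ P)
    (h2 : ∀ (H : Subgroup G) (V : FDRep.{0, u} ℂ H), Module.finrank ℂ V = 2 →
      FactorsThroughBasicDihedral V → ind H (V.character - 1 - repDet V) ∈ P)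
    (h3 : ∀ (k : ℕ) (τ : Fin k → G → ℂ) (n : Fin k → ℤ), (∀ i, τ i ∈ P) →
      ∑ i, n i • τ i ∈ P) :
    ∃ P' : AddSubgroup (G → ℂ), (P' : Set (G → ℂ)) = P ∧ Admissible P' := by
  let P' : AddSubgroup (G → ℂ) :=
    { carrier := P
      zero_mem' := by simpa using h3 0 (fun _ => 0) (fun _ => 0) (fun i => i.elim0)
      add_mem' := by
        intro a b ha hb
        have := h3 2 ![a, b] ![1, 1] (by intro i; fin_cases i <;> simpa)
        simpa [Fin.sum_univ_two] using this
      neg_mem' := by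
        intro a ha
        have := h3 1 ![a] ![-1] (by intro i; fin_cases i; simpa)
        simpa using this }
  refine ⟨P', rfl, fun τ hτ h => h1 τ (monomialCharacters_le hτ) h, ?_⟩
  intro H _ _ f hf A N _ hN hD
  let e : H ≃* f.range := MonoidHom.ofInjective hf
  have hnorm : (N.map (e : H →* f.range)).Normal := Subgroup.Normal.map ‹_› _ e.surjective
  have h := h2 f.range (matrixRep (A.comp e.symm.toMonoidHom)) (finrank_matrixRep _)
    ⟨N.map (e : H →* f.range), hnorm, by
      rintro _ ⟨n, hn, rfl⟩
      rw [matrixRep_ρ]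
      have : (A.comp e.symm.toMonoidHom) ((e : H →* f.range) n) = 1 := by
        simp [hN n hn]
      rw [this]
      exact Matrix.toLin'_one,
      hD.of_mulEquiv (QuotientGroup.congr N _ e rfl).symm⟩
  have heq : indHom f (fun h => (A h).trace - 1 - (A h).det) =
      ind f.range ((matrixRep (A.comp e.symm.toMonoidHom)).character - 1 -
        repDet (matrixRep (A.comp e.symm.toMonoidHom))) := by
    rw [indHom_eq_ind_range f hf]
    congr 1
    ext k
    simp only [Pi.sub_apply, character_matrixRep, repDet_matrixRep]
    rfl
  rw [heq]
  exact h

end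

/-! ### Permutation characters and their signs -/

section

variable {G : Type*} [Group G]

/-- The permutation character of a `G`-set. -/
noncomputable def permChar (G X : Type*) [Group G] [MulAction G X] : G → ℂ :=
  fun g => (Nat.card (MulAction.fixedBy X g) : ℂ)

theorem permChar_apply {X : Type*} [MulAction G X] [Fintype X] [DecidableEq X] (g : G) :
    permChar G X g = ∑ x : X, if g • x = x then 1 else 0 := by
  rw [permChar, Finset.sum_boole, Nat.card_eq_fintype_card, Fintype.card_subtype]
  rfl

theorem permChar_congr {X Y : Type*} [MulAction G X] [MulAction G Y] (e : X ≃ Y)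
    (he : ∀ (g : G) (x : X), e (g • x) = g • e x) : permChar G X = permChar G Y := by
  ext g
  rw [permChar, permChar, Nat.card_congr (e.subtypeEquiv fun x => ?_)]
  rw [MulAction.mem_fixedBy, MulAction.mem_fixedBy, ← he, e.apply_eq_iff_eq]

theorem sgn_congr {X Y : Type*} [MulAction G X] [MulAction G Y] [Finite X] [Finite Y] (e : X ≃ Y)
    (he : ∀ (g : G) (x : X), e (g • x) = g • e x) : sgn G X = sgn G Y := by
  classical
  let _ := Fintype.ofFinite X
  let _ := Fintype.ofFinite Y
  ext g
  rw [sgn_apply, sgn_apply, Equiv.Perm.sign_eq_sign_of_equiv (MulAction.toPerm g : Equiv.Perm X)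
    (MulAction.toPerm g : Equiv.Perm Y) e (fun x => he g x)]

theorem permChar_sum (X Y : Type*) [MulAction G X] [MulAction G Y] [Finite X] [Finite Y] :
    permChar G (X ⊕ Y) = permChar G X + permChar G Y := by
  classical
  let _ := Fintype.ofFinite X
  let _ := Fintype.ofFinite Y
  ext g
  simp only [permChar_apply, Fintype.sum_sum_type, Pi.add_apply, Sum.smul_inl, Sum.smul_inr,
    Sum.inl.injEq, Sum.inr.injEq]

theorem sgn_sum (X Y : Type*) [MulAction G X] [MulAction G Y] [Finite X] [Finite Y] :
    sgn G (X ⊕ Y) = sgn G X * sgn G Y := by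
  classical
  let _ := Fintype.ofFinite X
  let _ := Fintype.ofFinite Y
  ext g
  rw [MonoidHom.mul_apply, sgn_apply, sgn_apply, sgn_apply, ← Equiv.Perm.sign_sumCongr]
  congr 2

theorem permChar_prod (X Y : Type*) [MulAction G X] [MulAction G Y] [Finite X] [Finite Y] :
    permChar G (X × Y) = permChar G X * permChar G Y := by
  classical
  let _ := Fintype.ofFinite X
  let _ := Fintype.ofFinite Y
  ext g
  simp only [permChar_apply, Pi.mul_apply, Fintype.sum_prod_type, Finset.sum_mul_sum, Prod.ext_iff,
    Prod.smul_fst, Prod.smul_snd]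
  refine Finset.sum_congr rfl fun x _ => Finset.sum_congr rfl fun y _ => ?_
  by_cases h1 : g • x = x <;> by_cases h2 : g • y = y <;> simp [h1, h2]

/-- The action on `X × Y` moves one coordinate at a time: `|Y|` copies of the permutation of `X`,
then `|X|` copies of that of `Y`. -/
theorem sgn_prod (X Y : Type*) [MulAction G X] [MulAction G Y] [Finite X] [Finite Y] :
    sgn G (X × Y) = sgn G X ^ Nat.card Y * sgn G Y ^ Nat.card X := by
  classical
  let _ := Fintype.ofFinite X
  let _ := Fintype.ofFinite Y
  ext g
  rw [MonoidHom.mul_apply, MonoidHom.pow_apply, MonoidHom.pow_apply, sgn_apply, sgn_apply,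
    sgn_apply]
  have : (MulAction.toPerm g : Equiv.Perm (X × Y)) =
      Equiv.prodCongrLeft (fun _ : Y => (MulAction.toPerm g : Equiv.Perm X)) *
        Equiv.prodCongrRight (fun _ : X => (MulAction.toPerm g : Equiv.Perm Y)) := by
    rfl
  rw [this, Equiv.Perm.sign_mul, Equiv.Perm.sign_prodCongrLeft, Equiv.Perm.sign_prodCongrRight]
  simp

theorem permChar_one (X : Type*) [MulAction G X] : permChar G X 1 = Nat.card X := by
  rw [permChar]
  simp

theorem permChar_conj_invariant (X : Type*) [MulAction G X] (x g : G) :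
    permChar G X (x⁻¹ * g * x) = permChar G X g := by
  rw [permChar, permChar, Nat.card_congr ((MulAction.toPerm x).subtypeEquiv fun y => ?_)]
  rw [MulAction.mem_fixedBy, MulAction.mem_fixedBy, mul_smul, mul_smul, inv_smul_eq_iff]
  rfl

/-- A finite `G`-set is the disjoint union of an orbit and its complement. -/
noncomputable def orbitSumEquiv (X : Type*) [MulAction G X] (x : X) (C : SubMulAction G X)
    (hC : (C : Set X) = (MulAction.orbit G x)ᶜ) : (G ⧸ MulAction.stabilizer G x) ⊕ C ≃ X :=
  Equiv.ofBijective (Sum.elim (MulAction.ofQuotientStabilizer G x) Subtype.val) <| by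
    have hmem : ∀ y : X, y ∈ C ↔ y ∉ MulAction.orbit G x := fun y => by
      rw [← SetLike.mem_coe, hC, Set.mem_compl_iff]
    have horb : ∀ q, MulAction.ofQuotientStabilizer G x q ∈ MulAction.orbit G x :=
      MulAction.ofQuotientStabilizer_mem_orbit G x
    constructor
    · rintro (a | a) (b | b) h
      · exact congrArg Sum.inl (MulAction.injective_ofQuotientStabilizer G x h)
      · have h' : MulAction.ofQuotientStabilizer G x a = b := h
        exact absurd (h' ▸ horb a) ((hmem _).1 b.2)
      · have h' : (a : X) = MulAction.ofQuotientStabilizer G x b := h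
        exact absurd (h' ▸ horb b) ((hmem _).1 a.2)
      · exact congrArg Sum.inr (Subtype.ext h)
    · intro y
      by_cases hy : y ∈ MulAction.orbit G x
      · obtain ⟨g, rfl⟩ := hy
        exact ⟨Sum.inl g, rfl⟩
      · exact ⟨Sum.inr ⟨y, (hmem y).2 hy⟩, rfl⟩

theorem orbitSumEquiv_smul (X : Type*) [MulAction G X] (x : X) (C : SubMulAction G X)
    (hC : (C : Set X) = (MulAction.orbit G x)ᶜ) (g : G)
    (y : (G ⧸ MulAction.stabilizer G x) ⊕ C) :
    orbitSumEquiv X x C hC (g • y) = g • orbitSumEquiv X x C hC y := by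
  rcases y with y | y
  · exact MulAction.ofQuotientStabilizer_smul G x g y
  · rfl

/-- A finite `G`-set decomposes into transitive ones. -/
theorem exists_list_of_finite [Finite G] (n : ℕ) : ∀ (X : Type*) [MulAction G X] [Finite X],
    Nat.card X = n → ∃ L : List (Subgroup G),
      permChar G X = (L.map fun H => permChar G (G ⧸ H)).sum ∧
      sgn G X = (L.map fun H => sgn G (G ⧸ H)).prod ∧
      Nat.card X = (L.map fun H => Nat.card (G ⧸ H)).sum := by
  induction n using Nat.strong_induction_on with
  | _ n ih =>
    intro X _ _ hn
    rcases isEmpty_or_nonempty X with hX | ⟨⟨x⟩⟩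
    · refine ⟨[], ?_, ?_, by simp⟩
      · ext g
        simp [permChar]
      · ext g
        classical
        let _ := Fintype.ofFinite X
        rw [sgn_apply, Subsingleton.elim (MulAction.toPerm g : Equiv.Perm X) 1]
        simp
    · let C : SubMulAction G X :=
        { carrier := (MulAction.orbit G x)ᶜ
          smul_mem' := fun g y hy h => hy (by
            have := MulAction.mem_orbit_of_mem_orbit g⁻¹ h
            rwa [inv_smul_smul] at this) }
      let e := orbitSumEquiv X x C rfl
      have hcard : Nat.card (G ⧸ MulAction.stabilizer G x) + Nat.card C = Nat.card X := by
        rw [← Nat.card_sum, Nat.card_congr e]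
      have hpos : 0 < Nat.card (G ⧸ MulAction.stabilizer G x) := Nat.card_pos
      obtain ⟨L, h1, h2, h3⟩ := ih (Nat.card C) (by omega) C rfl
      refine ⟨MulAction.stabilizer G x :: L, ?_, ?_, ?_⟩
      · rw [← permChar_congr e (orbitSumEquiv_smul X x C rfl), permChar_sum, h1, List.map_cons,
          List.sum_cons]
      · rw [← sgn_congr e (orbitSumEquiv_smul X x C rfl), sgn_sum, h2, List.map_cons,
          List.prod_cons]
      · rw [← hcard, h3, List.map_cons, List.sum_cons]

end

section

variable {G : Type u} [Group G] [Finite G]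

/-- Identify `G/H` with `G/K × K/H`: `g` permutes the first factor and acts on the fibre over `x` by
an element `κ x` of `K`. With `s` the sign on `G/K` and `n = |K/H|`, the sign is `s ^ n ∏ sgn (κ
x)`, while the determinant of the representation induced from the sign of `K/H` is `s ∏ sgn (κ x)`;
they differ by `s ^ (n + 1)` since `s ^ 2 = 1`. -/
theorem sgn_quotient_of_le {H K : Subgroup G} (hle : H ≤ K) [Fintype (G ⧸ K)]
    [DecidableEq (G ⧸ K)] (g : G) :
    signFun (sgn G (G ⧸ H)) g =
      (monomialHom K (signHom (sgn K (K ⧸ H.subgroupOf K))) g).det *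
        signFun (sgn G (G ⧸ K)) g ^ (Nat.card (K ⧸ H.subgroupOf K) + 1) := by
  classical
  let _ := Fintype.ofFinite (G ⧸ H)
  let _ := Fintype.ofFinite (K ⧸ H.subgroupOf K)
  have hmem : ∀ x : G ⧸ K, (Quotient.out (g • x))⁻¹ * g * Quotient.out x ∈ K := fun x =>
    (mem_iff_smul_eq K g _ _).2 rfl
  let κ : G ⧸ K → K := fun x => ⟨_, hmem x⟩
  let T : Equiv.Perm ((G ⧸ K) × (K ⧸ H.subgroupOf K)) :=
    Equiv.prodCongrLeft (fun _ => (MulAction.toPerm g : Equiv.Perm (G ⧸ K))) *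
      Equiv.prodCongrRight (fun x => (MulAction.toPerm (κ x) : Equiv.Perm (K ⧸ H.subgroupOf K)))
  have hT : Equiv.Perm.sign (MulAction.toPerm g : Equiv.Perm (G ⧸ H)) = Equiv.Perm.sign T := by
    refine Equiv.Perm.sign_eq_sign_of_equiv _ _ (Subgroup.quotientEquivProdOfLE hle) ?_
    refine Quotient.ind' fun a => ?_
    refine Prod.ext rfl (congrArg Quotient.mk'' (Subtype.ext ?_))
    change (Quotient.out (g • (a : G ⧸ K)))⁻¹ * (g * a) = (Quotient.out (g • (a : G ⧸ K)))⁻¹ * g *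
      Quotient.out (a : G ⧸ K) * ((Quotient.out (a : G ⧸ K))⁻¹ * a)
    group
  rw [det_monomialHom, signFun, sgn_apply, hT, Equiv.Perm.sign_mul, Equiv.Perm.sign_prodCongrLeft,
    Equiv.Perm.sign_prodCongrRight]
  have hκ : ∀ x : G ⧸ K, extZero K (signHom (sgn K (K ⧸ H.subgroupOf K)))
      ((Quotient.out (g • x))⁻¹ * g * Quotient.out x) =
      ((Equiv.Perm.sign (MulAction.toPerm (κ x) : Equiv.Perm (K ⧸ H.subgroupOf K)) : ℤ) : ℂ) := by
    intro x
    rw [extZero_of_mem _ (hmem x), ← sgn_apply]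
    rfl
  rw [Finset.prod_congr rfl fun x _ => hκ x]
  have hs : (((sgn G (G ⧸ K) g : ℤ) : ℂ)) ^ 2 = 1 := by
    rcases Int.units_eq_one_or (sgn G (G ⧸ K) g) with h | h <;> simp [h]
  simp only [signFun, Finset.prod_const, Finset.card_univ, ← sgn_apply, Units.val_mul,
    Units.val_pow_eq_pow_val, Int.cast_mul, Int.cast_pow, Units.coe_prod, Int.cast_prod,
    ← Nat.card_eq_fintype_card]
  linear_combination (-(((sgn G (G ⧸ K) g : ℤ) : ℂ)) ^ (Nat.card (K ⧸ H.subgroupOf K)) *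
    ∏ x : G ⧸ K, ((sgn K (K ⧸ H.subgroupOf K) (κ x) : ℤ) : ℂ)) * hs

end

/-! ### Relations between quadratic characters -/

theorem signFun_mul {G : Type*} [Group G] (ε₁ ε₂ : G →* ℤˣ) (g : G) :
    signFun (ε₁ * ε₂) g = signFun ε₁ g * signFun ε₂ g := by
  simp [signFun]

theorem signFun_one {G : Type*} [Group G] (g : G) : signFun (1 : G →* ℤˣ) g = 1 := by
  simp [signFun]

theorem signFun_eq_or {G : Type*} [Group G] (ε : G →* ℤˣ) (g : G) :
    signFun ε g = 1 ∨ signFun ε g = -1 := by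
  rcases Int.units_eq_one_or (ε g) with h | h <;> simp [signFun, h]

theorem signFun_sq {G : Type*} [Group G] (ε : G →* ℤˣ) (g : G) : signFun ε g ^ 2 = 1 := by
  rcases signFun_eq_or ε g with h | h <;> simp [h]

theorem signFun_pow {G : Type*} [Group G] (ε : G →* ℤˣ) (n : ℕ) (g : G) :
    signFun (ε ^ n) g = signFun ε g ^ n := by
  simp [signFun]

theorem signFun_mul_self {G : Type*} [Group G] (ε : G →* ℤˣ) (g : G) :
    signFun (ε * ε) g = 1 := by
  rw [signFun_mul, ← sq, signFun_sq]

theorem prod_surjective_of_ne {G : Type*} [Group G] {ε₁ ε₂ : G →* ℤˣ} (h1 : ε₁ ≠ 1)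
    (h2 : ε₂ ≠ 1) (h12 : ε₁ ≠ ε₂) : Function.Surjective (ε₁.prod ε₂) := by
  have h3 : ε₁ * ε₂ ≠ 1 := by
    intro h
    apply h12
    ext g
    have := DFunLike.congr_fun h g
    simp only [MonoidHom.mul_apply, MonoidHom.one_apply] at this
    rw [eq_inv_of_mul_eq_one_left this, Int.units_inv_eq_self]
  have hneg : ∀ ε : G →* ℤˣ, ε ≠ 1 → ∃ g, ε g = -1 := by
    intro ε hε
    by_contra! h
    exact hε (MonoidHom.ext fun g => (Int.units_eq_one_or (ε g)).resolve_right (h g))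
  obtain ⟨a, ha⟩ := hneg _ h1
  obtain ⟨b, hb⟩ := hneg _ h2
  obtain ⟨c, hc⟩ := hneg _ h3
  have hx : ∃ x, ε₁ x = -1 ∧ ε₂ x = 1 := by
    rcases Int.units_eq_one_or (ε₂ a) with h | h
    · exact ⟨a, ha, h⟩
    · rcases Int.units_eq_one_or (ε₁ c) with h' | h'
      · refine ⟨a * c, by simp [ha, h'], ?_⟩
        have : ε₂ c = -1 := by simpa [h'] using hc
        simp [h, this]
      · refine ⟨c, h', ?_⟩
        simpa [h'] using hc
  have hy : ∃ y, ε₁ y = 1 ∧ ε₂ y = -1 := by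
    obtain ⟨x, hx1, hx2⟩ := hx
    rcases Int.units_eq_one_or (ε₁ b) with h | h
    · exact ⟨b, h, hb⟩
    · exact ⟨x * b, by simp [hx1, h], by simp [hx2, hb]⟩
  obtain ⟨x, hx1, hx2⟩ := hx
  obtain ⟨y, hy1, hy2⟩ := hy
  rintro ⟨u, v⟩
  rcases Int.units_eq_one_or u with rfl | rfl <;> rcases Int.units_eq_one_or v with rfl | rfl
  · exact ⟨1, by simp⟩
  · exact ⟨y, by simp [hy1, hy2]⟩
  · exact ⟨x, by simp [hx1, hx2]⟩
  · exact ⟨x * y, by simp [hx1, hx2, hy1, hy2]⟩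

/-- Two distinct nontrivial quadratic characters define a quotient isomorphic to `C₂ × C₂`. -/
theorem isBasicDihedral_quotient_ker_prod {G : Type u} [Group G] {ε₁ ε₂ : G →* ℤˣ} (h1 : ε₁ ≠ 1)
    (h2 : ε₂ ≠ 1) (h12 : ε₁ ≠ ε₂) : IsBasicDihedral (G ⧸ (ε₁.prod ε₂).ker) := by
  have hsurj := prod_surjective_of_ne h1 h2 h12
  have hcard : Nat.card ℤˣ = 2 := by simp
  have hcard' : Nat.card (Multiplicative (ZMod 2)) = 2 := by simp
  have : Fact (Nat.Prime 2) := ⟨Nat.prime_two⟩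
  exact Or.inl ⟨(QuotientGroup.quotientKerEquivOfSurjective _ hsurj).trans
    (MulEquiv.prodCongr (mulEquivOfPrimeCardEq hcard hcard') (mulEquivOfPrimeCardEq hcard hcard'))⟩

section

variable {G : Type u} [Group G] [Finite G]

theorem monoidHom_mem_monomialCharacters (χ : G →* ℂ) : ⇑χ ∈ monomialCharacters G := by
  have := indHom_mem_monomialCharacters (MonoidHom.id G) Function.injective_id χ
  rwa [indHom_id _ (monoidHom_conj_invariant χ)] at this

theorem const_mem_monomialCharacters (n : ℤ) : (fun _ => (n : ℂ)) ∈ monomialCharacters G := by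
  have := zsmul_mem (monoidHom_mem_monomialCharacters (1 : G →* ℂ)) n
  convert this using 1
  ext g
  simp

theorem permChar_quotient (H : Subgroup G) :
    permChar G (G ⧸ H) = indHom H.subtype (fun _ => 1) := by
  classical
  let _ := Fintype.ofFinite (G ⧸ H)
  ext g
  rw [permChar_apply, indHom_subtype_eq_sum_quotient _ _ (fun _ _ => rfl)]
  refine Finset.sum_congr rfl fun q _ => ?_
  split_ifs with h
  · rw [extZero_of_mem _ ((mem_iff_smul_eq H g q q).2 h.symm)]
  · rw [extZero_of_notMem]
    exact fun h' => h ((mem_iff_smul_eq H g q q).1 h').symm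

theorem permChar_mem_monomialCharacters (X : Type*) [MulAction G X] [Finite X] :
    permChar G X ∈ monomialCharacters G := by
  obtain ⟨L, h, -, -⟩ := exists_list_of_finite (G := G) _ X rfl
  rw [h]
  refine list_sum_mem fun x hx => ?_
  obtain ⟨H, -, rfl⟩ := List.mem_map.1 hx
  rw [permChar_quotient]
  exact indHom_mem_monomialCharacters H.subtype H.subtype_injective 1

variable {P : AddSubgroup (G → ℂ)}

/-- Twice a real difference of equal degree lies in an admissible subgroup. -/
theorem Admissible.two_mul_mem (hP : Admissible P) {τ : G → ℂ} (hτ : τ ∈ monomialCharacters G)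
    (h1 : τ 1 = 0) (hreal : ∀ g, starRingEnd ℂ (τ g) = τ g) : (fun g => 2 * τ g) ∈ P := by
  have := hP.add_conj_mem τ hτ h1
  convert this using 1
  ext g
  rw [hreal, two_mul]

/-- For distinct nontrivial characters, condition 2 applies to `ε₁ ⊕ ε₂`, which factors through `C₂
× C₂`. Equal characters give `2(ε - 1)`, covered by condition 1. If one is trivial the expression
vanishes. -/
theorem Admissible.sign_add_sign_mem (hP : Admissible P) (ε₁ ε₂ : G →* ℤˣ) :
    (fun g => signFun ε₁ g + signFun ε₂ g - 1 - signFun (ε₁ * ε₂) g) ∈ P := by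
  by_cases h1 : ε₁ = 1
  · subst h1
    convert zero_mem P using 1
    ext g
    simp [signFun_one]
  by_cases h2 : ε₂ = 1
  · subst h2
    convert zero_mem P using 1
    ext g
    simp [signFun_one]
  by_cases h12 : ε₁ = ε₂
  · subst h12
    have := hP.two_mul_mem (τ := signFun ε₁ - fun _ => ((1 : ℤ) : ℂ))
      (sub_mem (monoidHom_mem_monomialCharacters (signHom ε₁)) (const_mem_monomialCharacters 1))
      (by simp [signFun]) (fun g => by simp [signFun])
    convert this using 1
    ext g
    simp [signFun_mul_self]
    ring
  · let A : G →* Matrix (Fin 2) (Fin 2) ℂ :=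
      { toFun := fun g => Matrix.diagonal ![signFun ε₁ g, signFun ε₂ g]
        map_one' := by
          rw [← Matrix.diagonal_one]
          congr 1
          ext i
          fin_cases i <;> simp [signFun]
        map_mul' := fun a b => by
          rw [Matrix.diagonal_mul_diagonal]
          congr 1
          ext i
          fin_cases i <;> simp [signFun] }
    have hA : ∀ g, A g = Matrix.diagonal ![signFun ε₁ g, signFun ε₂ g] := fun _ => rfl
    have := hP.indHom_mem G (MonoidHom.id G) Function.injective_id A (ε₁.prod ε₂).ker (by
      intro n hn
      have h := MonoidHom.mem_ker.1 hn
      simp only [MonoidHom.prod_apply, Prod.mk_eq_one] at h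
      rw [hA, ← Matrix.diagonal_one]
      congr 1
      ext i
      fin_cases i <;> simp [signFun, h.1, h.2]) (isBasicDihedral_quotient_ker_prod h1 h2 h12)
    have hf : (fun h => (A h).trace - 1 - (A h).det) =
        fun g => signFun ε₁ g + signFun ε₂ g - 1 - signFun (ε₁ * ε₂) g := by
      ext g
      rw [hA, Matrix.trace_fin_two, Matrix.det_diagonal]
      simp [Fin.prod_univ_two, signFun_mul]
    rw [hf, indHom_id] at this
    · exact this
    · intro x g
      simp only [← coe_signHom, monoidHom_conj_invariant]

theorem Admissible.sign_list_mem (hP : Admissible P) (L : List (G →* ℤˣ)) :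
    (fun g => (L.map fun ε => signFun ε g).sum - ((L.length : ℂ) - 1) - signFun L.prod g) ∈ P := by
  induction L with
  | nil =>
    convert zero_mem P using 1
    ext g
    simp [signFun_one]
  | cons ε L ih =>
    convert add_mem ih (hP.sign_add_sign_mem ε L.prod) using 1
    ext g
    simp
    ring

theorem Admissible.sign_pow_mem (hP : Admissible P) (ε : G →* ℤˣ) (n : ℕ) :
    (fun g => n * signFun ε g - ((n : ℂ) - 1) - signFun (ε ^ n) g) ∈ P := by
  convert hP.sign_list_mem (List.replicate n ε) using 1
  ext g
  simp

/-- The permutation character of `X` is congruent modulo `P` to the sum of its sign character and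
a multiple of the trivial character. -/
def SignCongr (P : AddSubgroup (G → ℂ)) (X : Type*) [MulAction G X] [Finite X] : Prop :=
  (fun g => permChar G X g - signFun (sgn G X) g - ((Nat.card X : ℂ) - 1)) ∈ P

/-- Over a disjoint union of orbits the characters add while the signs multiply; `ε₁ + ε₂ ≡ 1 +
ε₁ε₂` reconciles the two. -/
theorem Admissible.signCongr_of_forall_quotient (hP : Admissible P)
    (h : ∀ H : Subgroup G, SignCongr P (G ⧸ H)) (X : Type*) [MulAction G X] [Finite X] :
    SignCongr P X := by
  obtain ⟨L, h1, h2, h3⟩ := exists_list_of_finite (G := G) _ X rfl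
  rw [SignCongr, h1, h2, h3]
  clear h1 h2 h3
  induction L with
  | nil =>
    convert zero_mem P using 1
    ext g
    simp [signFun_one]
  | cons H L ih =>
    convert add_mem (add_mem ih (h H)) (hP.sign_add_sign_mem (sgn G (G ⧸ H))
      (L.map fun H => sgn G (G ⧸ H)).prod) using 1
    ext g
    simp [-Nat.card_eq_fintype_card]
    ring

end

/-! ### Dihedral groups and subgroups of index two -/

/-- A group of order `2n` generated by an element of order `n > 2` and an involution inverting it
is dihedral. -/
theorem nonempty_mulEquiv_dihedralGroup {Q : Type*} [Group Q] {n : ℕ} (hn : 2 < n) (x y : Q)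
    (hx : orderOf x = n) (hy : y * y = 1) (hxy : y * x * y * x = 1) (hcard : Nat.card Q = 2 * n) :
    Nonempty (Q ≃* DihedralGroup n) := by
  have hnz : NeZero n := ⟨by omega⟩
  let pw : ZMod n →+ Additive Q := ZMod.lift n ⟨zmultiplesHom (Additive Q) (Additive.ofMul x), by
    rw [zmultiplesHom_apply, ← ofMul_zpow, zpow_natCast, ← hx, pow_orderOf_eq_one, ofMul_one]⟩
  let p : ZMod n → Q := fun i => (pw i).toMul
  have p_int : ∀ k : ℤ, p k = x ^ k := by
    intro k
    simp only [p, pw, ZMod.lift_coe]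
    simp
  have p_add : ∀ i j, p (i + j) = p i * p j := fun i j => by simp [p]
  have p_sub : ∀ i j, p (j - i) = (p i)⁻¹ * p j := fun i j => by
    rw [eq_inv_mul_iff_mul_eq, ← p_add, add_sub_cancel]
  have p_sub' : ∀ i j, p (i - j) = p i * (p j)⁻¹ := fun i j => by
    rw [eq_mul_inv_iff_mul_eq, ← p_add, sub_add_cancel]
  have p_zero : p 0 = 1 := by simp [p]
  have hyx : y * x * y = x⁻¹ := eq_inv_of_mul_eq_one_left hxy
  have hyinv : y⁻¹ = y := inv_eq_of_mul_eq_one_left hy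
  have hconj : ∀ i, y * p i * y = (p i)⁻¹ := by
    intro i
    obtain ⟨k, rfl⟩ := ZMod.intCast_surjective i
    have h : (y * x * y⁻¹) ^ k = y * x ^ k * y⁻¹ := conj_zpow
    rw [hyinv, hyx, inv_zpow] at h
    rw [p_int, h]
  have p_inj : Function.Injective p := by
    intro i j hij
    obtain ⟨k, rfl⟩ := ZMod.intCast_surjective i
    obtain ⟨l, rfl⟩ := ZMod.intCast_surjective j
    rw [p_int, p_int, zpow_eq_zpow_iff_modEq, hx] at hij
    exact (ZMod.intCast_eq_intCast_iff _ _ _).2 hij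
  have hynot : ∀ i, y ≠ p i := by
    intro i hi
    obtain ⟨k, rfl⟩ := ZMod.intCast_surjective i
    rw [p_int] at hi
    have hcomm : y * x = x * y := by
      rw [hi, ← zpow_add_one, ← zpow_one_add, add_comm]
    have h2 : x ^ 2 = 1 := by
      rw [hcomm, mul_assoc x y y, hy, mul_one] at hxy
      rw [sq, hxy]
    have := Nat.le_of_dvd two_pos (orderOf_dvd_of_pow_eq_one h2)
    omega
  let F : DihedralGroup n →* Q :=
    { toFun := fun d => match d with
        | .r i => p i
        | .sr i => y * p i
      map_one' := p_zero
      map_mul' := by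
        rintro (i | i) (j | j)
        · exact p_add i j
        · change y * p (j - i) = p i * (y * p j)
          rw [p_sub, ← hconj]
          simp only [← mul_assoc, hy, one_mul]
        · change y * p (i + j) = y * p i * p j
          rw [p_add, mul_assoc]
        · change p (j - i) = y * p i * (y * p j)
          rw [p_sub, ← hconj]
          simp only [mul_assoc] }
  have hinj : Function.Injective F := by
    rintro (i | i) (j | j) h
    · exact congrArg _ (p_inj h)
    · have h' : p i = y * p j := h
      exact absurd (by rw [p_sub']; exact eq_mul_inv_of_mul_eq h'.symm) (hynot (i - j))
    · have h' : y * p i = p j := h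
      exact absurd (by rw [p_sub']; exact eq_mul_inv_of_mul_eq h') (hynot (j - i))
    · exact congrArg _ (p_inj (mul_left_cancel (h : y * p i = y * p j)))
  have hfin : Finite Q := Nat.finite_of_card_ne_zero (by omega)
  let _ := Fintype.ofFinite Q
  have hbij : Function.Bijective F := by
    rw [Fintype.bijective_iff_injective_and_card, DihedralGroup.card, ← Nat.card_eq_fintype_card,
      hcard]
    exact ⟨hinj, rfl⟩
  exact ⟨(MulEquiv.ofBijective F hbij).symm⟩

section

variable {G : Type*} [Group G]

/-- An invariant linear character of a subgroup of index two extends. -/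
theorem exists_extension_of_index_two {M : Type*} [CommMonoid M] {K : Subgroup G}
    (hK : K.index = 2) {s : G} (hs : s ∉ K) (φ : K →* M)
    (hφ : ∀ (k k' : K), (k' : G) = s⁻¹ * k * s → φ k' = φ k) (c : M)
    (hc : ∀ k : K, (k : G) = s * s → c * c = φ k) :
    ∃ Φ : G →* M, (∀ k : K, Φ k = φ k) ∧ ∀ k : K, Φ (s * k) = c * φ k := by
  classical
  have hsg : ∀ {g}, g ∉ K → s⁻¹ * g ∈ K := fun {g} hg => by
    rw [Subgroup.mul_mem_iff_of_index_two hK, inv_mem_iff]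
    tauto
  have hss : s * s ∈ K := Subgroup.mul_self_mem_of_index_two hK s
  -- `c` is the prescribed value at `s`; multiplicativity needs exactly the invariance of `φ` under
  -- `s` and `c * c = φ (s * s)`.
  let F : G → M := fun g => if h : g ∈ K then φ ⟨g, h⟩ else c * φ ⟨s⁻¹ * g, by exact hsg h⟩
  have F1 : ∀ {g} (h : g ∈ K), F g = φ ⟨g, h⟩ := fun h => dif_pos h
  have F2 : ∀ {g} (h : g ∉ K), F g = c * φ ⟨s⁻¹ * g, hsg h⟩ := fun h => dif_neg h
  have hmul : ∀ a b, F (a * b) = F a * F b := by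
    intro a b
    have hab := Subgroup.mul_mem_iff_of_index_two hK (a := a) (b := b)
    by_cases ha : a ∈ K <;> by_cases hb : b ∈ K
    · rw [F1 ha, F1 hb, F1 (hab.2 (by tauto)), ← map_mul]
      rfl
    · rw [F1 ha, F2 hb, F2 (by tauto), mul_left_comm]
      congr 1
      have hm : s⁻¹ * a * s ∈ K := by
        have := (Subgroup.normal_of_index_eq_two hK).conj_mem a ha s⁻¹
        rwa [inv_inv] at this
      rw [← hφ ⟨a, ha⟩ ⟨_, hm⟩ rfl, ← map_mul]
      congr 1
      ext
      simp only [Subgroup.coe_mul]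
      group
    · rw [F2 ha, F1 hb, F2 (by tauto), mul_assoc, ← map_mul]
      congr 2
      ext
      simp only [Subgroup.coe_mul]
      group
    · rw [F2 ha, F2 hb, F1 (hab.2 (by tauto)), mul_mul_mul_comm, hc ⟨s * s, hss⟩ rfl]
      have hm : s⁻¹ * (s⁻¹ * a) * s ∈ K := by
        have := (Subgroup.normal_of_index_eq_two hK).conj_mem _ (hsg ha) s⁻¹
        rwa [inv_inv] at this
      rw [← hφ ⟨s⁻¹ * a, hsg ha⟩ ⟨_, hm⟩ rfl, ← map_mul, ← map_mul]
      congr 1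
      ext
      simp only [Subgroup.coe_mul]
      group
  refine ⟨⟨⟨F, ?_⟩, hmul⟩, fun k => ?_, fun k => ?_⟩
  · rw [F1 K.one_mem]
    exact map_one φ
  · exact F1 k.2
  · change F (s * k) = _
    have : s * (k : G) ∉ K := fun h => hs ((K.mul_mem_cancel_right k.2).1 h)
    rw [F2 this]
    congr 2
    ext
    simp

end

section

variable {G : Type*} [Group G] [Finite G]

omit [Finite G] in
theorem extZero_conj_of_mem {K : Subgroup G} (χ : K →* ℂ) {k : G} (hk : k ∈ K) (g : G) :
    extZero K χ (k⁻¹ * g * k) = extZero K χ g := by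
  by_cases hg : g ∈ K
  · rw [extZero_of_mem _ hg, extZero_of_mem _ (K.mul_mem (K.mul_mem (K.inv_mem hk) hg) hk),
      ← monoidHom_conj_invariant χ ⟨k, hk⟩ ⟨g, hg⟩]
    rfl
  · rw [extZero_of_notMem _ hg, extZero_of_notMem]
    intro h
    exact hg ((K.mul_mem_cancel_left (K.inv_mem hk)).1 ((K.mul_mem_cancel_right hk).1 h))

theorem indHom_index_two_apply {K : Subgroup G} (hK : K.index = 2) {s : G} (hs : s ∉ K)
    (χ : K →* ℂ) (g : G) :
    indHom K.subtype χ g = extZero K χ g + extZero K χ (s⁻¹ * g * s) := by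
  classical
  let _ := Fintype.ofFinite (G ⧸ K)
  have hrep : ∀ a : G, extZero K χ ((Quotient.out (a : G ⧸ K))⁻¹ * g * Quotient.out (a : G ⧸ K)) =
      extZero K χ (a⁻¹ * g * a) := by
    intro a
    have hk : a⁻¹ * Quotient.out (a : G ⧸ K) ∈ K :=
      QuotientGroup.eq.1 (Quotient.out_eq' (a : G ⧸ K)).symm
    rw [← extZero_conj_of_mem χ hk (a⁻¹ * g * a)]
    congr 1
    group
  have huniv : (Finset.univ : Finset (G ⧸ K)) = {((1 : G) : G ⧸ K), (s : G ⧸ K)} := by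
    symm
    rw [Finset.eq_univ_iff_forall]
    refine Quotient.ind' fun a => ?_
    rw [Finset.mem_insert, Finset.mem_singleton]
    by_cases ha : a ∈ K
    · left
      refine QuotientGroup.eq.2 ?_
      simpa using ha
    · right
      refine QuotientGroup.eq.2 ?_
      rw [Subgroup.mul_mem_iff_of_index_two hK, inv_mem_iff]
      tauto
  have hne : ((1 : G) : G ⧸ K) ≠ (s : G ⧸ K) := by
    rw [Ne, QuotientGroup.eq]
    simpa using hs
  rw [indHom_subtype_eq_sum_quotient K χ (monoidHom_conj_invariant χ), huniv,
    Finset.sum_pair hne, hrep, hrep]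
  simp

/-- The two-dimensional representation induced from a subgroup of index two. -/
theorem exists_matrix_of_index_two {K : Subgroup G} [Fintype (G ⧸ K)] [DecidableEq (G ⧸ K)]
    (hK : K.index = 2) (χ : K →* ℂ) :
    ∃ A : G →* Matrix (Fin 2) (Fin 2) ℂ, (∀ g, (A g).trace = indHom K.subtype χ g) ∧
      (∀ g, (A g).det = (monomialHom K χ g).det) ∧ ∀ g, monomialHom K χ g = 1 → A g = 1 := by
  let e : (G ⧸ K) ≃ Fin 2 := Finite.equivFinOfCardEq hK
  refine ⟨(Matrix.reindexAlgEquiv ℂ ℂ e).toMonoidHom.comp (monomialHom K χ), fun g => ?_,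
    fun g => ?_, fun g hg => ?_⟩
  · rw [← trace_monomialHom]
    exact Equiv.sum_comp e.symm (fun i => monomialHom K χ g i i)
  · exact Matrix.det_reindexAlgEquiv ℂ ℂ e (monomialHom K χ g)
  · change (Matrix.reindexAlgEquiv ℂ ℂ e) (monomialHom K χ g) = 1
    rw [hg, map_one]

/-- For a `2 × 2` matrix, `2 det A = (tr A)² - tr (A²)`; determinants can thus be read off from
induced characters. -/
theorem det_monomialHom_index_two {K : Subgroup G} [Fintype (G ⧸ K)] [DecidableEq (G ⧸ K)]
    (hK : K.index = 2) (χ : K →* ℂ) (g : G) :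
    (monomialHom K χ g).det =
      (indHom K.subtype χ g ^ 2 - indHom K.subtype χ (g * g)) / 2 := by
  obtain ⟨A, h1, h2, -⟩ := exists_matrix_of_index_two hK χ
  rw [← h1, ← h1, ← h2, map_mul, Matrix.det_fin_two, Matrix.trace_fin_two, Matrix.trace_fin_two,
    Matrix.mul_apply, Matrix.mul_apply, Fin.sum_univ_two, Fin.sum_univ_two]
  ring

end

theorem Admissible.indHom_index_two_mem {G S : Type u} [Group G] [Finite G] [Group S] [Finite S]
    {P : AddSubgroup (G → ℂ)} (hP : Admissible P) (f : S →* G) (hf : Function.Injective f)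
    {T : Subgroup S} [Fintype (S ⧸ T)] [DecidableEq (S ⧸ T)] (hT : T.index = 2) (χ : T →* ℂ)
    (N : Subgroup S) [N.Normal] (hN : ∀ n ∈ N, extZero T χ n = 1) (hD : IsBasicDihedral (S ⧸ N)) :
    indHom f (fun g => indHom T.subtype χ g - 1 - (monomialHom T χ g).det) ∈ P := by
  obtain ⟨A, h1, h2, h3⟩ := exists_matrix_of_index_two hT χ
  have := hP.indHom_mem S f hf A N (fun n hn => h3 n ?_) hD
  · simpa only [h1, h2] using this
  · have hNT : N ≤ T := fun m hm => by
      by_contra h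
      have := hN m hm
      rw [extZero_of_notMem _ h] at this
      exact zero_ne_one this
    ext i j
    rw [monomialHom_apply, Matrix.one_apply]
    split_ifs with h
    · subst h
      refine hN _ ?_
      have := ‹N.Normal›.conj_mem n hn (Quotient.out i)⁻¹
      rwa [inv_inv] at this
    · refine extZero_of_notMem _ ?_
      have hT' := Subgroup.normal_of_index_eq_two hT
      have h1 : (Quotient.out i)⁻¹ * n * Quotient.out i ∈ T := by
        have := hT'.conj_mem n (hNT hn) (Quotient.out i)⁻¹
        rwa [inv_inv] at this
      intro h2
      have h3 := T.mul_mem (T.inv_mem h1) h2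
      have h4 : ((Quotient.out i)⁻¹ * n * Quotient.out i)⁻¹ * ((Quotient.out i)⁻¹ * n * Quotient.out j)
        = (Quotient.out i)⁻¹ * 1 * Quotient.out j := by group
      rw [h4, mem_iff_smul_eq, one_smul] at h3
      exact h h3

section

variable {G : Type*} [Group G] [Finite G]

omit [Finite G] in
theorem extZero_signHom_mul_self {K : Subgroup G} (δ : K →* ℤˣ) {w : G} (hw : w ∈ K) :
    extZero K (signHom δ) (w * w) = 1 := by
  rw [extZero_mul_of_right_mem _ _ hw, extZero_of_mem _ hw, ← sq]
  exact signFun_sq δ _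

omit [Finite G] in
theorem extZero_signHom_eq_or {K : Subgroup G} (δ : K →* ℤˣ) {w : G} (hw : w ∈ K) :
    extZero K (signHom δ) w = 1 ∨ extZero K (signHom δ) w = -1 := by
  rw [extZero_of_mem _ hw]
  exact signFun_eq_or δ _

/-- Let `δ'` be the conjugate of `δ` by `s` and `N = ker δ ∩ ker δ'`. As `δ` and `δ'` are distinct
and nontrivial, `N` has index `4` in `K` and `8` in `G`. Modulo `N`, `s` is an involution, `s * u`
has order `4` because `δ` takes the value `δ' u * δ u = -1` on its square, and `s` inverts `s * u`.
Hence the quotient is `D₈`. -/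
theorem isBasicDihedral_of_index_two_of_not_invariant {G : Type u} [Group G] [Finite G]
    {K : Subgroup G} (hK : K.index = 2) (δ : K →* ℤˣ) {s : G} (hs : s ∉ K)
    (hss : extZero K (signHom δ) (s * s) = 1) {u : G} (hu : u ∈ K)
    (hne : extZero K (signHom δ) (s⁻¹ * u * s) ≠ extZero K (signHom δ) u) :
    ∃ (N : Subgroup G) (_ : N.Normal), (∀ n ∈ N, extZero K (signHom δ) n = 1) ∧
      IsBasicDihedral (G ⧸ N) := by
  have hKn := Subgroup.normal_of_index_eq_two hK
  have hconj : ∀ {k : G}, k ∈ K → s⁻¹ * k * s ∈ K := fun {k} hk => by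
    have := hKn.conj_mem k hk s⁻¹
    rwa [inv_inv] at this
  have hssK : s * s ∈ K := Subgroup.mul_self_mem_of_index_two hK s
  set e := extZero K (signHom δ) with he
  have e_mul : ∀ (a : G) {b : G}, b ∈ K → e (a * b) = e a * e b :=
    fun a _ hb => extZero_mul_of_right_mem _ a hb
  have e_or : ∀ {k}, k ∈ K → e k = 1 ∨ e k = -1 := extZero_signHom_eq_or δ
  have e_conj : ∀ {k : G}, k ∈ K → ∀ g, e (k⁻¹ * g * k) = e g := fun hk g =>
    extZero_conj_of_mem (signHom δ) hk g
  let δ' : K →* ℤˣ := δ.comp (MulAut.conjNormal s⁻¹).toMonoidHom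
  have eδ : ∀ k : K, e k = signFun δ k := fun k => extZero_of_mem _ k.2
  have eδ' : ∀ k : K, e (s⁻¹ * k * s) = signFun δ' k := fun k => by
    rw [he, extZero_of_mem _ (hconj k.2)]
    change signFun δ _ = signFun δ _
    congr 1
    ext
    simp
  have hδ' : δ' ≠ δ := by
    intro h
    apply hne
    rw [eδ' ⟨u, hu⟩, eδ ⟨u, hu⟩, h]
  have hδ1 : δ ≠ 1 := by
    rintro rfl
    exact hδ' (by ext; simp [δ'])
  have hδ'1 : δ' ≠ 1 := by
    intro h
    apply hδ1
    ext k
    obtain ⟨l, rfl⟩ := (MulAut.conjNormal (H := K) s⁻¹).surjective k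
    exact congrArg _ (DFunLike.congr_fun h l)
  have hsurj := prod_surjective_of_ne hδ1 hδ'1 hδ'.symm
  let N : Subgroup G := (δ.prod δ').ker.map K.subtype
  have hNmem : ∀ n, n ∈ N ↔ n ∈ K ∧ e n = 1 ∧ e (s⁻¹ * n * s) = 1 := by
    have hone : ∀ (ε : K →* ℤˣ) k, signFun ε k = 1 ↔ ε k = 1 := fun ε k => by
      rcases Int.units_eq_one_or (ε k) with h | h
      · simp [signFun, h]
      · simp only [signFun, h]
        norm_num
    intro n
    constructor
    · rintro ⟨k, hk, rfl⟩
      have hk' := MonoidHom.mem_ker.1 hk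
      simp only [MonoidHom.prod_apply, Prod.mk_eq_one] at hk'
      rw [Subgroup.subtype_apply, eδ, eδ', hone, hone]
      exact ⟨k.2, hk'⟩
    · rintro ⟨hn, h1, h2⟩
      refine ⟨⟨n, hn⟩, ?_, rfl⟩
      rw [eδ ⟨n, hn⟩, hone] at h1
      rw [eδ' ⟨n, hn⟩, hone] at h2
      exact MonoidHom.mem_ker.2 (Prod.ext h1 h2)
  have hNconj : ∀ n ∈ N, ∀ g, e (g⁻¹ * n * g) = 1 := by
    intro n hn g
    obtain ⟨-, h1, h2⟩ := (hNmem n).1 hn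
    by_cases hg : g ∈ K
    · rw [e_conj hg, h1]
    · have hg' : s⁻¹ * g ∈ K := by
        rw [Subgroup.mul_mem_iff_of_index_two hK, inv_mem_iff]
        tauto
      rw [← h2, ← e_conj hg' (s⁻¹ * n * s)]
      congr 1
      group
  have hN : N.Normal := ⟨fun n hn g => (hNmem _).2 ⟨hKn.conj_mem n ((hNmem n).1 hn).1 g, by
      have := hNconj n hn g⁻¹
      rwa [inv_inv] at this, by
      rw [← hNconj n hn (g⁻¹ * s)]
      congr 1
      group⟩⟩
  have hsq : ∀ w ∈ K, w * w ∈ N := fun w hw => (hNmem _).2 ⟨K.mul_mem hw hw,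
    extZero_signHom_mul_self δ hw, by
      rw [← extZero_signHom_mul_self δ (hconj hw)]
      congr 1
      group⟩
  have hindex : N.index = 2 * 4 := by
    rw [Subgroup.index_map_subtype, hK, Subgroup.index_ker, MonoidHom.range_eq_top.2 hsurj,
      Subgroup.card_top, Nat.card_prod]
    simp
  refine ⟨N, hN, fun n hn => ((hNmem n).1 hn).2.1, Or.inr (Or.inl ?_)⟩
  refine nonempty_mulEquiv_dihedralGroup (by norm_num) ((s * u : G) : G ⧸ N) (s : G ⧸ N) ?_ ?_ ?_
    hindex
  · have := Fact.mk Nat.prime_two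
    refine orderOf_eq_prime_pow (p := 2) (n := 1) ?_ ?_
    · rw [pow_one, ← QuotientGroup.mk_pow, QuotientGroup.eq_one_iff, hNmem]
      rintro ⟨-, h, -⟩
      have h1 : (s * u) ^ 2 = s * s * (s⁻¹ * u * s) * u := by
        rw [sq]
        group
      rw [h1, e_mul _ hu, e_mul _ (hconj hu), hss, one_mul] at h
      rcases e_or hu with h2 | h2 <;> rcases e_or (hconj hu) with h3 | h3
      · exact hne (h3.trans h2.symm)
      · rw [h2, h3] at h
        norm_num at h
      · rw [h2, h3] at h
        norm_num at h
      · exact hne (h3.trans h2.symm)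
    · rw [← QuotientGroup.mk_pow, QuotientGroup.eq_one_iff]
      have h1 : (s * u) ^ 2 ^ (1 + 1) = ((s * u) * (s * u)) * ((s * u) * (s * u)) := by
        norm_num [pow_succ, mul_assoc]
      rw [h1]
      exact hsq _ (Subgroup.mul_self_mem_of_index_two hK _)
  · rw [← QuotientGroup.mk_mul, QuotientGroup.eq_one_iff, hNmem]
    refine ⟨hssK, hss, ?_⟩
    rw [← hss]
    congr 1
    group
  · simp only [← QuotientGroup.mk_mul]
    rw [QuotientGroup.eq_one_iff]
    have h1 : s * (s * u) * s * (s * u) = (s * s * u) * (s * s * u) := by group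
    rw [h1]
    exact hsq _ (K.mul_mem hssK hu)

end

variable {G : Type u} [Group G] [Finite G] {P : AddSubgroup (G → ℂ)}

/-- Take `s ∉ K`. If `δ` is `s`-invariant with `δ(s²) = 1`, it extends to a quadratic `E`, and the
induced character is `E + Eη` with `η` the quadratic character of `G/K`. If it is invariant with
`δ(s²) = -1`, it extends to `χ` with `χ(s) = i`, and the induced character is `χ + χ̄` with
determinant `1`, so condition 1 applies to `χ - 1`. If `δ` is not invariant, the representation
factors through `D₈`. -/
theorem Admissible.indHom_sign_index_two_mem (hP : Admissible P) {K : Subgroup G}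
    [Fintype (G ⧸ K)] [DecidableEq (G ⧸ K)] (hK : K.index = 2) (δ : K →* ℤˣ) :
    (fun g => indHom K.subtype (signFun δ) g - 1 - (monomialHom K (signHom δ) g).det) ∈ P := by
  have hKn := Subgroup.normal_of_index_eq_two hK
  obtain ⟨s, hs⟩ : ∃ s, s ∉ K := by
    by_contra! h
    rw [(Subgroup.eq_top_iff' K).2 h, Subgroup.index_top] at hK
    exact absurd hK (by norm_num)
  have hconj : ∀ {k : G}, k ∈ K → s⁻¹ * k * s ∈ K := fun {k} hk => by
    have := hKn.conj_mem k hk s⁻¹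
    rwa [inv_inv] at this
  have hss : s * s ∈ K := Subgroup.mul_self_mem_of_index_two hK s
  have hcases : ∀ g, g ∈ K ∨ ∃ k : K, g = s * k := by
    intro g
    by_cases hg : g ∈ K
    · exact Or.inl hg
    · refine Or.inr ⟨⟨s⁻¹ * g, ?_⟩, by simp⟩
      rw [Subgroup.mul_mem_iff_of_index_two hK, inv_mem_iff]
      tauto
  have hsk : ∀ k : K, s * (k : G) ∉ K := fun k h => hs ((K.mul_mem_cancel_right k.2).1 h)
  set e := extZero K (signHom δ) with he
  have heK : ∀ k : K, e k = signFun δ k := fun k => extZero_of_mem _ k.2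
  have htr : ∀ g, indHom K.subtype (signFun δ) g = e g + e (s⁻¹ * g * s) :=
    indHom_index_two_apply hK hs (signHom δ)
  have htr0 : ∀ k : K, indHom K.subtype (signFun δ) (s * k) = 0 := by
    intro k
    rw [htr, he, extZero_of_notMem _ (hsk k), extZero_of_notMem, zero_add]
    intro h
    apply hsk k
    have := hKn.conj_mem _ h s
    convert this using 1
    group
  have hdet : ∀ g, (monomialHom K (signHom δ) g).det =
      (indHom K.subtype (signFun δ) g ^ 2 - indHom K.subtype (signFun δ) (g * g)) / 2 :=
    det_monomialHom_index_two hK (signHom δ)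
  by_cases hinv : ∀ k : K, e (s⁻¹ * k * s) = e k
  · have htrK : ∀ k : K, indHom K.subtype (signFun δ) k = 2 * signFun δ k := by
      intro k
      rw [htr, hinv, heK, two_mul]
    have hdetK : ∀ k : K, (monomialHom K (signHom δ) k).det = 1 := by
      intro k
      have h1 : signFun δ (k * k) = 1 := by
        rw [← coe_signHom, map_mul, ← sq]
        exact signFun_sq δ k
      rw [hdet, htrK, ← Subgroup.coe_mul, htrK, h1, mul_pow, signFun_sq]
      norm_num
    have hdets : ∀ k : K, (monomialHom K (signHom δ) (s * k)).det = - e (s * s) := by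
      intro k
      have h1 : s * (k : G) * (s * k) = ((⟨s * s, hss⟩ * (⟨s⁻¹ * k * s, hconj k.2⟩ * k) : K) : G) := by
        simp only [Subgroup.coe_mul]
        group
      have h2 : signFun δ (⟨s * s, hss⟩ * (⟨s⁻¹ * k * s, hconj k.2⟩ * k)) = e (s * s) := by
        rw [← coe_signHom, map_mul, map_mul, coe_signHom, ← heK, ← heK, ← heK]
        have h3 := hinv k
        have h4 := signFun_sq δ k
        rw [← heK] at h4
        change e (s * s) * (e (s⁻¹ * k * s) * e k) = _
        rw [h3, ← sq (e k), h4, mul_one]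
      rw [hdet, htr0, h1, htrK, h2]
      ring
    have hφ : ∀ k k' : K, (k' : G) = s⁻¹ * k * s → signFun δ k' = signFun δ k := by
      intro k k' h
      rw [← heK, ← heK, h, hinv]
    have hs2 : e (s * s) = signFun δ ⟨s * s, hss⟩ := extZero_of_mem _ hss
    have sign_inj : ∀ {a b : ℤˣ}, ((a : ℤ) : ℂ) = ((b : ℤ) : ℂ) → a = b := fun h =>
      Units.ext (Int.cast_injective h)
    rcases signFun_eq_or δ ⟨s * s, hss⟩ with hc | hc
    · obtain ⟨E, hE, -⟩ := exists_extension_of_index_two hK hs δ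
        (fun k k' h => sign_inj (hφ k k' h)) 1 (by
          intro k hk
          have : k = ⟨s * s, hss⟩ := Subtype.ext hk
          subst this
          apply sign_inj
          rw [mul_one]
          exact (hc.trans (by simp)).symm)
      obtain ⟨η, hη, hηs⟩ := exists_extension_of_index_two hK hs (1 : K →* ℤˣ) (by simp) (-1)
        (by simp)
      have := hP.sign_add_sign_mem E (E * η)
      convert this using 1
      ext g
      rcases hcases g with hg | ⟨k, rfl⟩
      · have hEg : signFun E g = signFun δ ⟨g, hg⟩ := by
          rw [signFun, signFun, ← hE]
        have hηg : signFun η g = 1 := by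
          have := hη ⟨g, hg⟩
          rw [signFun, this]
          simp
        rw [htrK ⟨g, hg⟩, hdetK ⟨g, hg⟩, ← mul_assoc, signFun_mul (E * E), signFun_mul_self, signFun_mul,
          hEg, hηg]
        ring
      · have hηg : signFun η (s * k) = -1 := by
          rw [signFun, hηs k]
          simp
        rw [htr0, hdets, ← mul_assoc, signFun_mul (E * E), signFun_mul_self, signFun_mul, hηg, hs2, hc]
        ring
    · obtain ⟨χ, hχ, hχs⟩ := exists_extension_of_index_two hK hs (signHom δ) hφ Complex.I (by
          intro k hk
          have : k = ⟨s * s, hss⟩ := Subtype.ext hk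
          subst this
          rw [Complex.I_mul_I]
          exact hc.symm)
      have := hP.add_conj_mem (⇑χ - fun _ => ((1 : ℤ) : ℂ))
        (sub_mem (monoidHom_mem_monomialCharacters χ) (const_mem_monomialCharacters 1)) (by simp)
      convert this using 1
      ext g
      have hreal : ∀ k, starRingEnd ℂ (signFun δ k) = signFun δ k := fun k => by simp [signFun]
      rcases hcases g with hg | ⟨k, rfl⟩
      · have hg' : χ g = signFun δ ⟨g, hg⟩ := hχ ⟨g, hg⟩
        rw [htrK ⟨g, hg⟩, hdetK ⟨g, hg⟩, Pi.sub_apply, hg', map_sub, hreal]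
        simp
        ring
      · rw [htr0, hdets, Pi.sub_apply, hχs, map_sub, map_mul, coe_signHom, hreal, hs2, hc]
        simp
        ring
  · push Not at hinv
    obtain ⟨k₀, hk₀⟩ := hinv
    have e_or : ∀ {k}, k ∈ K → e k = 1 ∨ e k = -1 := extZero_signHom_eq_or δ
    -- Replacing `s` by `s * k₀` multiplies `e (s * s)` by `e (s⁻¹ * k₀ * s) * e k₀ = -1`, so one of
    -- the two choices gives the value `1`.
    obtain ⟨s', hs', hss', hne'⟩ : ∃ s' ∉ K, e (s' * s') = 1 ∧ e (s'⁻¹ * k₀ * s') ≠ e k₀ := by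
      rcases e_or hss with h | h
      · exact ⟨s, hs, h, hk₀⟩
      · refine ⟨s * k₀, hsk k₀, ?_, ?_⟩
        · have h1 : s * k₀ * (s * k₀) = s * s * (s⁻¹ * k₀ * s) * k₀ := by group
          rw [h1, he, extZero_mul_of_right_mem _ _ k₀.2,
            extZero_mul_of_right_mem _ _ (hconj k₀.2), ← he, h]
          rcases e_or k₀.2 with h2 | h2 <;> rcases e_or (hconj k₀.2) with h3 | h3
          · exact absurd (h3.trans h2.symm) hk₀
          · rw [h2, h3]
            norm_num
          · rw [h2, h3]
            norm_num
          · exact absurd (h3.trans h2.symm) hk₀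
        · have h1 : (s * k₀ : G)⁻¹ * k₀ * (s * k₀) = (k₀ : G)⁻¹ * (s⁻¹ * k₀ * s) * k₀ := by group
          rw [h1, he, extZero_conj_of_mem _ k₀.2]
          exact hk₀
    obtain ⟨N, hN, hN1, hD⟩ :=
      isBasicDihedral_of_index_two_of_not_invariant hK δ hs' hss' k₀.2 hne'
    have := hP.indHom_index_two_mem (MonoidHom.id G) Function.injective_id hK (signHom δ) N hN1 hD
    rw [indHom_id] at this
    · exact this
    · intro x g
      rw [indHom_conj_invariant]
      congr 1
      rw [map_mul, map_mul, Matrix.det_mul, Matrix.det_mul, mul_right_comm, ← Matrix.det_mul,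
        ← map_mul, inv_mul_cancel, map_one, Matrix.det_one, one_mul]

/-! ### Affine actions on `ZMod q` -/

/-- A homomorphism to the affine group of `ZMod q`, given by its linear part and its value at
zero. -/
structure AffineHom (G : Type*) [Group G] (q : ℕ) where
  lin : G →* (ZMod q)ˣ
  trans : G → ZMod q
  trans_mul : ∀ g h, trans (g * h) = trans g + lin g * trans h

namespace AffineHom

section

variable {G : Type*} [Group G] {q : ℕ} (Φ : AffineHom G q)

theorem trans_one : Φ.trans 1 = 0 := by
  have := Φ.trans_mul 1 1
  simpa using this

theorem trans_inv (x : G) : Φ.trans x⁻¹ = -((Φ.lin x)⁻¹ : (ZMod q)ˣ) * Φ.trans x := by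
  have := Φ.trans_mul x⁻¹ x
  rw [inv_mul_cancel, trans_one, map_inv] at this
  linear_combination -this

theorem trans_conj (x g : G) : Φ.trans (x⁻¹ * g * x) =
    ((Φ.lin x)⁻¹ : (ZMod q)ˣ) * (Φ.trans g + (Φ.lin g - 1) * Φ.trans x) := by
  rw [mul_assoc, trans_mul, trans_mul, trans_inv, map_inv]
  ring

theorem trans_conj_of_mem_ker (x : G) {g : G} (hg : g ∈ Φ.lin.ker) : Φ.trans (x⁻¹ * g * x) =
    ((Φ.lin x)⁻¹ : (ZMod q)ˣ) * Φ.trans g := by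
  rw [trans_conj, MonoidHom.mem_ker.1 hg]
  simp

theorem trans_pow {g : G} (hg : Φ.lin g = 1) (n : ℕ) : Φ.trans (g ^ n) = n * Φ.trans g := by
  induction n with
  | zero => simp [trans_one]
  | succ n ih =>
    rw [pow_succ, trans_mul, ih, map_pow, hg]
    push_cast
    simp
    ring

/-- The linear character of the kernel of the linear part defined by an additive character. -/
def kerHom (ψ : AddChar (ZMod q) ℂ) : Φ.lin.ker →* ℂ where
  toFun t := ψ (Φ.trans t)
  map_one' := by rw [Subgroup.coe_one, trans_one, AddChar.map_zero_eq_one]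
  map_mul' a b := by
    rw [Subgroup.coe_mul, trans_mul, MonoidHom.mem_ker.1 a.2, Units.val_one, one_mul,
      AddChar.map_add_eq_mul]

theorem kerHom_apply (ψ : AddChar (ZMod q) ℂ) (t : Φ.lin.ker) : Φ.kerHom ψ t = ψ (Φ.trans t) := rfl

/-- The restriction of an affine homomorphism. -/
def comp {H : Type*} [Group H] (f : H →* G) : AffineHom H q where
  lin := Φ.lin.comp f
  trans h := Φ.trans (f h)
  trans_mul a b := by rw [map_mul, trans_mul]; rfl

/-- Conjugation by `x` scales the translation part by `(lin x)⁻¹`, so the sum over cosets of the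
kernel becomes a sum over the group of linear parts. -/
theorem indHom_kerHom_apply [Finite G] [NeZero q] [Fintype Φ.lin.range] (ψ : AddChar (ZMod q) ℂ) {g : G}
    (hg : g ∈ Φ.lin.ker) :
    indHom Φ.lin.ker.subtype (Φ.kerHom ψ) g =
      ∑ r : Φ.lin.range, ψ ((r : (ZMod q)ˣ) * Φ.trans g) := by
  classical
  let _ := Fintype.ofFinite (G ⧸ Φ.lin.ker)
  rw [indHom_subtype_eq_sum_quotient _ _ (monoidHom_conj_invariant _)]
  refine Fintype.sum_equiv ((QuotientGroup.quotientKerEquivRange Φ.lin).toEquiv.trans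
    (Equiv.inv Φ.lin.range)) _ _ fun x => ?_
  have hm : (Quotient.out x)⁻¹ * g * Quotient.out x ∈ Φ.lin.ker := by
    have := Φ.lin.normal_ker.conj_mem g hg (Quotient.out x)⁻¹
    rwa [inv_inv] at this
  have hx : QuotientGroup.quotientKerEquivRange Φ.lin x =
      ⟨Φ.lin (Quotient.out x), ⟨_, rfl⟩⟩ := by
    conv_lhs => rw [← Quotient.out_eq' x]
    rfl
  rw [extZero_of_mem _ hm, kerHom_apply, trans_conj_of_mem_ker Φ _ hg]
  simp only [Equiv.trans_apply, MulEquiv.toEquiv_eq_coe, MulEquiv.coe_toEquiv, hx, Equiv.inv_apply]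
  rfl

theorem indHom_kerHom_apply_of_notMem [Finite G] (ψ : Φ.lin.ker → ℂ) {g : G}
    (hg : g ∉ Φ.lin.ker) : indHom Φ.lin.ker.subtype ψ g = 0 := by
  classical
  let _ := Fintype.ofFinite G
  rw [indHom_subtype_apply, Finset.sum_eq_zero, mul_zero]
  intro x _
  refine extZero_of_notMem _ fun h => hg ?_
  have := Φ.lin.normal_ker.conj_mem _ h x
  convert this using 1
  group

theorem index_ker_eq_two {s : G} [Fact q.Prime] (hq : q ≠ 2) (hs : Φ.lin s = -1)
    (h : ∀ g, Φ.lin g = 1 ∨ Φ.lin g = -1) : Φ.lin.ker.index = 2 := by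
  have hne : (1 : (ZMod q)ˣ) ≠ -1 := by
    intro h
    have h1 : (1 : ZMod q) = -1 := congrArg Units.val h
    have : Fact (2 < q) := ⟨lt_of_le_of_ne (Fact.out : q.Prime).two_le (Ne.symm hq)⟩
    exact ZMod.neg_one_ne_one h1.symm
  rw [Subgroup.index_eq_two_iff]
  refine ⟨s, fun g => ?_⟩
  rw [MonoidHom.mem_ker, MonoidHom.mem_ker, map_mul, hs]
  rcases h g with hg | hg <;> rw [hg]
  · right
    simp [hne.symm]
  · left
    simp [hne.symm]

/-- With linear parts `±1` the image in the affine group is `{y ↦ t ± y}`, that is `D_{2q}`: `c` is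
the rotation and any `s` with linear part `-1` a reflection. `N` is the kernel of the action. -/
theorem isBasicDihedral {G : Type u} [Group G] [Finite G] [Fact q.Prime] (Φ : AffineHom G q)
    (hq : q ≠ 2) {s c : G} (hs : Φ.lin s = -1) (h : ∀ g, Φ.lin g = 1 ∨ Φ.lin g = -1)
    (hc : Φ.lin c = 1) (hc' : Φ.trans c = 1) :
    ∃ (N : Subgroup G) (_ : N.Normal), (∀ n ∈ N, Φ.lin n = 1 ∧ Φ.trans n = 0) ∧
      IsBasicDihedral (G ⧸ N) := by
  have hodd : Odd q := (Fact.out : q.Prime).odd_of_ne_two hq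
  have h2q : 2 < q := lt_of_le_of_ne (Fact.out : q.Prime).two_le (Ne.symm hq)
  let F : Φ.lin.ker →* Multiplicative (ZMod q) :=
    { toFun := fun t => Multiplicative.ofAdd (Φ.trans t)
      map_one' := by rw [Subgroup.coe_one, trans_one]; rfl
      map_mul' := fun a b => by
        rw [Subgroup.coe_mul, trans_mul, MonoidHom.mem_ker.1 a.2, Units.val_one, one_mul]; rfl }
  have hF : Function.Surjective F := by
    intro y
    obtain ⟨k, hk⟩ := ZMod.natCast_zmod_surjective (Multiplicative.toAdd y)
    refine ⟨⟨c ^ k, Subgroup.pow_mem _ (MonoidHom.mem_ker.2 hc) k⟩, ?_⟩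
    change Multiplicative.ofAdd (Φ.trans (c ^ k)) = y
    rw [Φ.trans_pow hc, hc', mul_one, hk]
    rfl
  let N : Subgroup G := F.ker.map Φ.lin.ker.subtype
  have hN : ∀ n, n ∈ N ↔ Φ.lin n = 1 ∧ Φ.trans n = 0 := by
    intro n
    constructor
    · rintro ⟨t, ht, rfl⟩
      exact ⟨t.2, MonoidHom.mem_ker.1 ht⟩
    · rintro ⟨h1, h2⟩
      exact ⟨⟨n, h1⟩, MonoidHom.mem_ker.2 h2, rfl⟩
  have hNn : N.Normal := by
    refine ⟨fun n hn g => (hN _).2 ⟨?_, ?_⟩⟩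
    · rw [map_mul, map_mul, ((hN n).1 hn).1, mul_one, map_inv, mul_inv_cancel]
    · have := Φ.trans_conj_of_mem_ker g⁻¹ (MonoidHom.mem_ker.2 ((hN n).1 hn).1)
      rw [inv_inv] at this
      rw [this, ((hN n).1 hn).2, mul_zero]
  have hsq : ∀ w, Φ.lin w = -1 → w * w ∈ N := by
    intro w hw
    rw [hN, map_mul, trans_mul, hw]
    simp
  have hindex : N.index = 2 * q := by
    rw [Subgroup.index_map_subtype, Φ.index_ker_eq_two hq hs h, Subgroup.index_ker,
      MonoidHom.range_eq_top.2 hF, Subgroup.card_top]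
    simp [mul_comm]
  refine ⟨N, hNn, fun n hn => (hN n).1 hn, Or.inr (Or.inr ⟨q, Fact.out, hodd, ?_⟩)⟩
  refine nonempty_mulEquiv_dihedralGroup h2q (c : G ⧸ N) (s : G ⧸ N) ?_ ?_ ?_ hindex
  · refine orderOf_eq_prime ?_ ?_
    · rw [← QuotientGroup.mk_pow, QuotientGroup.eq_one_iff, hN, map_pow, hc, trans_pow Φ hc]
      simp
    · rw [Ne, QuotientGroup.eq_one_iff, hN, hc']
      simp
  · rw [← QuotientGroup.mk_mul, QuotientGroup.eq_one_iff]
    exact hsq s hs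
  · simp only [← QuotientGroup.mk_mul]
    rw [QuotientGroup.eq_one_iff, mul_assoc (s * c)]
    apply hsq
    rw [map_mul, hs, hc, mul_one]

/-- The relation for a dihedral quotient of order `2q`. -/
theorem indHom_kerHom_sub_mem {G S : Type u} [Group G] [Finite G] [Group S] [Finite S]
    {P : AddSubgroup (G → ℂ)} (hP : Admissible P) (f : S →* G) (hf : Function.Injective f)
    [Fact q.Prime] (Φ : AffineHom S q)
    (hq : q ≠ 2) {s c : S} (hs : Φ.lin s = -1) (h : ∀ g, Φ.lin g = 1 ∨ Φ.lin g = -1)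
    (hc : Φ.lin c = 1) (hc' : Φ.trans c = 1) (ψ : AddChar (ZMod q) ℂ) :
    indHom f (indHom Φ.lin.ker.subtype (Φ.kerHom ψ)) -
      indHom f (indHom Φ.lin.ker.subtype (fun _ => 1)) ∈ P := by
  classical
  let _ := Fintype.ofFinite (S ⧸ Φ.lin.ker)
  have hind := Φ.index_ker_eq_two hq hs h
  obtain ⟨N, hN, hN1, hD⟩ := Φ.isBasicDihedral hq hs h hc hc'
  have := hP.indHom_index_two_mem f hf hind (Φ.kerHom ψ) N (fun n hn => by
    rw [extZero_of_mem _ (MonoidHom.mem_ker.2 (hN1 n hn).1), kerHom_apply, (hN1 n hn).2,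
      AddChar.map_zero_eq_one]) hD
  rw [← map_sub]
  -- It remains to see that the character induced from `1` equals `1 + det`, with `det` that of the
  -- representation induced from `ψ`. On the kernel `det` is `ψ(t)ψ(-t) = 1`. Off it, `g` has trace
  -- `0` and `g * g` acts trivially on the line, so `det = -1`.
  convert this using 2
  have hsk : s ∉ Φ.lin.ker := by
    intro h'
    have hall : Φ.lin.ker = ⊤ := by
      rw [Subgroup.eq_top_iff']
      intro g
      rw [MonoidHom.mem_ker] at h' ⊢
      rcases h g with hg | hg
      · exact hg
      · rw [hg, ← hs, h']
    rw [hall, Subgroup.index_top] at hind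
    exact absurd hind (by norm_num)
  have hconj : ∀ {t}, t ∈ Φ.lin.ker → s⁻¹ * t * s ∈ Φ.lin.ker := fun {t} ht => by
    have := Φ.lin.normal_ker.conj_mem t ht s⁻¹
    rwa [inv_inv] at this
  have htr : ∀ t ∈ Φ.lin.ker, indHom Φ.lin.ker.subtype (Φ.kerHom ψ) t =
      ψ (Φ.trans t) + ψ (-Φ.trans t) := by
    intro t ht
    rw [indHom_index_two_apply hind hsk, extZero_of_mem _ ht, extZero_of_mem _ (hconj ht),
      kerHom_apply, kerHom_apply, Φ.trans_conj_of_mem_ker s ht, hs]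
    simp
  ext g
  simp only [Pi.sub_apply]
  rw [det_monomialHom_index_two hind]
  have h1 := indHom_index_two_apply hind hsk (1 : Φ.lin.ker →* ℂ) g
  have h1' : ⇑(1 : Φ.lin.ker →* ℂ) = fun _ => 1 := rfl
  rw [h1'] at h1
  by_cases hg : g ∈ Φ.lin.ker
  · rw [h1, extZero_of_mem _ hg, extZero_of_mem _ (hconj hg), htr g hg,
      htr _ (Subgroup.mul_mem _ hg hg), trans_mul, MonoidHom.mem_ker.1 hg, Units.val_one, one_mul,
      neg_add, AddChar.map_add_eq_mul, AddChar.map_add_eq_mul]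
    have : ψ (Φ.trans g) * ψ (-Φ.trans g) = 1 := by
      rw [← AddChar.map_add_eq_mul, add_neg_cancel, AddChar.map_zero_eq_one]
    linear_combination this
  · have hg' := (h g).resolve_left hg
    have hgg : g * g ∈ Φ.lin.ker := Subgroup.mul_self_mem_of_index_two hind g
    have : Φ.trans (g * g) = 0 := by
      rw [trans_mul, hg']
      simp
    rw [Φ.indHom_kerHom_apply_of_notMem _ hg, Φ.indHom_kerHom_apply_of_notMem _ hg, htr _ hgg, this,
      neg_zero, AddChar.map_zero_eq_one]
    norm_num

end

end AffineHom

theorem indHom_comp_mulEquiv {G H H' : Type*} [Group G] [Group H] [Group H'] [Finite G] [Finite H]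
    [Finite H'] (f : H →* G) (e : H' ≃* H) (ψ : H → ℂ) :
    indHom (f.comp e.toMonoidHom) (fun h => ψ (e h)) = indHom f ψ := by
  classical
  let _ := Fintype.ofFinite G
  let _ := Fintype.ofFinite H
  let _ := Fintype.ofFinite H'
  ext g
  rw [indHom_apply, indHom_apply, Nat.card_congr e.toEquiv]
  congr 1
  refine Finset.sum_congr rfl fun x _ => Fintype.sum_equiv e.toEquiv _ _ fun h => rfl

namespace AffineHom

section

variable {G : Type*} [Group G] {q : ℕ} (Φ : AffineHom G q)

/-- The affine permutation of `ZMod q` defined by a group element. -/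
def affinePerm (g : G) : Equiv.Perm (ZMod q) :=
  (Φ.lin g).mulLeft.trans (Equiv.addLeft (Φ.trans g))

theorem affinePerm_apply (g : G) (y : ZMod q) : Φ.affinePerm g y = Φ.trans g + Φ.lin g * y := rfl

theorem trans_surjective {c : G} (hc : Φ.lin c = 1) (hc' : Φ.trans c = 1) [NeZero q] :
    Function.Surjective Φ.trans := by
  intro y
  obtain ⟨k, rfl⟩ := ZMod.natCast_zmod_surjective y
  exact ⟨c ^ k, by rw [Φ.trans_pow hc, hc', mul_one]⟩

theorem trans_inv_mul_eq_zero_iff (a b : G) : Φ.trans (a⁻¹ * b) = 0 ↔ Φ.trans a = Φ.trans b := by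
  rw [trans_mul, trans_inv, map_inv, neg_mul, neg_add_eq_zero, Units.mul_right_inj]

/-- The cosets of the stabiliser of zero are the points of the affine line. -/
noncomputable def quotientEquiv {M : Subgroup G} (hM : ∀ g, g ∈ M ↔ Φ.trans g = 0)
    (hsurj : Function.Surjective Φ.trans) : G ⧸ M ≃ ZMod q :=
  Equiv.ofBijective (Quotient.lift Φ.trans fun a b hab => by
    rw [← trans_inv_mul_eq_zero_iff, ← hM]
    exact QuotientGroup.leftRel_apply.1 hab) <| by
    constructor
    · refine Quotient.ind' fun a => Quotient.ind' fun b => fun h => ?_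
      refine QuotientGroup.eq.2 ((hM _).2 ((Φ.trans_inv_mul_eq_zero_iff a b).2 h))
    · intro y
      obtain ⟨g, rfl⟩ := hsurj y
      exact ⟨(g : G ⧸ M), rfl⟩

theorem quotientEquiv_smul {M : Subgroup G} (hM : ∀ g, g ∈ M ↔ Φ.trans g = 0)
    (hsurj : Function.Surjective Φ.trans) (g : G) (x : G ⧸ M) :
    Φ.quotientEquiv hM hsurj (g • x) = Φ.affinePerm g (Φ.quotientEquiv hM hsurj x) := by
  obtain ⟨a, rfl⟩ := QuotientGroup.mk_surjective x
  exact Φ.trans_mul g a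

variable [Finite G] [Fact q.Prime]

/-- Count the solutions of `t + a y = y`: exactly one if `a ≠ 1`, and all or none if `a = 1`. -/
theorem permChar_quotient_eq {M : Subgroup G} (hM : ∀ g, g ∈ M ↔ Φ.trans g = 0)
    (hsurj : Function.Surjective Φ.trans) (g : G) :
    permChar G (G ⧸ M) g =
      if Φ.lin g = 1 then (if Φ.trans g = 0 then (q : ℂ) else 0) else 1 := by
  classical
  let _ := Fintype.ofFinite (G ⧸ M)
  rw [permChar_apply, Fintype.sum_equiv (Φ.quotientEquiv hM hsurj) _
    (fun y => if Φ.trans g + Φ.lin g * y = y then (1 : ℂ) else 0) fun x => ?_]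
  · split_ifs with h1 h2
    · simp [h1, h2]
    · simp [h1, h2]
    · have hne : (1 : ZMod q) - Φ.lin g ≠ 0 := by
        rw [sub_ne_zero]
        intro h
        exact h1 (Units.ext h.symm)
      have : ∀ y, Φ.trans g + Φ.lin g * y = y ↔ y = Φ.trans g / (1 - Φ.lin g) := by
        intro y
        rw [eq_div_iff hne]
        constructor
        · intro h
          linear_combination -h
        · intro h
          linear_combination -h
      simp [this]
  · refine if_congr ?_ rfl rfl
    rw [← (Φ.quotientEquiv hM hsurj).apply_eq_iff_eq, quotientEquiv_smul]
    rfl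

/-- The nonzero elements of `ZMod q` together with zero. -/
noncomputable def optionUnitsEquiv (q : ℕ) [Fact q.Prime] : Option (ZMod q)ˣ ≃ ZMod q :=
  (WithZero.withZeroUnitsEquiv (G := ZMod q)).toEquiv

theorem sign_mulLeft_units (a : (ZMod q)ˣ) :
    Equiv.Perm.sign (a.mulLeft : Equiv.Perm (ZMod q)) =
      Equiv.Perm.sign (Equiv.mulLeft a : Equiv.Perm (ZMod q)ˣ) := by
  classical
  rw [← Equiv.optionCongr_sign (Equiv.mulLeft a)]
  refine (Equiv.Perm.sign_eq_sign_of_equiv _ _ (optionUnitsEquiv q) ?_).symm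
  rintro (_ | u)
  · exact (mul_zero _).symm
  · rfl

omit [Finite G] in
-- Moving the unique fixed point `t / (1 - a)` to `0` conjugates `y ↦ t + a y` into multiplication
-- by `a`, which fixes `0` and permutes the units.
theorem sign_affinePerm {g : G} (hg : Φ.lin g ≠ 1) : Equiv.Perm.sign (Φ.affinePerm g) =
    Equiv.Perm.sign (Equiv.mulLeft (Φ.lin g) : Equiv.Perm (ZMod q)ˣ) := by
  have hne : (1 : ZMod q) - Φ.lin g ≠ 0 := by
    rw [sub_ne_zero]
    intro h
    exact hg (Units.ext h.symm)
  rw [← sign_mulLeft_units]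
  refine Equiv.Perm.sign_eq_sign_of_equiv _ _
    (Equiv.subRight (Φ.trans g / (1 - Φ.lin g))) fun y => ?_
  change Φ.trans g + Φ.lin g * y - _ = Φ.lin g * (y - _)
  field_simp
  ring

theorem sign_mulLeft_of_subgroup {U : Type*} [CommGroup U] [Fintype U] [DecidableEq U]
    (R : Subgroup U) [Fintype R] [DecidableEq R] (a : R) :
    Equiv.Perm.sign (Equiv.mulLeft (a : U)) =
      Equiv.Perm.sign (Equiv.mulLeft a) ^ Nat.card (U ⧸ R) := by
  classical
  let _ := Fintype.ofFinite (U ⧸ R)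
  have h : Equiv.Perm.sign (Equiv.prodCongrRight fun _ : U ⧸ R =>
      (Equiv.mulLeft a : Equiv.Perm R)) = Equiv.Perm.sign (Equiv.mulLeft (a : U)) := by
    refine Equiv.Perm.sign_eq_sign_of_equiv _ _ (quotientProdEquiv R) ?_
    rintro ⟨x, k⟩
    exact mul_left_comm _ _ _
  rw [← h, Equiv.Perm.sign_prodCongrRight]
  simp

/-- Translations have odd order, hence are even. Otherwise the sign is that of multiplication by
`lin g` on the units, which split into cosets of the range of `lin`, each a copy of `G ⧸ ker`. -/
theorem sgn_quotient_eq_pow {M : Subgroup G} (hM : ∀ g, g ∈ M ↔ Φ.trans g = 0)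
    (hsurj : Function.Surjective Φ.trans) (hq : q ≠ 2) :
    sgn G (G ⧸ M) = sgn G (G ⧸ Φ.lin.ker) ^ Nat.card ((ZMod q)ˣ ⧸ Φ.lin.range) := by
  classical
  let _ := Fintype.ofFinite (G ⧸ M)
  let _ := Fintype.ofFinite (G ⧸ Φ.lin.ker)
  refine MonoidHom.ext fun g => ?_
  rw [MonoidHom.pow_apply, sgn_apply, sgn_apply]
  have hl : Equiv.Perm.sign (MulAction.toPerm g : Equiv.Perm (G ⧸ M)) =
      Equiv.Perm.sign (Φ.affinePerm g) :=
    Equiv.Perm.sign_eq_sign_of_equiv _ _ (Φ.quotientEquiv hM hsurj) (Φ.quotientEquiv_smul hM hsurj g)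
  have hr : Equiv.Perm.sign (MulAction.toPerm g : Equiv.Perm (G ⧸ Φ.lin.ker)) =
      Equiv.Perm.sign (Equiv.mulLeft (⟨Φ.lin g, ⟨g, rfl⟩⟩ : Φ.lin.range)) := by
    refine Equiv.Perm.sign_eq_sign_of_equiv _ _
      (QuotientGroup.quotientKerEquivRange Φ.lin).toEquiv fun x => ?_
    obtain ⟨a, rfl⟩ := QuotientGroup.mk_surjective x
    exact Subtype.ext (map_mul Φ.lin g a)
  rw [hl, hr]
  by_cases hg : Φ.lin g = 1
  · have h1 : Equiv.mulLeft (⟨Φ.lin g, ⟨g, rfl⟩⟩ : Φ.lin.range) = 1 := by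
      ext x
      simp [hg]
    have h2 : Φ.affinePerm g ^ q = 1 := by
      have h3 : ∀ n : ℕ, ∀ y, (Φ.affinePerm g ^ n) y = n * Φ.trans g + y := by
        intro n
        induction n with
        | zero => simp
        | succ n ih =>
          intro y
          rw [pow_succ', Equiv.Perm.mul_apply, ih, affinePerm_apply, hg]
          push_cast
          ring
      ext y
      rw [h3]
      simp
    have h4 : Equiv.Perm.sign (Φ.affinePerm g) ^ q = 1 := by rw [← map_pow, h2, map_one]
    rw [h1, map_one, one_pow]
    rcases Int.units_eq_one_or (Equiv.Perm.sign (Φ.affinePerm g)) with h | h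
    · exact h
    · rw [h, ((Fact.out : q.Prime).odd_of_ne_two hq).neg_one_pow] at h4
      exact absurd h4 (by decide)
  · rw [Φ.sign_affinePerm hg]
    exact sign_mulLeft_of_subgroup Φ.lin.range ⟨Φ.lin g, ⟨g, rfl⟩⟩

omit [Finite G] in
theorem sum_stdAddChar_mul (t : ZMod q) :
    ∑ j : ZMod q, ZMod.stdAddChar (j * t) = if t = 0 then (q : ℂ) else 0 := by
  have := AddChar.sum_mulShift t (ZMod.isPrimitive_stdAddChar q)
  rw [this, ZMod.card]
  push_cast
  rfl

theorem sum_units_stdAddChar_mul (t : ZMod q) :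
    ∑ j : (ZMod q)ˣ, ZMod.stdAddChar ((j : ZMod q) * t) = (if t = 0 then (q : ℂ) else 0) - 1 := by
  rw [← sum_stdAddChar_mul, ← Equiv.sum_comp (optionUnitsEquiv q), Fintype.sum_option]
  have h : optionUnitsEquiv q none = 0 := rfl
  have h' : ∀ u, optionUnitsEquiv q (some u) = u := fun _ => rfl
  simp only [h, h', zero_mul, AddChar.map_zero_eq_one, add_sub_cancel_left]

/-- Fourier decomposition of functions on the affine line: the trivial additive character gives `1`,
and each orbit of the linear parts on the nontrivial ones gives one representation induced from the
kernel. -/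
theorem permChar_quotient_eq_sum [Fintype ((ZMod q)ˣ ⧸ Φ.lin.range)] {M : Subgroup G} (hM : ∀ g, g ∈ M ↔ Φ.trans g = 0)
    (hsurj : Function.Surjective Φ.trans) :
    permChar G (G ⧸ M) = 1 + ∑ c : (ZMod q)ˣ ⧸ Φ.lin.range, indHom Φ.lin.ker.subtype
      (Φ.kerHom (ZMod.stdAddChar.mulShift ((Quotient.out c : (ZMod q)ˣ) : ZMod q))) := by
  classical
  let _ := Fintype.ofFinite Φ.lin.range
  ext g
  rw [Φ.permChar_quotient_eq hM hsurj, Pi.add_apply, Pi.one_apply, Finset.sum_apply]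
  by_cases h1 : Φ.lin g = 1
  · rw [if_pos h1]
    have h2 := sum_units_stdAddChar_mul (q := q) (Φ.trans g)
    rw [← Equiv.sum_comp (quotientProdEquiv Φ.lin.range), Fintype.sum_prod_type] at h2
    rw [eq_add_of_sub_eq' h2.symm]
    congr 1
    refine Finset.sum_congr rfl fun c _ => ?_
    rw [Φ.indHom_kerHom_apply _ (MonoidHom.mem_ker.2 h1)]
    refine Finset.sum_congr rfl fun r _ => ?_
    rw [AddChar.mulShift_apply, quotientProdEquiv_apply, Units.val_mul, mul_assoc]
  · rw [if_neg h1, Finset.sum_eq_zero, add_zero]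
    exact fun c _ => Φ.indHom_kerHom_apply_of_notMem _ (mt MonoidHom.mem_ker.1 h1)

omit [Finite G] [Fact q.Prime] in
theorem sum_zmod_of_odd (m : ℕ) (f : ZMod (2 * m + 1) → ℂ) : ∑ j, f j =
    f 0 + ∑ i ∈ Finset.range m, (f ((i : ℕ) + 1) + f (-((i : ℕ) + 1))) := by
  have h1 : ∑ j, f j = ∑ i ∈ Finset.range (2 * m + 1), f (i : ℕ) := by
    rw [Finset.sum_range]
    refine Finset.sum_congr rfl fun i _ => ?_
    congr 1
    exact (ZMod.natCast_zmod_val (n := 2 * m + 1) i).symm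
  have h2 : ∀ F : ℕ → ℂ, ∑ i ∈ Finset.range (2 * m), F i =
      ∑ i ∈ Finset.range m, F i + ∑ i ∈ Finset.range m, F (m + i) := fun F => by
    rw [two_mul, Finset.sum_range_add]
  rw [h1, Finset.sum_range_succ', add_comm, Nat.cast_zero, h2, Finset.sum_add_distrib]
  congr 2
  · simp
  · rw [← Finset.sum_range_reflect]
    refine Finset.sum_congr rfl fun i hi => ?_
    congr 1
    have hi' := Finset.mem_range.1 hi
    rw [eq_neg_iff_add_eq_zero]
    have : ((m + (m - 1 - i) + 1 : ℕ) : ZMod (2 * m + 1)) + ((i : ℕ) + 1) =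
        ((2 * m + 1 : ℕ) : ZMod (2 * m + 1)) := by
      rw [← Nat.cast_add_one i, ← Nat.cast_add]
      congr 1
      omega
    rw [this, ZMod.natCast_self]

theorem stdAddChar_neg (t : ZMod q) :
    ZMod.stdAddChar (-t) = starRingEnd ℂ (ZMod.stdAddChar t) := by
  rw [ZMod.stdAddChar_apply, ZMod.stdAddChar_apply, AddChar.map_neg_eq_inv, Circle.coe_inv_eq_conj]

end

section

variable {G : Type u} [Group G] [Finite G] {q : ℕ} [Fact q.Prime] (Φ : AffineHom G q)
  {P : AddSubgroup (G → ℂ)}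

/-- Here `G` acts by translations, with trivial sign, and the nontrivial additive characters pair
off as `χ, χ̄`. Condition 1 applies to the sum of `χ - 1` over one representative of each pair. -/
theorem signCongr_of_lin_eq_one (hP : Admissible P) (hq : q ≠ 2) (h1 : ∀ g, Φ.lin g = 1)
    {M : Subgroup G} (hM : ∀ g, g ∈ M ↔ Φ.trans g = 0)
    (hsurj : Function.Surjective Φ.trans) : SignCongr P (G ⧸ M) := by
  obtain ⟨m, rfl⟩ := (Fact.out : q.Prime).odd_of_ne_two hq
  let l : ZMod (2 * m + 1) → G →* ℂ := fun j =>
    { toFun := fun g => ZMod.stdAddChar (j * Φ.trans g)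
      map_one' := by rw [trans_one, mul_zero, AddChar.map_zero_eq_one]
      map_mul' := fun a b => by
        rw [trans_mul, h1, Units.val_one, one_mul, mul_add, AddChar.map_add_eq_mul] }
  have := hP.add_conj_mem (∑ i ∈ Finset.range m, (⇑(l ((i : ℕ) + 1)) - fun _ => ((1 : ℤ) : ℂ)))
    (sum_mem fun i _ => sub_mem (monoidHom_mem_monomialCharacters _)
      (const_mem_monomialCharacters 1)) (by simp)
  rw [SignCongr]
  convert this using 1
  ext g
  have hs : signFun (sgn G (G ⧸ M)) g = 1 := by
    rw [Φ.sgn_quotient_eq_pow hM hsurj hq, signFun_pow]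
    have : Subsingleton (G ⧸ Φ.lin.ker) := ⟨by
      refine Quotient.ind' fun a => Quotient.ind' fun b => ?_
      exact QuotientGroup.eq.2 (h1 _)⟩
    classical
    let _ := Fintype.ofFinite (G ⧸ Φ.lin.ker)
    have h2 : sgn G (G ⧸ Φ.lin.ker) g = 1 := by
      rw [sgn_apply, Subsingleton.elim (MulAction.toPerm g : Equiv.Perm (G ⧸ Φ.lin.ker)) 1,
        map_one]
    simp [signFun, h2]
  have hl : ∀ j, l j g = ZMod.stdAddChar (j * Φ.trans g) := fun _ => rfl
  rw [Φ.permChar_quotient_eq hM hsurj, if_pos (h1 g), ← sum_stdAddChar_mul, sum_zmod_of_odd, hs,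
    Nat.card_congr (Φ.quotientEquiv hM hsurj), Nat.card_zmod, Finset.sum_apply, map_sum,
    ← Finset.sum_add_distrib, zero_mul, AddChar.map_zero_eq_one]
  simp only [Pi.sub_apply, hl, map_sub, neg_mul, stdAddChar_neg]
  have : ∀ a : ℂ, a - ((1 : ℤ) : ℂ) + (starRingEnd ℂ a - starRingEnd ℂ ((1 : ℤ) : ℂ)) =
      (a + starRingEnd ℂ a) - 2 := by
    intro a
    simp
    ring
  simp only [this, Finset.sum_sub_distrib, Finset.sum_const, Finset.card_range]
  push_cast
  simp
  ring

/-- Apply the dihedral relation inside the subgroup `S` of elements with linear part `±1`, which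
contains the kernel, and induce from `S` to `G`. -/
theorem indHom_kerHom_sub_indHom_mem (hP : Admissible P) (hq : q ≠ 2) {s c : G}
    (hs : Φ.lin s = -1) (hc : Φ.lin c = 1) (hc' : Φ.trans c = 1) (ψ : AddChar (ZMod q) ℂ) :
    indHom Φ.lin.ker.subtype (Φ.kerHom ψ) - indHom Φ.lin.ker.subtype (fun _ => 1) ∈ P := by
  let S : Subgroup G :=
    { carrier := {g | Φ.lin g = 1 ∨ Φ.lin g = -1}
      one_mem' := Or.inl (map_one _)
      mul_mem' := by
        rintro a b (ha | ha) (hb | hb) <;> simp [ha, hb]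
      inv_mem' := by
        rintro a (ha | ha) <;> simp [ha] }
  let ΦS := Φ.comp S.subtype
  let e : ΦS.lin.ker ≃* Φ.lin.ker :=
    { toFun := fun x => ⟨x.1.1, x.2⟩
      invFun := fun x => ⟨⟨x.1, Or.inl x.2⟩, x.2⟩
      left_inv := fun _ => rfl
      right_inv := fun _ => rfl
      map_mul' := fun _ _ => rfl }
  have key := ΦS.indHom_kerHom_sub_mem hP S.subtype S.subtype_injective hq
    (s := ⟨s, Or.inr hs⟩) (c := ⟨c, Or.inl hc⟩) hs (fun g => g.2) hc hc' ψ
  rw [indHom_comp, indHom_comp] at key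
  rw [← indHom_comp_mulEquiv Φ.lin.ker.subtype e, ← indHom_comp_mulEquiv Φ.lin.ker.subtype e]
  exact key

/-- The congruence for the points of an affine line, given that for the regular action of the
group of linear parts. -/
theorem signCongr_quotient (hP : Admissible P) (hq : q ≠ 2) {c : G} (hc : Φ.lin c = 1)
    (hc' : Φ.trans c = 1) {M : Subgroup G} (hM : ∀ g, g ∈ M ↔ Φ.trans g = 0)
    {k : ℕ} (hk : Φ.lin.ker.index = 2 ^ k)
    (hT : Φ.lin.ker ≠ ⊤ → SignCongr P (G ⧸ Φ.lin.ker)) : SignCongr P (G ⧸ M) := by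
  classical
  have hsurj := Φ.trans_surjective hc hc'
  by_cases htop : Φ.lin.ker = ⊤
  · exact Φ.signCongr_of_lin_eq_one hP hq ((Subgroup.eq_top_iff' _).1 htop) hM hsurj
  -- The linear parts form a nontrivial `2`-group, and `-1` is the only element of order two in the
  -- units of a field.
  obtain ⟨s, hs⟩ : ∃ s, Φ.lin s = -1 := by
    have : Fact (Nat.Prime 2) := ⟨Nat.prime_two⟩
    have hdvd : 2 ∣ Nat.card Φ.lin.range := by
      rw [← Subgroup.index_ker, hk]
      refine dvd_pow_self 2 ?_
      rintro rfl
      exact htop (Subgroup.index_eq_one.1 (by rw [hk, pow_zero]))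
    obtain ⟨⟨_, ⟨s, rfl⟩⟩, hord⟩ := exists_prime_orderOf_dvd_card' 2 hdvd
    refine ⟨s, ?_⟩
    have hord' : orderOf (Φ.lin s) = 2 := (Subgroup.orderOf_coe _).trans hord
    have h2 : (Φ.lin s) * (Φ.lin s) = 1 := by
      rw [← sq, ← hord']
      exact pow_orderOf_eq_one _
    have h1 : Φ.lin s ≠ 1 := by
      intro h
      rw [h, orderOf_one] at hord'
      exact absurd hord' (by norm_num)
    rcases mul_self_eq_one_iff.1 (congrArg Units.val h2) with h | h
    · exact absurd (Units.ext h) h1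
    · exact Units.ext h
  let _ := Fintype.ofFinite ((ZMod q)ˣ ⧸ Φ.lin.range)
  set r := Nat.card ((ZMod q)ˣ ⧸ Φ.lin.range) with hr
  -- Modulo `P` each of the `r` induced Fourier components may be replaced by `ℂ[G ⧸ ker]`. Then
  -- `hT`, used `r` times, and `r ε ≡ (r - 1) + ε ^ r` finish, the degrees matching by `hcard`.
  have h1 : permChar G (G ⧸ M) - 1 - r • permChar G (G ⧸ Φ.lin.ker) ∈ P := by
    rw [Φ.permChar_quotient_eq_sum hM hsurj, add_sub_cancel_left, hr, Nat.card_eq_fintype_card,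
      ← Finset.card_univ, ← Finset.sum_const, ← Finset.sum_sub_distrib]
    refine sum_mem fun c _ => ?_
    rw [CharInduction.permChar_quotient]
    exact Φ.indHom_kerHom_sub_indHom_mem hP hq hs hc hc' _
  have hcard : (r : ℂ) * Nat.card (G ⧸ Φ.lin.ker) = q - 1 := by
    have h2 : Nat.card (G ⧸ Φ.lin.ker) = Nat.card Φ.lin.range := Subgroup.index_ker Φ.lin
    have h3 : Nat.card (ZMod q)ˣ = q - 1 := by
      rw [Nat.card_eq_fintype_card, ZMod.card_units]
    rw [h2, ← Nat.cast_mul, hr, ← Subgroup.card_eq_card_quotient_mul_card_subgroup, h3,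
      Nat.cast_sub (Fact.out : q.Prime).one_le, Nat.cast_one]
  have h4 := add_mem (add_mem h1 (nsmul_mem (hT htop) r))
    (hP.sign_pow_mem (sgn G (G ⧸ Φ.lin.ker)) r)
  rw [SignCongr, Φ.sgn_quotient_eq_pow hM hsurj hq, Nat.card_congr (Φ.quotientEquiv hM hsurj),
    Nat.card_zmod]
  convert h4 using 1
  ext g
  simp only [Pi.add_apply, Pi.sub_apply, Pi.smul_apply, Pi.one_apply]
  simp only [nsmul_eq_mul]
  linear_combination hcard

end

end AffineHom

/-! ### Passing the congruence from a subgroup to the group -/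

section

variable {G : Type u} [Group G] [Finite G] {P : AddSubgroup (G → ℂ)}

omit [Finite G] in
theorem signCongr_of_subsingleton (X : Type*) [MulAction G X] [Finite X] [Subsingleton X]
    [Nonempty X] : SignCongr P X := by
  classical
  let _ := Fintype.ofFinite X
  rw [SignCongr]
  convert zero_mem P using 1
  ext g
  have h1 : signFun (sgn G X) g = 1 := by
    rw [signFun, sgn_apply, Subsingleton.elim (MulAction.toPerm g : Equiv.Perm X) 1, map_one]
    simp
  have h2 : Nat.card X = 1 := Nat.card_unique
  have h3 : permChar G X g = 1 := by
    rw [permChar_apply, Finset.sum_congr rfl fun x _ => if_pos (Subsingleton.elim _ _)]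
    simp [← Nat.card_eq_fintype_card]
  rw [h1, h2, h3]
  simp

theorem indHom_permChar_quotient {H K : Subgroup G} (hle : H ≤ K) :
    indHom K.subtype (permChar K (K ⧸ H.subgroupOf K)) = permChar G (G ⧸ H) := by
  rw [permChar_quotient, permChar_quotient, indHom_comp,
    ← indHom_comp_mulEquiv H.subtype (Subgroup.subgroupOfEquivOfLe hle)]
  rfl

omit [Finite G] in
theorem natCard_quotient_of_le {H K : Subgroup G} (hle : H ≤ K) :
    Nat.card (G ⧸ H) = Nat.card (G ⧸ K) * Nat.card (K ⧸ H.subgroupOf K) := by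
  rw [Nat.card_congr (Subgroup.quotientEquivProdOfLE hle), Nat.card_prod]

theorem det_monomialHom_one (K : Subgroup G) [Fintype (G ⧸ K)] [DecidableEq (G ⧸ K)] (g : G) :
    (monomialHom K (signHom 1) g).det = signFun (sgn G (G ⧸ K)) g := by
  rw [det_monomialHom, Finset.prod_eq_one, mul_one]
  · rfl
  · intro x _
    rw [extZero_of_mem _ ((mem_iff_smul_eq K g _ _).2 rfl)]
    simp [signHom]

theorem SignCongr.indHom_mem {H K : Subgroup G} (hle : H ≤ K)
    (h : SignCongr (P.comap (indHom K.subtype).toAddMonoidHom) (K ⧸ H.subgroupOf K)) :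
    permChar G (G ⧸ H) - indHom K.subtype (signFun (sgn K (K ⧸ H.subgroupOf K))) -
      ((Nat.card (K ⧸ H.subgroupOf K) : ℂ) - 1) • permChar G (G ⧸ K) ∈ P := by
  have h' : indHom K.subtype (fun g => permChar K (K ⧸ H.subgroupOf K) g -
      signFun (sgn K (K ⧸ H.subgroupOf K)) g - ((Nat.card (K ⧸ H.subgroupOf K) : ℂ) - 1)) ∈ P := h
  rw [← indHom_permChar_quotient hle, permChar_quotient K, ← map_smul, ← map_sub, ← map_sub]
  convert h' using 2
  ext g
  simp

/-- Induction of the congruence from a subgroup of index two. -/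
theorem Admissible.signCongr_of_index_two (hP : Admissible P) {H K : Subgroup G} (hle : H ≤ K)
    (hK : K.index = 2)
    (h : SignCongr (P.comap (indHom K.subtype).toAddMonoidHom) (K ⧸ H.subgroupOf K)) :
    SignCongr P (G ⧸ H) := by
  classical
  let _ := Fintype.ofFinite (G ⧸ K)
  set n := Nat.card (K ⧸ H.subgroupOf K) with hn
  set η := sgn G (G ⧸ K)
  have h1 := h.indHom_mem hle
  have h2 := hP.indHom_sign_index_two_mem hK (sgn K (K ⧸ H.subgroupOf K))
  have h3 : permChar G (G ⧸ K) - 1 - signFun η ∈ P := by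
    have := hP.indHom_sign_index_two_mem hK 1
    simp only [det_monomialHom_one] at this
    rw [permChar_quotient]
    convert this using 1
    ext g
    simp only [Pi.sub_apply, Pi.one_apply]
    rw [show (fun _ : K => (1 : ℂ)) = signFun 1 from funext fun k => (signFun_one k).symm]
  have h4 := nsmul_mem h3 n
  have h5 := hP.sign_pow_mem η (n + 1)
  have h6 := hP.sign_add_sign_mem η η
  have h7 := hP.sign_add_sign_mem (sgn G (G ⧸ H) * η ^ (n + 1)) (η ^ (n + 1))
  have hE : ∀ g, signFun (sgn G (G ⧸ H) * η ^ (n + 1)) g =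
      (monomialHom K (signHom (sgn K (K ⧸ H.subgroupOf K))) g).det := by
    intro g
    rw [signFun_mul, signFun_pow, sgn_quotient_of_le hle, mul_assoc, ← sq, ← pow_mul, mul_comm _ 2,
      pow_mul, signFun_sq, one_pow, mul_one]
  have hE' : ∀ g, signFun (sgn G (G ⧸ H) * η ^ (n + 1) * η ^ (n + 1)) g =
      signFun (sgn G (G ⧸ H)) g := by
    intro g
    rw [signFun_mul, signFun_mul, mul_assoc, ← sq, signFun_sq, mul_one]
  have hcard : (Nat.card (G ⧸ H) : ℂ) = 2 * n := by
    rw [natCard_quotient_of_le hle, ← hn, show Nat.card (G ⧸ K) = 2 from hK]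
    push_cast
    rfl
  rw [SignCongr, hcard]
  convert add_mem (add_mem (add_mem (add_mem (sub_mem h4 h3) h1) h2) (sub_mem h5 h6)) h7 using 1
  ext g
  simp only [Pi.add_apply, Pi.sub_apply, Pi.smul_apply, Pi.one_apply, hE, hE', signFun_mul_self,
    smul_eq_mul]
  simp only [nsmul_eq_mul]
  push_cast
  ring

theorem quadratic_surjective {K : Type*} [Group K] {δ : K →* ℤˣ} (hδ : δ ≠ 1) :
    Function.Surjective δ := by
  have : ∃ g, δ g = -1 := by
    by_contra! h
    exact hδ (MonoidHom.ext fun g => (Int.units_eq_one_or (δ g)).resolve_right (h g))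
  obtain ⟨g, hg⟩ := this
  intro u
  rcases Int.units_eq_one_or u with rfl | rfl
  · exact ⟨1, map_one δ⟩
  · exact ⟨g, hg⟩

/-- The action on the cosets of the kernel of a quadratic character. -/
theorem sgn_quotient_ker {K : Type*} [Group K] [Finite K] {δ : K →* ℤˣ} (hδ : δ ≠ 1) :
    sgn K (K ⧸ δ.ker) = δ := by
  classical
  let _ := Fintype.ofFinite (K ⧸ δ.ker)
  refine MonoidHom.ext fun g => ?_
  rw [sgn_apply, Equiv.Perm.sign_eq_sign_of_equiv _ (Equiv.mulLeft (δ g))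
    (QuotientGroup.quotientKerEquivOfSurjective δ (quadratic_surjective hδ)).toEquiv fun x => ?_]
  · rcases Int.units_eq_one_or (δ g) with h | h <;> rw [h] <;> decide
  · obtain ⟨a, rfl⟩ := QuotientGroup.mk_surjective x
    exact map_mul δ g a

theorem permChar_quotient_ker {K : Type*} [Group K] [Finite K] {δ : K →* ℤˣ} (hδ : δ ≠ 1) :
    permChar K (K ⧸ δ.ker) = 1 + signFun δ := by
  classical
  let _ := Fintype.ofFinite (K ⧸ δ.ker)
  ext g
  rw [permChar_apply, Fintype.sum_equiv
    (QuotientGroup.quotientKerEquivOfSurjective δ (quadratic_surjective hδ)).toEquiv _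
    (fun u => if δ g * u = u then (1 : ℂ) else 0) fun x => ?_]
  · rcases Int.units_eq_one_or (δ g) with h | h
    · norm_num [signFun, h]
    · have : ∀ u : ℤˣ, ¬ (-1 * u = u) := by decide
      simp [signFun, h]
  · refine if_congr ?_ rfl rfl
    rw [← (QuotientGroup.quotientKerEquivOfSurjective δ
      (quadratic_surjective hδ)).toEquiv.apply_eq_iff_eq]
    obtain ⟨a, rfl⟩ := QuotientGroup.mk_surjective x
    have : QuotientGroup.quotientKerEquivOfSurjective δ (quadratic_surjective hδ)
      (g • (a : K ⧸ δ.ker)) = δ g * δ a := map_mul δ g a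
    change _ = _ ↔ δ g * δ a = δ a
    rw [← this]
    rfl

/-- Induction of the congruence in stages. -/
theorem Admissible.signCongr_of_le (hP : Admissible P) {H M : Subgroup G} (hle : H ≤ M)
    (h : SignCongr (P.comap (indHom M.subtype).toAddMonoidHom) (M ⧸ H.subgroupOf M))
    (hM : SignCongr P (G ⧸ M))
    (hker : sgn M (M ⧸ H.subgroupOf M) ≠ 1 →
      SignCongr P (G ⧸ (sgn M (M ⧸ H.subgroupOf M)).ker.map M.subtype)) :
    SignCongr P (G ⧸ H) := by
  classical
  let _ := Fintype.ofFinite (G ⧸ M)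
  set n := Nat.card (M ⧸ H.subgroupOf M) with hn
  set δ := sgn M (M ⧸ H.subgroupOf M) with hδ'
  set s := sgn G (G ⧸ M)
  have h1 := h.indHom_mem hle
  rw [← hn, ← hδ'] at h1
  have h2 := nsmul_mem hM n
  have h3 := hP.sign_pow_mem s n
  have hs2 : ∀ g, signFun s g ^ 2 = 1 := signFun_sq s
  have hcard : (Nat.card (G ⧸ H) : ℂ) = Nat.card (G ⧸ M) * n := by
    rw [natCard_quotient_of_le hle, ← hn]
    push_cast
    rfl
  have hW := fun g => sgn_quotient_of_le hle g
  by_cases hδ : δ = 1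
  · have hs : ∀ g, signFun (sgn G (G ⧸ H)) g = signFun s g ^ n := by
      intro g
      rw [hW, ← hδ', hδ, det_monomialHom_one, ← hn]
      linear_combination (signFun s g ^ n) * hs2 g
    have hδ1 : indHom M.subtype (signFun δ) = permChar G (G ⧸ M) := by
      rw [permChar_quotient]
      congr 1
      ext k
      rw [hδ, signFun_one]
    rw [hδ1] at h1
    rw [SignCongr, hcard]
    convert add_mem (add_mem h1 h2) h3 using 1
    ext g
    simp only [Pi.add_apply, Pi.sub_apply, Pi.smul_apply, hs, signFun_pow, smul_eq_mul]
    simp only [nsmul_eq_mul]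
    ring
  -- The kernel `M₀` has index two in `M`, so inducing `1 + δ` from `M` gives `ℂ[G/M₀]`. Thus the
  -- unknown induced `δ` is the difference of the permutation characters of `G/M₀` and `G/M`, both
  -- controlled by hypothesis.
  · set M₀ := δ.ker.map M.subtype with hM₀
    have hle₀ : M₀ ≤ M := Subgroup.map_subtype_le _
    have hsub : M₀.subgroupOf M = δ.ker := Subgroup.comap_map_eq_self_of_injective
      M.subtype_injective _
    have h4 := hker hδ
    have e1 : sgn M (M ⧸ M₀.subgroupOf M) = δ := by
      rw [← sgn_quotient_ker hδ]
      exact sgn_congr (Subgroup.quotientEquivOfEq hsub) fun g x => by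
        obtain ⟨a, rfl⟩ := QuotientGroup.mk_surjective x
        rfl
    have e2 : permChar G (G ⧸ M₀) = permChar G (G ⧸ M) + indHom M.subtype (signFun δ) := by
      rw [← indHom_permChar_quotient hle₀, permChar_congr (Subgroup.quotientEquivOfEq hsub)
        (fun g x => by
          obtain ⟨a, rfl⟩ := QuotientGroup.mk_surjective x
          rfl), permChar_quotient_ker hδ, map_add, permChar_quotient M]
      rfl
    have e3 : Nat.card (M ⧸ M₀.subgroupOf M) = 2 := by
      rw [Nat.card_congr (Subgroup.quotientEquivOfEq hsub), Nat.card_congr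
        (QuotientGroup.quotientKerEquivOfSurjective δ (quadratic_surjective hδ)).toEquiv]
      simp
    have e4 : ∀ g, signFun (sgn G (G ⧸ M₀)) g = signFun (sgn G (G ⧸ H) * s ^ n) g := by
      intro g
      have hpow : (signFun s g ^ n) ^ 2 = 1 := by
        rw [← pow_mul, mul_comm, pow_mul, hs2, one_pow]
      rw [sgn_quotient_of_le hle₀, e1, e3, signFun_mul, signFun_pow, hW, ← hn, ← hδ']
      linear_combination (monomialHom M (signHom δ) g).det * signFun s g * (hs2 g - hpow)
    have e5 : (Nat.card (G ⧸ M₀) : ℂ) = Nat.card (G ⧸ M) * 2 := by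
      rw [natCard_quotient_of_le hle₀, e3]
      push_cast
      rfl
    have h5 := hP.sign_add_sign_mem (sgn G (G ⧸ H) * s ^ n) (s ^ n)
    have h6 := hP.sign_add_sign_mem s s
    have e6 : ∀ g, signFun (sgn G (G ⧸ H) * s ^ n * s ^ n) g = signFun (sgn G (G ⧸ H)) g := by
      intro g
      rw [signFun_mul, signFun_mul, mul_assoc, ← sq, signFun_sq, mul_one]
    rw [SignCongr, e2, e5] at h4
    rw [SignCongr, hcard]
    convert add_mem (add_mem (sub_mem (add_mem h1 h4) (nsmul_mem hM 2)) (add_mem h2 h3))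
      (sub_mem h5 h6) using 1
    ext g
    simp only [Pi.add_apply, Pi.sub_apply, Pi.smul_apply, e4, e6, signFun_mul_self, smul_eq_mul]
    simp only [nsmul_eq_mul]
    push_cast
    ring

end

/-! ### The congruence for 2-hyperelementary groups -/

/-- A group with a normal cyclic subgroup of odd order whose index is a power of two. -/
def IsTwoHyperelementary (G : Type*) [Group G] : Prop :=
  ∃ C : Subgroup G, C.Normal ∧ IsCyclic C ∧ Odd (Nat.card C) ∧ ∃ k : ℕ, C.index = 2 ^ k

theorem IsTwoHyperelementary.subgroup {G : Type*} [Group G] [Finite G]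
    (hG : IsTwoHyperelementary G) (K : Subgroup G) : IsTwoHyperelementary K := by
  obtain ⟨C, hC, hcyc, hodd, k, hk⟩ := hG
  let f : C.subgroupOf K →* C :=
    (K.subtype.comp (C.subgroupOf K).subtype).codRestrict C fun x => Subgroup.mem_subgroupOf.1 x.2
  have hf : Function.Injective f := fun x y hxy =>
    Subtype.ext (Subtype.ext (congrArg (fun z : C => (z : G)) hxy))
  refine ⟨C.subgroupOf K, inferInstance, isCyclic_of_injective _ hf,
    hodd.of_dvd_nat (Subgroup.card_dvd_of_injective _ hf), ?_⟩
  have h : C.relIndex K ∣ 2 ^ k := hk ▸ Subgroup.relIndex_dvd_index_of_normal C K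
  obtain ⟨m, -, hm⟩ := (Nat.dvd_prime_pow Nat.prime_two).1 h
  exact ⟨m, hm⟩

/-- `G/C` is a `2`-group, and a proper subgroup of a `2`-group lies in one of index two. -/
theorem exists_le_index_two {G : Type*} [Group G] [Finite G] {C L : Subgroup G} [C.Normal] {k : ℕ}
    (hk : C.index = 2 ^ k) (hC : C ≤ L) (hL : L ≠ ⊤) : ∃ K : Subgroup G, L ≤ K ∧ K.index = 2 := by
  have : Fact (Nat.Prime 2) := ⟨Nat.prime_two⟩
  have hcard : Nat.card (G ⧸ C) = 2 ^ k := hk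
  set π := QuotientGroup.mk' C
  have hπ : Function.Surjective π := QuotientGroup.mk'_surjective C
  have hcomap : (L.map π).comap π = L := by
    rw [Subgroup.comap_map_eq, QuotientGroup.ker_mk', sup_eq_left]
    exact hC
  obtain ⟨n, hn, hn'⟩ := (Nat.dvd_prime_pow Nat.prime_two).1
    (hcard ▸ (L.map π).card_subgroup_dvd_card)
  have hlt : n < k := by
    refine lt_of_le_of_ne hn fun h => hL ?_
    rw [h, ← hcard, Subgroup.card_eq_iff_eq_top] at hn'
    rw [← hcomap, hn', Subgroup.comap_top]
  obtain ⟨m, rfl⟩ : ∃ m, k = m + 1 := ⟨k - 1, by omega⟩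
  obtain ⟨K, hK, hle⟩ := Sylow.exists_subgroup_card_pow_prime_le 2 (m := m)
    (hcard ▸ pow_dvd_pow 2 (Nat.le_succ m)) (L.map π) hn' (by omega)
  refine ⟨K.comap π, Subgroup.map_le_iff_le_comap.1 hle, ?_⟩
  rw [Subgroup.index_comap_of_surjective _ hπ]
  have := K.card_mul_index
  rw [hK, hcard, pow_succ] at this
  exact Nat.eq_of_mul_eq_mul_left (by positivity) this

section

variable {G : Type u} [Group G] [Finite G] {P : AddSubgroup (G → ℂ)}

theorem Admissible.signCongr_of_sup_ne_top (hP : Admissible P)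
    (ih : ∀ K : Subgroup G, K ≠ ⊤ → ∀ P' : AddSubgroup (K → ℂ), Admissible P' →
      ∀ H : Subgroup K, SignCongr P' (K ⧸ H))
    {C : Subgroup G} [C.Normal] {k : ℕ} (hk : C.index = 2 ^ k) {H : Subgroup G}
    (hH : H ⊔ C ≠ ⊤) : SignCongr P (G ⧸ H) := by
  obtain ⟨K, hle, hK⟩ := exists_le_index_two hk le_sup_right hH
  refine hP.signCongr_of_index_two (le_sup_left.trans hle) hK (ih K ?_ _ ?_ _)
  · rintro rfl
    simp at hK
  · exact hP.comap K.subtype K.subtype_injective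

end

section

variable {G : Type*} [Group G] {H : Subgroup G} {c : G} {q : ℕ}

/-- This makes the residue modulo `q` of an exponent `i` with `g ∈ c ^ i H` well defined; it becomes
the translation part of the affine action. -/
theorem intCast_eq_of_zpow_inv_mul_mem (hc : ∀ i : ℤ, c ^ i ∈ H → (q : ℤ) ∣ i) {g : G} {i j : ℤ}
    (hi : (c ^ i)⁻¹ * g ∈ H) (hj : (c ^ j)⁻¹ * g ∈ H) : (i : ZMod q) = j := by
  rw [ZMod.intCast_eq_intCast_iff_dvd_sub]
  refine hc _ ?_
  have := H.mul_mem hj (H.inv_mem hi)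
  have h2 := H.inv_mem this
  rw [show (c ^ (j - i)) = ((c ^ j)⁻¹ * g * ((c ^ i)⁻¹ * g)⁻¹)⁻¹ by
    rw [zpow_sub, (Commute.zpow_zpow_self c j i).inv_right.eq]
    group]
  exact h2

theorem intCast_eq_of_zpow_eq (hc : ∀ i : ℤ, c ^ i ∈ H → (q : ℤ) ∣ i) {i j : ℤ}
    (h : c ^ i = c ^ j) : (i : ZMod q) = j :=
  intCast_eq_of_zpow_inv_mul_mem hc (g := c ^ i) (by simp) (by simp [h])

/-- A normal cyclic subgroup acts transitively on the cosets of a supplement; reducing this action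
modulo a prime divisor of the index gives an affine action of the group. -/
theorem exists_affineHom (hc : ∀ i : ℤ, c ^ i ∈ H → (q : ℤ) ∣ i) [hn : (Subgroup.zpowers c).Normal]
    (htop : H ⊔ Subgroup.zpowers c = ⊤) : ∃ Φ : AffineHom G q, Φ.lin c = 1 ∧ Φ.trans c = 1 ∧
      ∀ h ∈ H, Φ.trans h = 0 := by
  have hA : ∀ g : G, ∃ a : ℤ, c ^ a = g * c * g⁻¹ := fun g =>
    Subgroup.mem_zpowers_iff.1 (hn.conj_mem c (Subgroup.mem_zpowers c) g)
  choose a ha using hA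
  have hA' : ∀ (g : G) (j : ℤ), g * c ^ j = c ^ (a g * j) * g := by
    intro g j
    rw [zpow_mul, ha, conj_zpow]
    group
  have hT : ∀ g : G, ∃ i : ℤ, (c ^ i)⁻¹ * g ∈ H := by
    intro g
    have hg : g ∈ Subgroup.zpowers c ⊔ H := by rw [sup_comm, htop]; trivial
    obtain ⟨x, hx, h, hh, rfl⟩ := Subgroup.mem_sup_of_normal_left.1 hg
    obtain ⟨i, rfl⟩ := Subgroup.mem_zpowers_iff.1 hx
    exact ⟨i, by simpa using hh⟩
  choose t ht using hT
  -- The exponents `a g` and `t g`, defined by `g c g⁻¹ = c ^ a g` and `g ∈ c ^ t g H`, are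
  -- arbitrary choices; only their residues modulo `q` obey the affine cocycle rule.
  let lin : G →* ZMod q :=
    { toFun := fun g => (a g : ZMod q)
      map_one' := by
        have := intCast_eq_of_zpow_eq hc (i := a 1) (j := 1) (by rw [ha]; simp)
        simpa using this
      map_mul' := fun g h => by
        rw [← Int.cast_mul]
        refine intCast_eq_of_zpow_eq hc ?_
        rw [ha, zpow_mul, ha g, conj_zpow, ha h]
        group }
  refine ⟨⟨lin.toHomUnits, fun g => (t g : ZMod q), fun g h => ?_⟩, ?_, ?_, ?_⟩
  · have e : (c ^ (t g + a g * t h))⁻¹ * (g * h) = ((c ^ t g)⁻¹ * g) * ((c ^ t h)⁻¹ * h) := by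
      have := hA' g (t h)
      rw [show (c ^ t h)⁻¹ * h = (c ^ t h)⁻¹ * (g⁻¹ * g) * h by group,
        ← mul_assoc (c ^ t h)⁻¹, ← mul_inv_rev, this]
      rw [zpow_add]
      group
    have := intCast_eq_of_zpow_inv_mul_mem hc (ht (g * h))
      (e ▸ H.mul_mem (ht g) (ht h) : (c ^ (t g + a g * t h))⁻¹ * (g * h) ∈ H)
    rw [this]
    push_cast
    rfl
  · refine Units.ext ?_
    have := intCast_eq_of_zpow_eq hc (i := a c) (j := 1) (by rw [ha]; simp)
    simpa [lin] using this
  · have := intCast_eq_of_zpow_inv_mul_mem hc (ht c) (j := 1) (by simp)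
    simpa using this
  · intro h hh
    have := intCast_eq_of_zpow_inv_mul_mem hc (ht h) (j := 0) (by simpa using hh)
    simpa using this

/-- The exponents `i` with `c ^ i ∈ H` are the multiples of the length `d ≠ 1` of the `c`-orbit of
the coset `H`; take a prime factor of `d`. -/
theorem exists_prime_dvd_of_zpow_mem (hc : c ∉ H) :
    ∃ q : ℕ, q.Prime ∧ q ∣ orderOf c ∧ ∀ i : ℤ, c ^ i ∈ H → (q : ℤ) ∣ i := by
  set d := Function.minimalPeriod (c • ·) ((1 : G) : G ⧸ H)
  have hd : ∀ i : ℤ, c ^ i ∈ H ↔ (d : ℤ) ∣ i := by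
    intro i
    rw [← MulAction.zpow_smul_eq_iff_minimalPeriod_dvd, MulAction.Quotient.smul_coe, smul_eq_mul,
      mul_one, eq_comm, QuotientGroup.eq, inv_one, one_mul]
  have hd1 : d ≠ 1 := by
    intro h
    refine hc ?_
    have := (hd 1).2 (by simp [h])
    simpa using this
  obtain ⟨q, hq, hqd⟩ := Nat.exists_prime_and_dvd hd1
  refine ⟨q, hq, hqd.trans ?_, fun i hi => (Int.natCast_dvd_natCast.2 hqd).trans ((hd i).1 hi)⟩
  rw [← Int.natCast_dvd_natCast, ← hd, zpow_natCast, pow_orderOf_eq_one]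
  exact H.one_mem

/-- The subgroup of elements fixing zero. -/
def AffineHom.stabilizer {G : Type*} [Group G] {q : ℕ} (Φ : AffineHom G q) : Subgroup G where
  carrier := {g | Φ.trans g = 0}
  one_mem' := Φ.trans_one
  mul_mem' := fun {a b} (ha : Φ.trans a = 0) (hb : Φ.trans b = 0) => by
    change Φ.trans (a * b) = 0
    rw [Φ.trans_mul, ha, hb, mul_zero, add_zero]
  inv_mem' := fun {a} (ha : Φ.trans a = 0) => by
    change Φ.trans a⁻¹ = 0
    rw [Φ.trans_inv, ha, mul_zero]

end

theorem quadratic_eq_one_of_odd_orderOf {K : Type*} [Group K] (δ : K →* ℤˣ) {y : K}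
    (hy : Odd (orderOf y)) : δ y = 1 := by
  have h : δ y ^ orderOf y = 1 := by rw [← map_pow, pow_orderOf_eq_one, map_one]
  rcases Int.units_eq_one_or (δ y) with h1 | h1
  · exact h1
  · rw [h1, hy.neg_one_pow] at h
    exact absurd h (by decide)

/-- Otherwise an element of `M` with `δ = -1` would be a product of an element of `ker δ` and an
element of `C ∩ M`; the latter has odd order, so `δ` is `1` on it. -/
theorem map_ker_sup_ne_top {G : Type*} [Group G] {M C : Subgroup G} [C.Normal] [Finite G]
    (hC : Odd (Nat.card C)) {δ : M →* ℤˣ} (hδ : δ ≠ 1) : δ.ker.map M.subtype ⊔ C ≠ ⊤ := by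
  intro htop
  obtain ⟨m, hm⟩ := quadratic_surjective hδ (-1)
  have hmem : (m : G) ∈ δ.ker.map M.subtype ⊔ C := by rw [htop]; trivial
  obtain ⟨x, ⟨x, hx, rfl⟩, y, hy, hxy⟩ := Subgroup.mem_sup_of_normal_right.1 hmem
  have hyM : y = ((x⁻¹ * m : M) : G) := by
    rw [Subgroup.coe_mul, ← hxy]
    simp
  have hodd : Odd (orderOf (x⁻¹ * m)) := by
    rw [← Subgroup.orderOf_coe, ← hyM]
    refine hC.of_dvd_nat ?_
    rw [← Subgroup.orderOf_mk y hy]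
    exact orderOf_dvd_natCard _
  have h1 := quadratic_eq_one_of_odd_orderOf δ hodd
  rw [map_mul, map_inv, MonoidHom.mem_ker.1 hx, hm] at h1
  exact absurd h1 (by decide)

/-- Induction on the order of `G`. When `HC = G` and `H ≠ G`, the stabiliser `M` of `0` for the
affine action is proper and contains `H`, so `M/H` falls to the induction hypothesis. The remaining
inputs are the sets `G/ker lin` (if `ker lin` is proper) and `G/ker δ`. In both cases the product of
the subgroup with `C` is proper: the first subgroup contains `C`, and the second is
`map_ker_sup_ne_top`. -/
theorem IsTwoHyperelementary.signCongr_quotient_of_card (n : ℕ) : ∀ (G : Type u) [Group G]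
    [Finite G], Nat.card G = n → IsTwoHyperelementary G → ∀ P : AddSubgroup (G → ℂ),
    Admissible P → ∀ H : Subgroup G, SignCongr P (G ⧸ H) := by
  induction n using Nat.strong_induction_on with
  | _ n IH =>
  intro G _ _ hn hG P hP H
  have ih : ∀ K : Subgroup G, K ≠ ⊤ → ∀ P' : AddSubgroup (K → ℂ), Admissible P' →
      ∀ H : Subgroup K, SignCongr P' (K ⧸ H) := by
    intro K hK P' hP' H
    refine IH (Nat.card K) (hn ▸ lt_of_le_of_ne K.card_le_card_group fun h => hK ?_) K rfl
      (hG.subgroup K) P' hP' H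
    exact K.eq_top_of_card_eq h
  obtain ⟨C, hC, hcyc, hodd, k, hk⟩ := hG
  by_cases hHC : H ⊔ C ≠ ⊤
  · exact hP.signCongr_of_sup_ne_top ih hk hHC
  push Not at hHC
  by_cases htop : H = ⊤
  · subst htop
    have := QuotientGroup.subsingleton_quotient_top (G := G)
    exact signCongr_of_subsingleton _
  obtain ⟨c, rfl⟩ := (Subgroup.isCyclic_iff_exists_zpowers_eq_top C).1 hcyc
  have hcH : c ∉ H := by
    intro hc
    refine htop ?_
    rwa [sup_eq_left.2 ((Subgroup.zpowers_le).2 hc)] at hHC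
  obtain ⟨q, hq, hqd, hqH⟩ := exists_prime_dvd_of_zpow_mem hcH
  rw [Nat.card_zpowers] at hodd
  have hq2 : q ≠ 2 := by
    rintro rfl
    exact Nat.not_even_iff_odd.2 hodd (even_iff_two_dvd.2 hqd)
  have := Fact.mk hq
  obtain ⟨Φ, h1, h2, h3⟩ := exists_affineHom hqH hHC
  have hker : Subgroup.zpowers c ≤ Φ.lin.ker := Subgroup.zpowers_le.2 h1
  obtain ⟨j, -, hj⟩ := (Nat.dvd_prime_pow Nat.prime_two).1 (hk ▸ Subgroup.index_dvd_of_le hker)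
  have hM : Φ.stabilizer ≠ ⊤ := by
    intro h
    have : c ∈ Φ.stabilizer := by rw [h]; trivial
    exact one_ne_zero (h2.symm.trans this)
  refine hP.signCongr_of_le (M := Φ.stabilizer) h3 (ih _ hM _ (hP.comap _ Subtype.val_injective) _)
    (Φ.signCongr_quotient hP hq2 h1 h2 (fun g => Iff.rfl) hj fun hT =>
      hP.signCongr_of_sup_ne_top ih hk ?_) fun hδ => hP.signCongr_of_sup_ne_top ih hk ?_
  · rwa [sup_eq_left.2 hker]
  · exact map_ker_sup_ne_top (by rwa [Nat.card_zpowers]) hδ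

theorem IsTwoHyperelementary.signCongr {G : Type u} [Group G] [Finite G]
    (hG : IsTwoHyperelementary G) {P : AddSubgroup (G → ℂ)} (hP : Admissible P) (X : Type*)
    [MulAction G X] [Finite X] : SignCongr P X :=
  hP.signCongr_of_forall_quotient (hG.signCongr_quotient_of_card _ G rfl P hP) X

/-! ### Odd numbers of fixed points -/

theorem smul_coe_eq_iff {G : Type*} [Group G] {E : Subgroup G} {x g : G} :
    x • (g : G ⧸ E) = g ↔ g⁻¹ * x * g ∈ E := by
  rw [MulAction.Quotient.smul_coe, eq_comm, QuotientGroup.eq, smul_eq_mul, mul_assoc]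

theorem mem_of_odd_orderOf {K : Type*} [Group K] {C : Subgroup K} [C.Normal] {k : ℕ}
    (hk : C.index = 2 ^ k) {y : K} (hy : Odd (orderOf y)) : y ∈ C := by
  rw [← QuotientGroup.eq_one_iff, ← orderOf_eq_one_iff]
  have h1 : orderOf (y : K ⧸ C) ∣ orderOf y := orderOf_map_dvd (QuotientGroup.mk' C) y
  have h2 : orderOf (y : K ⧸ C) ∣ 2 ^ k := by
    rw [← hk]
    exact orderOf_dvd_natCard _
  exact Nat.eq_one_of_dvd_coprimes ((Nat.coprime_two_right.2 hy).pow_right k) h1 h2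

theorem odd_card_fixedBy {X G : Type*} [Group G] [MulAction G X] [Finite X] {x : G} {a : ℕ}
    (hx : ∀ y : X, x ^ 2 ^ a • y = y) (hX : Odd (Nat.card X)) :
    Odd (Nat.card (MulAction.fixedBy X x)) := by
  classical
  let _ := Fintype.ofFinite X
  have : Fact (Nat.Prime 2) := ⟨Nat.prime_two⟩
  have h := Equiv.Perm.card_fixedPoints_modEq (α := X) (f := MulAction.toEndHom x) (p := 2) (n := a)
    (by rw [← map_pow]; exact funext hx)
  rw [Nat.odd_iff] at hX ⊢
  rw [← hX, Nat.card_eq_fintype_card, Nat.card_eq_fintype_card]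
  exact h.symm

section

variable {G : Type*} [Group G] [Finite G]

/-- For a cyclic subgroup of odd order, its product with a Sylow `2`-subgroup of its normaliser. -/
theorem exists_le_normalizer (C : Subgroup G) (hcyc : IsCyclic C) (hC : Odd (Nat.card C)) :
    ∃ E : Subgroup G, C ≤ E ∧ E ≤ Subgroup.normalizer C ∧
      Odd (Nat.card (Subgroup.normalizer C ⧸ E.subgroupOf (Subgroup.normalizer C))) ∧
      (∃ k, (C.subgroupOf E).index = 2 ^ k) ∧ IsTwoHyperelementary E := by
  have : Fact (Nat.Prime 2) := ⟨Nat.prime_two⟩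
  set N := Subgroup.normalizer (C : Set G) with hN
  have hCN : C ≤ N := Subgroup.le_normalizer
  have hnorm : (C.subgroupOf N).Normal := Subgroup.normal_in_normalizer
  let S : Sylow 2 N := default
  set E' := (S : Subgroup N) ⊔ C.subgroupOf N with hE'
  have hEN : (E'.map N.subtype).subgroupOf N = E' :=
    Subgroup.comap_map_eq_self_of_injective N.subtype_injective _
  have hle : E'.map N.subtype ≤ N := Subgroup.map_subtype_le _
  have hCE : C ≤ E'.map N.subtype := by
    rw [← Subgroup.map_subgroupOf_eq_of_le hCN]
    exact Subgroup.map_mono le_sup_right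
  obtain ⟨k, hk⟩ : ∃ k, (C.subgroupOf (E'.map N.subtype)).index = 2 ^ k := by
    obtain ⟨n, hn⟩ := IsPGroup.iff_card.1 S.isPGroup'
    suffices h : (C.subgroupOf (E'.map N.subtype)).index ∣ 2 ^ n by
      obtain ⟨k, -, hk⟩ := (Nat.dvd_prime_pow Nat.prime_two).1 h
      exact ⟨k, hk⟩
    have h1 : (C.subgroupOf (E'.map N.subtype)).index = (C.subgroupOf N).relIndex E' := by
      have := Subgroup.relIndex_subgroupOf (H := C) hle
      rw [hEN] at this
      exact this.symm
    rw [h1, hE', Subgroup.relIndex_sup_right, ← hn]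
    exact Subgroup.relIndex_dvd_card _ _
  have hnE : (C.subgroupOf (E'.map N.subtype)).Normal := Subgroup.normal_subgroupOf_of_le_normalizer hle
  refine ⟨E'.map N.subtype, hCE, hle, ?_, ⟨k, hk⟩, C.subgroupOf _, hnE, ?_, ?_, k, hk⟩
  · rw [hEN, ← Nat.not_even_iff_odd, even_iff_two_dvd]
    exact fun h => S.not_dvd_index (h.trans (Subgroup.index_dvd_of_le le_sup_left))
  · exact isCyclic_of_surjective _ (Subgroup.subgroupOfEquivOfLe hCE).symm.surjective
  · rwa [Nat.card_congr (Subgroup.subgroupOfEquivOfLe hCE).toEquiv]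

/-- Let `c` be the power of `x` generating the odd part of `⟨x⟩`, `C = ⟨c⟩`, `N` its normaliser, and
`E` the product of `C` with a Sylow `2`-subgroup of `N`. If `x` fixes `gE`, then `g⁻¹ c g` lies in
`E` and has odd order, so it lies in `C` and `g ∈ N`. Hence all fixed points lie in `N/E`, a set of
odd size on which `x` acts with `2`-power order. -/
theorem exists_isTwoHyperelementary_odd_card_fixedBy (x : G) :
    ∃ E : Subgroup G, IsTwoHyperelementary E ∧ Odd (Nat.card (MulAction.fixedBy (G ⧸ E) x)) := by
  obtain ⟨a, m, hm, hxm⟩ := Nat.exists_eq_two_pow_mul_odd (orderOf_pos x).ne'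
  set c := x ^ 2 ^ a with hc
  have hcm : orderOf c = m := by
    rw [hc, orderOf_pow, hxm, Nat.gcd_eq_right (dvd_mul_right _ _),
      Nat.mul_div_cancel_left _ (by positivity)]
  set C := Subgroup.zpowers c with hC
  have hcC : c ∈ C := Subgroup.mem_zpowers c
  obtain ⟨E, hCE, hEN, hodd, ⟨k, hk⟩, hE⟩ := exists_le_normalizer C inferInstance
    (by rwa [hC, Nat.card_zpowers, hcm])
  refine ⟨E, hE, ?_⟩
  set N := Subgroup.normalizer (C : Set G) with hN
  have hnE : (C.subgroupOf E).Normal := Subgroup.normal_subgroupOf_of_le_normalizer hEN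
  have hnorm : (C.subgroupOf N).Normal := Subgroup.normal_in_normalizer
  have hxc : x * c = c * x := (Commute.refl x).pow_right _
  have hxN : x ∈ N := by
    refine Subgroup.mem_normalizer_fintype fun n hn => ?_
    obtain ⟨i, rfl⟩ := Subgroup.mem_zpowers_iff.1 hn
    rw [((show Commute x c from hxc).zpow_right i).eq, mul_inv_cancel_right]
    exact hn
  have hmemN : ∀ g : G, g⁻¹ * x * g ∈ E → g ∈ N := by
    intro g hg
    have h1 : g⁻¹ * c * g ∈ E := by
      have := E.pow_mem hg (2 ^ a)
      have h2 := conj_pow (i := 2 ^ a) (a := g⁻¹) (b := x)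
      rw [inv_inv] at h2
      rwa [h2, ← hc] at this
    have h2 : g⁻¹ * c * g ∈ C := by
      have h3 : orderOf (⟨g⁻¹ * c * g, h1⟩ : E) = m := by
        rw [Subgroup.orderOf_mk, ← hcm]
        have := (MulAut.conj g⁻¹).orderOf_eq c
        simpa using this
      have := mem_of_odd_orderOf hk (y := (⟨g⁻¹ * c * g, h1⟩ : E)) (by rwa [h3])
      exact Subgroup.mem_subgroupOf.1 this
    rw [← inv_mem_iff]
    refine Subgroup.mem_normalizer_fintype fun n hn => ?_
    obtain ⟨i, rfl⟩ := Subgroup.mem_zpowers_iff.1 hn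
    rw [← conj_zpow, inv_inv]
    exact C.zpow_mem h2 i
  have hfix := odd_card_fixedBy (X := N ⧸ E.subgroupOf N) (x := (⟨x, hxN⟩ : N)) (a := a)
    (fun y => by
      obtain ⟨n, rfl⟩ := QuotientGroup.mk_surjective y
      rw [smul_coe_eq_iff, Subgroup.mem_subgroupOf]
      refine hCE ?_
      have := hnorm.conj_mem (⟨x, hxN⟩ ^ 2 ^ a) (Subgroup.mem_subgroupOf.2 hcC) n⁻¹
      rw [inv_inv] at this
      exact Subgroup.mem_subgroupOf.1 this) hodd
  let f : N ⧸ E.subgroupOf N → G ⧸ E := Quotient.map' Subtype.val fun p q h => by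
    rw [QuotientGroup.leftRel_apply] at h ⊢
    exact h
  have hf : ∀ n : N, f n = ((n : G) : G ⧸ E) := fun _ => rfl
  have hmem : ∀ y, y ∈ MulAction.fixedBy (N ⧸ E.subgroupOf N) (⟨x, hxN⟩ : N) ↔
      f y ∈ MulAction.fixedBy (G ⧸ E) x := by
    intro y
    obtain ⟨n, rfl⟩ := QuotientGroup.mk_surjective y
    rw [MulAction.mem_fixedBy, MulAction.mem_fixedBy, hf, smul_coe_eq_iff, smul_coe_eq_iff]
    rfl
  rw [← Nat.card_congr (Equiv.ofBijective
    (fun y : MulAction.fixedBy (N ⧸ E.subgroupOf N) (⟨x, hxN⟩ : N) =>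
      (⟨f y, (hmem y).1 y.2⟩ : MulAction.fixedBy (G ⧸ E) x)) ⟨?_, ?_⟩)]
  · exact hfix
  · rintro ⟨y, hy⟩ ⟨z, hz⟩ h
    obtain ⟨n, rfl⟩ := QuotientGroup.mk_surjective y
    obtain ⟨p, rfl⟩ := QuotientGroup.mk_surjective z
    have h' : ((n : G) : G ⧸ E) = (p : G) := congrArg Subtype.val h
    rw [QuotientGroup.eq] at h'
    exact Subtype.ext (QuotientGroup.eq.2 h')
  · rintro ⟨y, hy⟩
    obtain ⟨g, rfl⟩ := QuotientGroup.mk_surjective y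
    have hg := hmemN g (smul_coe_eq_iff.1 hy)
    exact ⟨⟨((⟨g, hg⟩ : N) : N ⧸ E.subgroupOf N), (hmem _).2 hy⟩, rfl⟩

end

/-! ### Induction from 2-hyperelementary subgroups -/

/-- The differences of the permutation characters of two `G`-sets with the same degree and the same
determinant. -/
def balancedCharacters (G : Type u) [Group G] : Set (G → ℂ) :=
  {ρ | ∃ (X Y : Type u) (_ : Finite X) (_ : Finite Y) (_ : MulAction G X) (_ : MulAction G Y),
    Nat.card X = Nat.card Y ∧ sgn G X = sgn G Y ∧ ρ = permChar G X - permChar G Y}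

section

variable {G : Type u} [Group G] [Finite G] {P : AddSubgroup (G → ℂ)}

/-- The functions multiplying the balanced permutation characters into `P`. -/
def multiplierGroup (P : AddSubgroup (G → ℂ)) : AddSubgroup (G → ℂ) where
  carrier := {w | ∀ ρ ∈ balancedCharacters G, w * ρ ∈ P}
  zero_mem' ρ _ := by rw [zero_mul]; exact zero_mem P
  add_mem' ha hb ρ hρ := by rw [add_mul]; exact add_mem (ha ρ hρ) (hb ρ hρ)
  neg_mem' ha ρ hρ := by rw [neg_mul]; exact neg_mem (ha ρ hρ)

/-- The functions multiplying `multiplierGroup P` into itself. -/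
def multiplierRing (P : AddSubgroup (G → ℂ)) : Subring (G → ℂ) where
  carrier := {a | ∀ w ∈ multiplierGroup P, a * w ∈ multiplierGroup P}
  zero_mem' w _ := by rw [zero_mul]; exact zero_mem _
  one_mem' w hw := by rwa [one_mul]
  add_mem' ha hb w hw := by rw [add_mul]; exact add_mem (ha w hw) (hb w hw)
  mul_mem' ha hb w hw := by rw [mul_assoc]; exact ha _ (hb w hw)
  neg_mem' ha w hw := by rw [neg_mul]; exact neg_mem (ha w hw)

omit [Finite G] in
theorem permChar_mul_mem_balancedCharacters (Z : Type u) [MulAction G Z] [Finite Z] {ρ : G → ℂ}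
    (hρ : ρ ∈ balancedCharacters G) : permChar G Z * ρ ∈ balancedCharacters G := by
  obtain ⟨X, Y, _, _, _, _, h1, h2, rfl⟩ := hρ
  refine ⟨Z × X, Z × Y, inferInstance, inferInstance, inferInstance, inferInstance, ?_, ?_, ?_⟩
  · rw [Nat.card_prod, Nat.card_prod, h1]
  · rw [sgn_prod, sgn_prod, h1, h2]
  · rw [permChar_prod, permChar_prod, mul_sub]

omit [Finite G] in
theorem permChar_mem_multiplierRing (Z : Type u) [MulAction G Z] [Finite Z] :
    permChar G Z ∈ multiplierRing P := fun w hw ρ hρ => by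
  rw [mul_comm (permChar G Z), mul_assoc]
  exact hw _ (permChar_mul_mem_balancedCharacters Z hρ)

/-- By the projection formula the product is induced from the restriction of `ℂ[X] - ℂ[Y]` to `E`.
There `SignCongr` holds for both sets, and the sign and degree terms cancel. -/
theorem IsTwoHyperelementary.permChar_mem_multiplierGroup {E : Subgroup G}
    (hE : IsTwoHyperelementary E) (hP : Admissible P) :
    permChar G (G ⧸ E) ∈ multiplierGroup P := by
  rintro _ ⟨X, Y, _, _, _, _, h1, h2, rfl⟩
  have hP' := hP.comap E.subtype E.subtype_injective
  have h3 := sub_mem (hE.signCongr hP' X) (hE.signCongr hP' Y)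
  have h4 : sgn E X = sgn E Y := by
    have := congrArg (fun δ => δ.comp E.subtype) h2
    exact this
  rw [AddSubgroup.mem_comap] at h3
  have h5 := indHom_mul_comp E.subtype (fun _ => 1) (permChar G X - permChar G Y) (fun x g => by
    rw [Pi.sub_apply, permChar_conj_invariant, permChar_conj_invariant, Pi.sub_apply])
  rw [← permChar_quotient] at h5
  change _ = permChar G (G ⧸ E) * (permChar G X - permChar G Y) at h5
  rw [← h5]
  have h6 : (fun h : E => (1 : ℂ) * (permChar G X - permChar G Y) (E.subtype h)) =
      fun h => permChar E X h - permChar E Y h := by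
    ext h
    rw [one_mul]
    rfl
  rw [h6]
  convert h3 using 1
  rw [h4, h1]
  change indHom E.subtype _ = indHom E.subtype _
  congr 1
  ext h
  simp only [Pi.sub_apply]
  ring

theorem exists_forall_mem_odd (hP : Admissible P) (T : Finset G) : ∃ w : G → ℤ,
    (fun g => (w g : ℂ)) ∈ multiplierGroup P ∧ (fun g => (w g : ℂ)) ∈ multiplierRing P ∧
    ∀ g ∈ T, Odd (w g) := by
  classical
  induction T using Finset.induction_on with
  | empty =>
    have h0 : (fun g => (((0 : G → ℤ) g : ℤ) : ℂ)) = 0 := by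
      ext g
      simp
    exact ⟨0, h0 ▸ zero_mem _, h0 ▸ zero_mem _, by simp⟩
  | insert x T _ ih =>
    obtain ⟨w, h1, h2, h3⟩ := ih
    obtain ⟨E, hE, hodd⟩ := exists_isTwoHyperelementary_odd_card_fixedBy x
    set f : G → ℤ := fun g => Nat.card (MulAction.fixedBy (G ⧸ E) g)
    have hf : (fun g => (f g : ℂ)) = permChar G (G ⧸ E) := by
      ext g
      simp [f, permChar]
    have hf1 : (fun g => (f g : ℂ)) ∈ multiplierGroup P := by
      rw [hf]
      exact hE.permChar_mem_multiplierGroup hP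
    have hf2 : (fun g => (f g : ℂ)) ∈ multiplierRing P := by
      rw [hf]
      exact permChar_mem_multiplierRing _
    have hw : (fun g => ((w g + f g - w g * f g : ℤ) : ℂ)) =
        (fun g => (w g : ℂ)) + (fun g => (f g : ℂ)) - (fun g => (w g : ℂ)) * fun g => (f g : ℂ) := by
      ext g
      simp
    -- This is `1 - (1 - w)(1 - f)`, odd wherever `w` or `f` is odd.
    refine ⟨fun g => w g + f g - w g * f g, ?_, ?_, fun g hg => ?_⟩
    · rw [hw]
      exact sub_mem (add_mem h1 hf1) (h2 _ hf1)
    · rw [hw]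
      exact sub_mem (add_mem h2 hf2) (mul_mem h2 hf2)
    · have : Odd (w g) ∨ Odd (f g) := by
        rcases Finset.mem_insert.1 hg with rfl | hg
        · exact Or.inr (by simpa [f] using hodd)
        · exact Or.inl (h3 g hg)
      have h4 : w g + f g - w g * f g = 1 - (w g - 1) * (f g - 1) := by ring
      change Odd (w g + f g - w g * f g)
      rw [h4]
      refine odd_one.sub_even ?_
      rcases this with h | h
      · exact (h.sub_odd odd_one).mul_right _
      · exact (h.sub_odd odd_one).mul_left _

/-- With `v` everywhere odd, the product of `v - w x` over all `x` vanishes at every point of `G`.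
Expanding it, the terms involving `v` lie in `multiplierGroup P`, and the constant term is a product
of odd integers up to sign. -/
theorem exists_odd_mem_multiplierGroup (hP : Admissible P) :
    ∃ n : ℤ, Odd n ∧ (n : G → ℂ) ∈ multiplierGroup P := by
  classical
  let _ := Fintype.ofFinite G
  obtain ⟨w, h1, h2, h3⟩ := exists_forall_mem_odd hP Finset.univ
  set v : G → ℂ := fun g => (w g : ℂ) with hv
  have key : ∀ T : Finset G, (∏ x ∈ T, (v - ((w x : ℤ) : G → ℂ))) ∈ multiplierRing P ∧
      ∃ n : ℤ, Odd n ∧ (∏ x ∈ T, (v - ((w x : ℤ) : G → ℂ))) - (n : G → ℂ) ∈ multiplierGroup P := by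
    intro T
    refine ⟨prod_mem fun x _ => sub_mem h2 (intCast_mem _ _), ?_⟩
    induction T using Finset.induction_on with
    | empty => exact ⟨1, odd_one, by simp⟩
    | insert y T hy ih =>
      obtain ⟨n, hn, hmem⟩ := ih
      have hp : (∏ x ∈ T, (v - ((w x : ℤ) : G → ℂ))) ∈ multiplierRing P :=
        prod_mem fun x _ => sub_mem h2 (intCast_mem _ _)
      refine ⟨-(n * w y), (hn.mul (h3 y (Finset.mem_univ y))).neg, ?_⟩
      convert sub_mem (hp v h1) (intCast_mem (multiplierRing P) (w y) _ hmem) using 1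
      rw [Finset.prod_insert hy]
      push_cast
      ring
  obtain ⟨-, n, hn, hmem⟩ := key Finset.univ
  refine ⟨-n, hn.neg, ?_⟩
  convert hmem using 1
  rw [show ∏ x, (v - ((w x : ℤ) : G → ℂ)) = 0 from funext fun g => ?_]
  · push_cast
    rw [zero_sub]
  · rw [Finset.prod_apply]
    exact Finset.prod_eq_zero (Finset.mem_univ g) (by simp [hv])

theorem Admissible.balancedCharacters_subset (hP : Admissible P) : balancedCharacters G ⊆ P := by
  intro ρ hρ
  obtain ⟨n, ⟨m, rfl⟩, hn⟩ := exists_odd_mem_multiplierGroup hP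
  have h1 := hn ρ hρ
  obtain ⟨X, Y, _, _, _, _, h2, -, rfl⟩ := hρ
  have h3 := hP.two_mul_mem (sub_mem (permChar_mem_monomialCharacters (G := G) X)
    (permChar_mem_monomialCharacters (G := G) Y))
    (by rw [Pi.sub_apply, permChar_one, permChar_one, h2, sub_self])
    (fun g => by simp [permChar])
  have := sub_mem h1 (zsmul_mem h3 m)
  rw [SetLike.mem_coe]
  convert this using 1
  ext g
  simp only [Pi.sub_apply, Pi.mul_apply, zsmul_eq_mul, Pi.intCast_apply]
  push_cast
  ring

end

/-! ### Determinants from characters, via eigenvalues -/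

section

open Polynomial

variable {n : Type*} [Fintype n] [DecidableEq n]

theorem det_aeval_eq_prod_roots (A : Matrix n n ℂ) (p : ℂ[X]) :
    (aeval A p).det = (A.charpoly.roots.map fun x => p.eval x).prod := by
  have hcard : A.charpoly.roots.card = Fintype.card n := by
    rw [← (IsAlgClosed.splits A.charpoly).natDegree_eq_card_roots, Matrix.charpoly_natDegree_eq_dim]
  have hX : ∀ b : ℂ, (aeval A (X - C b)).det =
      (A.charpoly.roots.map fun x => (X - C b).eval x).prod := by
    intro b
    have h1 : A.charpoly.eval b = (A.charpoly.roots.map fun x => b - x).prod := by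
      conv_lhs => rw [(IsAlgClosed.splits A.charpoly).eq_prod_roots_of_monic A.charpoly_monic]
      rw [eval_multiset_prod, Multiset.map_map]
      simp
    rw [Matrix.eval_charpoly] at h1
    have h2 : aeval A (X - C b) = -(Matrix.scalar n b - A) := by
      simp [Matrix.algebraMap_eq_diagonal, Matrix.scalar_apply]
    rw [h2, Matrix.det_neg, h1, ← hcard]
    simp only [eval_sub, eval_X, eval_C, ← neg_sub b]
    rw [← Multiset.card_map (fun x => b - x), ← Multiset.prod_map_neg, Multiset.map_map]
    rfl
  have hprod : ∀ s : Multiset ℂ, (aeval A (s.map fun b => X - C b).prod).det =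
      (A.charpoly.roots.map fun x => (s.map fun b => X - C b).prod.eval x).prod := by
    intro s
    induction s using Multiset.induction_on with
    | empty => simp
    | cons b s ih =>
      simp only [Multiset.map_cons, Multiset.prod_cons, map_mul, Matrix.det_mul, eval_mul,
        Multiset.prod_map_mul, ih, hX]
  rw [(IsAlgClosed.splits p).eq_prod_roots]
  simp only [map_mul, Matrix.det_mul, eval_mul, Multiset.prod_map_mul, hprod, aeval_C, eval_C,
    Multiset.map_const', Multiset.prod_replicate, hcard]
  congr 1
  rw [Matrix.algebraMap_eq_diagonal, Matrix.det_diagonal]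
  simp

/-- Evaluating det p(A) = ∏ p(λ) at `p = t - X ^ k` identifies the characteristic polynomial of `A ^
k`. -/
theorem trace_pow_eq_sum_roots (A : Matrix n n ℂ) (k : ℕ) :
    (A ^ k).trace = (A.charpoly.roots.map fun x => x ^ k).sum := by
  have h : (A ^ k).charpoly = ((A.charpoly.roots.map fun x => x ^ k).map fun x => X - C x).prod := by
    refine Polynomial.funext fun t => ?_
    have h1 := det_aeval_eq_prod_roots A (C t - X ^ k)
    rw [Matrix.eval_charpoly, eval_multiset_prod, Multiset.map_map, Multiset.map_map]
    have h2 : aeval A (C t - X ^ k) = Matrix.scalar n t - A ^ k := by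
      simp [Matrix.algebraMap_eq_diagonal, Matrix.scalar_apply]
    rw [← h2, h1]
    simp
  rw [Matrix.trace_eq_sum_roots_charpoly, h, roots_multiset_prod_X_sub_C]

/-- Equal power sums give equal sums of any polynomial; a polynomial vanishing at every other
element but not at `a` isolates the multiplicity of `a`. -/
theorem multiset_eq_of_sum_pow_eq {s t : Multiset ℂ}
    (h : ∀ k : ℕ, (s.map fun x => x ^ k).sum = (t.map fun x => x ^ k).sum) : s = t := by
  classical
  have hp : ∀ p : ℂ[X], (s.map fun x => p.eval x).sum = (t.map fun x => p.eval x).sum := by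
    intro p
    induction p using Polynomial.induction_on' with
    | add p q hp hq => simp only [eval_add, Multiset.sum_map_add, hp, hq]
    | monomial k a => simp only [eval_monomial, Multiset.sum_map_mul_left, h]
  refine Multiset.ext.2 fun a => ?_
  set p : ℂ[X] := ∏ b ∈ (s + t).toFinset.erase a, (X - C b) with hpdef
  have hpa : p.eval a ≠ 0 := by
    rw [hpdef, eval_prod, Finset.prod_ne_zero_iff]
    intro b hb
    rw [eval_sub, eval_X, eval_C, sub_ne_zero]
    exact (Finset.ne_of_mem_erase hb).symm
  have key : ∀ r : Multiset ℂ, r ≤ s + t →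
      (r.map fun x => p.eval x).sum = r.count a * p.eval a := by
    intro r hr
    rw [Finset.sum_multiset_map_count, Finset.sum_eq_single a, nsmul_eq_mul]
    · intro b hb hba
      have : p.eval b = 0 := by
        rw [hpdef, eval_prod]
        refine Finset.prod_eq_zero (i := b) (Finset.mem_erase.2 ⟨hba, ?_⟩) (by simp)
        exact Multiset.mem_toFinset.2 (Multiset.mem_of_le hr (Multiset.mem_toFinset.1 hb))
      rw [this, smul_zero]
    · intro ha
      rw [Multiset.count_eq_zero_of_notMem (fun h => ha (Multiset.mem_toFinset.2 h)), zero_smul]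
  have h1 := hp p
  rw [key s (Multiset.le_add_right s t), key t (Multiset.le_add_left t s)] at h1
  exact_mod_cast mul_right_cancel₀ hpa h1

end

/-- The eigenvalues of an endomorphism, with multiplicity. -/
noncomputable def eigenvalueMultiset {V : Type*} [AddCommGroup V] [Module ℂ V]
    [FiniteDimensional ℂ V] (f : V →ₗ[ℂ] V) : Multiset ℂ :=
  f.charpoly.roots

section

variable {V : Type*} [AddCommGroup V] [Module ℂ V] [FiniteDimensional ℂ V]

theorem det_eq_prod_eigenvalueMultiset (f : V →ₗ[ℂ] V) :
    LinearMap.det f = (eigenvalueMultiset f).prod :=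
  Module.End.det_eq_prod_roots_charpoly_of_splits (IsAlgClosed.splits _)

theorem trace_pow_eq_sum_eigenvalueMultiset (f : V →ₗ[ℂ] V) (k : ℕ) :
    LinearMap.trace ℂ V (f ^ k) = ((eigenvalueMultiset f).map fun x => x ^ k).sum := by
  classical
  let b := Module.finBasis ℂ V
  rw [LinearMap.trace_eq_matrix_trace ℂ b, ← LinearMap.toMatrix_pow, trace_pow_eq_sum_roots,
    LinearMap.charpoly_toMatrix]
  rfl

end

section

variable {G : Type u} [Group G]

theorem toMatrix_ofMulAction {X : Type*} [Fintype X] [DecidableEq X] [MulAction G X] (g : G) :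
    LinearMap.toMatrix (MonoidAlgebra.basis X ℂ) (MonoidAlgebra.basis X ℂ)
      (Representation.ofMulAction ℂ G X g) =
      (MulAction.toPerm g⁻¹ : Equiv.Perm X).permMatrix ℂ := by
  ext i j
  have h : (MonoidAlgebra.basis X ℂ).repr (MonoidAlgebra.single (g • j) 1) i =
      if i = g • j then 1 else 0 := Finsupp.single_apply.trans (if_congr eq_comm rfl rfl)
  rw [LinearMap.toMatrix_apply, MonoidAlgebra.basis_apply, Representation.ofMulAction_single,
    Equiv.Perm.permMatrix, PEquiv.toMatrix_apply, h]
  simp [eq_inv_smul_iff, eq_comm]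

theorem trace_ofMulAction {X : Type*} [Finite X] [MulAction G X] (g : G) :
    LinearMap.trace ℂ (MonoidAlgebra ℂ X) (Representation.ofMulAction ℂ G X g) = permChar G X g := by
  classical
  let _ := Fintype.ofFinite X
  rw [LinearMap.trace_eq_matrix_trace ℂ (MonoidAlgebra.basis X ℂ), toMatrix_ofMulAction,
    permChar_apply, Matrix.trace]
  refine Finset.sum_congr rfl fun x _ => ?_
  rw [Matrix.diag_apply, Equiv.Perm.permMatrix, PEquiv.toMatrix_apply]
  simp [inv_smul_eq_iff, eq_comm (a := x)]

theorem det_ofMulAction {X : Type*} [Finite X] [MulAction G X] (g : G) :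
    LinearMap.det (Representation.ofMulAction ℂ G X g) = signFun (sgn G X) g := by
  classical
  let _ := Fintype.ofFinite X
  rw [← LinearMap.det_toMatrix (MonoidAlgebra.basis X ℂ), toMatrix_ofMulAction,
    Matrix.det_permutation, ← sgn_apply, map_inv, Int.units_inv_eq_self]
  rfl

/-- The action on the empty set. -/
@[reducible]
def emptyAction : MulAction G PEmpty.{u + 1} where
  smul _ x := x
  one_smul _ := rfl
  mul_smul _ _ _ := rfl

theorem exists_eq_permChar_sub {ρ : G → ℂ} (hρ : ρ ∈ permutationCharacters G) :
    ∃ (X Y : Type u) (_ : Finite X) (_ : Finite Y) (_ : MulAction G X) (_ : MulAction G Y),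
      ρ = permChar G X - permChar G Y := by
  induction hρ using AddSubgroup.closure_induction with
  | mem χ hχ =>
    obtain ⟨X, _, _, rfl⟩ := hχ
    refine ⟨X, PEmpty, inferInstance, inferInstance, inferInstance,
      emptyAction, ?_⟩
    ext g
    rw [Pi.sub_apply, Representation.character, trace_ofMulAction]
    simp [permChar]
  | zero =>
    exact ⟨PEmpty, PEmpty, inferInstance, inferInstance,
      emptyAction,
      emptyAction, by ext g; simp [permChar]⟩
  | add χ ψ _ _ hχ hψ =>
    obtain ⟨X, Y, _, _, _, _, rfl⟩ := hχ
    obtain ⟨X', Y', _, _, _, _, rfl⟩ := hψ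
    refine ⟨X ⊕ X', Y ⊕ Y', inferInstance, inferInstance, inferInstance, inferInstance, ?_⟩
    rw [permChar_sum, permChar_sum]
    ring
  | neg χ _ hχ =>
    obtain ⟨X, Y, _, _, _, _, rfl⟩ := hχ
    exact ⟨Y, X, inferInstance, inferInstance, inferInstance, inferInstance, by ring⟩

theorem repDet_mul_conj [Finite G] (V : FDRep.{0, u} ℂ G) (g : G) :
    repDet V g * starRingEnd ℂ (repDet V g) = 1 := by
  have h : repDet V g ^ orderOf g = 1 := by
    rw [repDet, ← map_pow, ← map_pow, pow_orderOf_eq_one, map_one, map_one]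
  rw [Complex.mul_conj, Complex.normSq_eq_norm_sq,
    Complex.norm_eq_one_of_pow_eq_one h (orderOf_pos g).ne']
  simp

/-- The determinant of a virtual permutation character is the quotient of the signs. -/
theorem sgn_eq_sgn_of_hasDet_one [Finite G] {X Y : Type u} [Finite X] [Finite Y] [MulAction G X]
    [MulAction G Y] (h : HasDet (permChar G X - permChar G Y) 1) : sgn G X = sgn G Y := by
  obtain ⟨V, W, hVW, hdet⟩ := h
  ext g
  have := Module.Finite.of_basis (MonoidAlgebra.basis X ℂ)
  have := Module.Finite.of_basis (MonoidAlgebra.basis Y ℂ)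
  -- `V` and `W` need not be permutation representations. The power sums of the eigenvalues at `g`
  -- are the character values at `g ^ k`, so the identity of characters yields one of multisets, and
  -- products give determinants.
  have hms : eigenvalueMultiset (Representation.ofMulAction ℂ G X g) + eigenvalueMultiset (W.ρ g) =
      eigenvalueMultiset (Representation.ofMulAction ℂ G Y g) + eigenvalueMultiset (V.ρ g) := by
    refine multiset_eq_of_sum_pow_eq fun k => ?_
    simp only [Multiset.map_add, Multiset.sum_add, ← trace_pow_eq_sum_eigenvalueMultiset, ← map_pow]
    have := congrFun hVW (g ^ k)
    simp only [Pi.sub_apply, FDRep.character] at this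
    rw [trace_ofMulAction, trace_ofMulAction]
    linear_combination this
  have h1 := congrArg Multiset.prod hms
  simp only [Multiset.prod_add, ← det_eq_prod_eigenvalueMultiset, det_ofMulAction] at h1
  have h2 := repDet_mul_conj W g
  have h3 := hdet g
  have h4 : signFun (sgn G X) g = signFun (sgn G Y) g := by
    change signFun (sgn G X) g * repDet W g = signFun (sgn G Y) g * repDet V g at h1
    rw [Pi.one_apply] at h3
    linear_combination (starRingEnd ℂ (repDet W g)) * h1 - signFun (sgn G X) g * h2 -
      signFun (sgn G Y) g * h3
  have h5 : ((sgn G X g : ℤ) : ℂ) = (sgn G Y g : ℤ) := h4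
  exact_mod_cast h5

end

end CharInduction

theorem theorem1p2 {G : Type u} [Group G] [Fintype G] (P : Set (G → ℂ))
    (hP : ∀ χ ∈ P, χ ∈ CharInduction.generalisedCharacters G ∧ ∀ g, (χ g).im = 0)
    (h1 : ∀ τ ∈ CharInduction.generalisedCharacters G, τ 1 = 0 →
      (fun g => τ g + starRingEnd ℂ (τ g)) ∈ P)
    (h2 : ∀ (H : Subgroup G) (V : FDRep.{0, u} ℂ H), Module.finrank ℂ V = 2 →
      CharInduction.FactorsThroughBasicDihedral V →
      CharInduction.ind H (V.character - 1 - CharInduction.repDet V) ∈ P)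
    (h3 : ∀ (k : ℕ) (τ : Fin k → G → ℂ) (n : Fin k → ℤ), (∀ i, τ i ∈ P) →
      ∑ i, n i • τ i ∈ P)
    (ρ : G → ℂ) (hperm : ρ ∈ CharInduction.permutationCharacters G)
    (hdeg : ρ 1 = 0) (hdet : CharInduction.HasDet ρ 1) :
    ρ ∈ P := by
  obtain ⟨P', rfl, hP'⟩ := CharInduction.exists_admissible P h1 h2 h3
  obtain ⟨X, Y, _, _, _, _, rfl⟩ := CharInduction.exists_eq_permChar_sub hperm
  refine hP'.balancedCharacters_subset ⟨X, Y, inferInstance, inferInstance, inferInstance,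
    inferInstance, ?_, CharInduction.sgn_eq_sgn_of_hasDet_one hdet, rfl⟩
  rw [Pi.sub_apply, CharInduction.permChar_one, CharInduction.permChar_one, sub_eq_zero] at hdeg
  exact_mod_cast hdeg
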